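/- Let $K$ be a compact (smooth, boundaryless) Riemannian manifold, with no assumption on its curvature, let $I=[0,1]$, and let $\pi_1:K\times I\to K$ and $\pi_2:K\times I\to I$ be the projections. Let $\mathcal F$ be a foliated $I$-bundle structure on $K\times I$, that is, a continuous codimension-one foliation of $K\times I$ that is transverse to the fibers $\{q\}\times I$, such that the restriction of $\pi_1$ to each leaf is a covering of $K$ and such that $K\times\{0\}$ and $K\times\{1\}$ are unions of leaves. Give the leaves the smooth structure and the Riemannian metric pulled back from $K$ by $\pi_1$, so that these coverings are Riemannian coverings. Suppose that 1. $\mathcal F$ is a harmonic foliation: the height function $\pi_2$ is leafwise harmonic, i.e. its restriction to each leaf is $C^2$ and satisfies $\Delta\pi_2=0$ for the Laplace–Beltrami operator $\Delta$ of the leaf (equivalently, the leaves are locally graphs of harmonic functions on open subsets of $K$); 2. $\mathcal F$ is Lipschitz continuous: every point of $K\times I$ has a neighborhood in which the holonomy maps of $\mathcal F$ between fibers $\{q\}\times I$ and $\{q'\}\times I$, given by sliding along plaques, are Lipschitz with a constant independent of $q$ and $q'$. Then $\mathcal F$ is the product foliation: its leaves are the sets $K'\times\{t\}$ with $K'$ a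 connected component of $K$ and $t\in I$ (thus the sets $K\times\{t\}$ if $K$ is connected). -/

import Mathlib

open Bundle
open scoped Manifold ContDiff Topology NNReal

noncomputable section

/-! ### The Laplace-Beltrami operator and harmonic functions -/

section Harmonic

variable {n : ℕ} {K : Type*} [TopologicalSpace K] [ChartedSpace (EuclideanSpace ℝ (Fin n)) K]
  [IsManifold (𝓡 n) ∞ K] [RiemannianBundle (fun x : K ↦ TangentSpace (𝓡 n) x)]

/-- The matrix `g i j = ⟪∂ᵢ, ∂ⱼ⟫` of the Riemannian metric in the chart `c`, at the point with
coordinates `y`. -/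
def metricMatrix (c : OpenPartialHomeomorph K (EuclideanSpace ℝ (Fin n)))
    (y : EuclideanSpace ℝ (Fin n)) : Matrix (Fin n) (Fin n) ℝ :=
  Matrix.of fun i j ↦
    inner ℝ (mfderiv (𝓡 n) (𝓡 n) c.symm y (EuclideanSpace.single i (1 : ℝ)))
      (mfderiv (𝓡 n) (𝓡 n) c.symm y (EuclideanSpace.single j (1 : ℝ)))

/-- The density `√(det g)` of the Riemannian volume in the chart `c`. -/
def volDensity (c : OpenPartialHomeomorph K (EuclideanSpace ℝ (Fin n)))
    (y : EuclideanSpace ℝ (Fin n)) : ℝ :=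
  Real.sqrt (metricMatrix c y).det

/-- The Laplace-Beltrami operator in the chart `c`:
`Δ u = (det g)^(-1/2) ∑ i, ∂ᵢ ((det g)^(1/2) ∑ j, gⁱʲ ∂ⱼ u)`, at the point with coordinates `y`. -/
def laplaceBeltrami (c : OpenPartialHomeomorph K (EuclideanSpace ℝ (Fin n))) (u : K → ℝ)
    (y : EuclideanSpace ℝ (Fin n)) : ℝ :=
  (volDensity c y)⁻¹ *
    ∑ i, fderiv ℝ
      (fun z ↦ volDensity c z *
        ∑ j, (metricMatrix c z)⁻¹ i j *
          fderiv ℝ (u ∘ c.symm) z (EuclideanSpace.single j (1 : ℝ)))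
      y (EuclideanSpace.single i (1 : ℝ))

/-- `u` is harmonic on the open set `U`: it is `C²` there and `Δ u = 0` on `U`
(computed in the charts of the atlas). -/
def IsHarmonicOn (u : K → ℝ) (U : Set K) : Prop :=
  ContMDiffOn (𝓡 n) 𝓘(ℝ, ℝ) 2 u U ∧
    ∀ c ∈ atlas (EuclideanSpace ℝ (Fin n)) K, ∀ x ∈ U ∩ c.source, laplaceBeltrami c u (c x) = 0

end Harmonic

/-! ### Foliations -/

/-- A continuous foliation of `X`, with leaves modelled on `B` and transversals modelled on `T`:
an atlas of charts with values in `B × T` whose changes of charts have locally the form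
`(x, y) ↦ (f x y, g y)`. -/
structure Foliation (B T X : Type*) [TopologicalSpace B] [TopologicalSpace T]
    [TopologicalSpace X] where
  /-- The foliation charts. -/
  charts : Set (OpenPartialHomeomorph X (B × T))
  cover : ∀ x, ∃ e ∈ charts, x ∈ e.source
  compatible : ∀ e ∈ charts, ∀ e' ∈ charts, ∀ x ∈ e.source ∩ e'.source,
    ∃ U ∈ 𝓝 x, ∀ y ∈ U, ∀ z ∈ U, (e y).2 = (e z).2 → (e' y).2 = (e' z).2

namespace Foliation

variable {B T X : Type*} [TopologicalSpace B] [TopologicalSpace T] [TopologicalSpace X]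

/-- The leaf topology, generated by the open subsets of the plaques. -/
@[reducible]
def leafTopology (F : Foliation B T X) : TopologicalSpace X :=
  TopologicalSpace.generateFrom
    {s | ∃ e ∈ F.charts, ∃ V : Set B, IsOpen V ∧ ∃ y : T, s = e.source ∩ e ⁻¹' (V ×ˢ {y})}

/-- The leaf through `x`: its connected component in the leaf topology. -/
def leaf (F : Foliation B T X) (x : X) : Set X :=
  @connectedComponent X F.leafTopology x

end Foliation

section Bundle

variable {n : ℕ} {K : Type*} [TopologicalSpace K]

/-- A foliated `I`-bundle structure on `π₁ : K × I → K`, `I = [0, 1]`: a codimension one foliation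
of `K × I` that is transverse to the fibers `{q} × I`, such that `π₁` restricted to each leaf is a
covering of `K` and the boundary components `K × {0}` and `K × {1}` are saturated by leaves.
The leaves carry the smooth structure and the metric that make these coverings Riemannian, that is,
those pulled back from `K` by `π₁`. -/
structure IsFoliatedIBundle (F : Foliation (EuclideanSpace ℝ (Fin n)) unitInterval (K × unitInterval)) : Prop where
  /-- Near every point, `π₁` and the transverse coordinate of a foliation chart form together
  a topological chart, in which leaves are horizontal and fibers are vertical. -/
  transverse : ∀ e ∈ F.charts,
    IsLocalHomeomorphOn (fun p : K × unitInterval ↦ ((p.1, (e p).2) : K × unitInterval)) e.source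
  covering : ∀ p : K × unitInterval,
    letI : TopologicalSpace (F.leaf p) := F.leafTopology.induced Subtype.val
    IsCoveringMap (fun x : F.leaf p ↦ (x : K × unitInterval).1)
  boundary_zero : ∀ q : K, ∀ p ∈ F.leaf (q, 0), p.2 = 0
  boundary_one : ∀ q : K, ∀ p ∈ F.leaf (q, 1), p.2 = 1

/-- `f` is leafwise harmonic: it is continuous, and its restriction to each leaf is harmonic for the
pulled back metric, i.e. harmonic on `U` when composed with any section `τ` of `π₁` over an open set
`U` of `K` that is continuous for the leaf topology (the local inverses of the restrictions of `π₁`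
to the leaves). -/
def IsLeafwiseHarmonic [ChartedSpace (EuclideanSpace ℝ (Fin n)) K] [IsManifold (𝓡 n) ∞ K]
    [RiemannianBundle (fun x : K ↦ TangentSpace (𝓡 n) x)]
    (F : Foliation (EuclideanSpace ℝ (Fin n)) unitInterval (K × unitInterval)) (f : K × unitInterval → ℝ) : Prop :=
  Continuous f ∧
    ∀ (U : Set K) (τ : K → K × unitInterval), IsOpen U → (∀ q ∈ U, (τ q).1 = q) →
      @ContinuousOn K (K × unitInterval) _ F.leafTopology τ U → IsHarmonicOn (n := n) (f ∘ τ) U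

/-- A harmonic foliation of `K × I`: a foliated `I`-bundle whose height function `π₂` is leafwise
harmonic. -/
def IsHarmonicFoliation [ChartedSpace (EuclideanSpace ℝ (Fin n)) K] [IsManifold (𝓡 n) ∞ K]
    [RiemannianBundle (fun x : K ↦ TangentSpace (𝓡 n) x)]
    (F : Foliation (EuclideanSpace ℝ (Fin n)) unitInterval (K × unitInterval)) : Prop :=
  IsFoliatedIBundle F ∧ IsLeafwiseHarmonic F (fun p ↦ (p.2 : ℝ))

/-- The holonomy is Lipschitz: near every point the holonomy maps between pieces of fibers
`{q} × I` and `{q'} × I` that slide points along plaques are Lipschitz, locally uniformly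
in `q`, `q'`. -/
def IsLipschitzFoliation (F : Foliation (EuclideanSpace ℝ (Fin n)) unitInterval (K × unitInterval)) : Prop :=
  ∀ e ∈ F.charts, ∀ p ∈ e.source, ∃ U ∈ 𝓝 p, ∃ C : ℝ≥0, ∀ (q q' : K) (s t s' t' : unitInterval),
    (q, s) ∈ U → (q, t) ∈ U → (q', s') ∈ U → (q', t') ∈ U →
    (e (q, s)).2 = (e (q', s')).2 → (e (q, t)).2 = (e (q', t')).2 →
    dist s' t' ≤ C * dist s t

/-- The product foliation: the leaves are the sets `K' × {t}`, with `K'` a connected component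
of `K` (so `K × {t}` when `K` is connected). -/
def IsProductFoliation (F : Foliation (EuclideanSpace ℝ (Fin n)) unitInterval (K × unitInterval)) : Prop :=
  ∀ (q : K) (t : unitInterval), F.leaf (q, t) = connectedComponent q ×ˢ {t}

end Bundle

end

open Filter Set MeasureTheory

/-!
Over a small connected open subset of `K` the leaves are the graphs of harmonic functions `h · t`,
where `t` is the height over a base point and `h` is Lipschitz in `t`. For two harmonic functions
`u` and `v` and a cutoff `ψ`, testing harmonicity of `u` against `ψ u v` and harmonicity of `v`
against `ψ u²` gives
`∫ ψ v |∇u|² = ½ ∫ u² ⟪∇v, ∇ψ⟫ - ∫ u v ⟪∇u, ∇ψ⟫`.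
Take `u = h · t`, `v = h · (t + δ)` and integrate over `t`. The change of variable `t ↦ t - δ` in
the first integral on the right puts every gradient at `t`, so that `δ` occurs only in the values
of `h`; subtracting the case `δ = 0`, dividing by `δ` and letting `δ → 0`, which the Lipschitz
hypothesis allows, yields
`∫∫ ψ |∇π₂|² dvol ds = -2 ∫∫ π₂ ⟪∇π₂, ∇ψ⟫ dvol ds`
with `∇` the leafwise gradient and `s = h q t` the height. Neither side depends on the box, so the
identity can be summed over a partition of unity; as `∑ ∇ψⱼ = 0`, the leafwise energy of `π₂`
vanishes. Hence `∇π₂ = 0` almost everywhere; since the inverse holonomy is Lipschitz as well, this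
holds on almost every leaf of a box, and by continuity all leaves are horizontal.
-/

namespace Foliation

variable {B T X : Type*} [TopologicalSpace B] [TopologicalSpace T] [TopologicalSpace X]
  {K : Type*} [TopologicalSpace K]

theorem plaque_mem_nhds_leafTopology (F : Foliation B T X) {e : OpenPartialHomeomorph X (B × T)}
    (he : e ∈ F.charts) {V : Set B} (hV : IsOpen V) {x : X} (hx : x ∈ e.source)
    (hxV : (e x).1 ∈ V) : e.source ∩ e ⁻¹' (V ×ˢ {(e x).2}) ∈ @nhds X F.leafTopology x :=
  let := F.leafTopology
  IsOpen.mem_nhds (.basic _ ⟨e, he, V, hV, _, rfl⟩) ⟨hx, hxV, rfl⟩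

theorem exists_plaque_subset {e : OpenPartialHomeomorph X (B × T)} {x : X} (hx : x ∈ e.source)
    {s : Set X} (hs : s ∈ 𝓝 x) :
    ∃ V : Set B, IsOpen V ∧ (e x).1 ∈ V ∧ e.source ∩ e ⁻¹' (V ×ˢ {(e x).2}) ⊆ s := by
  obtain ⟨O, hOs, hO, hxO⟩ := mem_nhds_iff.1 hs
  obtain ⟨V, W, hV, -, hxV, hxW, hVW⟩ := isOpen_prod_iff.1 (e.isOpen_image_source_inter hO)
    (e x).1 (e x).2 ⟨x, ⟨hx, hxO⟩, rfl⟩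
  refine ⟨V, hV, hxV, ?_⟩
  rintro y ⟨hy, hyV, hyx : (e y).2 = (e x).2⟩
  obtain ⟨z, ⟨hz, hzO⟩, hzy⟩ := hVW (show e y ∈ V ×ˢ W from ⟨hyV, hyx ▸ hxW⟩)
  exact hOs (e.injOn hz hy hzy ▸ hzO)

theorem nhds_leafTopology (F : Foliation B T X) {e : OpenPartialHomeomorph X (B × T)}
    (he : e ∈ F.charts) {x : X} (hx : x ∈ e.source) :
    @nhds X F.leafTopology x = 𝓝[{y | (e y).2 = (e x).2}] x := by
  apply le_antisymm
  · refine le_inf (fun s hs ↦ ?_) (le_principal_iff.2 ?_)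
    · obtain ⟨V, hV, hxV, hVs⟩ := exists_plaque_subset hx hs
      exact mem_of_superset (F.plaque_mem_nhds_leafTopology he hV hx hxV) hVs
    · exact mem_of_superset (F.plaque_mem_nhds_leafTopology he isOpen_univ hx (mem_univ _))
        fun y hy ↦ hy.2.2
  · rw [TopologicalSpace.nhds_generateFrom]
    refine le_iInf₂ ?_
    rintro s ⟨hxs, e', he', V, hV, y, rfl⟩
    obtain ⟨U, hU, hUc⟩ := F.compatible e he e' he' x ⟨hx, hxs.1⟩
    have hVU : e'.source ∩ e' ⁻¹' (V ×ˢ univ) ∈ 𝓝 x :=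
      (e'.isOpen_inter_preimage (hV.prod isOpen_univ)).mem_nhds ⟨hxs.1, hxs.2.1, mem_univ _⟩
    rw [le_principal_iff]
    filter_upwards [inter_mem_inf (inter_mem hU hVU) (mem_principal_self _)]
    rintro z ⟨⟨hzU, hz, hzV, -⟩, hze⟩
    refine ⟨hz, hzV, ?_⟩
    rw [mem_singleton_iff, hUc z hzU x (mem_of_mem_nhds hU) hze]
    exact hxs.2.2

theorem leafTopology_le (F : Foliation B T X) : F.leafTopology ≤ ‹TopologicalSpace X› := by
  refine (le_iff_nhds _ _).2 fun x ↦ ?_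
  obtain ⟨e, he, hx⟩ := F.cover x
  rw [F.nhds_leafTopology he hx]
  exact inf_le_left

/-- `τ` restricted to `U` is continuous for the leaf topology. -/
def LeafContinuousOn (F : Foliation B T X) (τ : K → X)
    (U : Set K) : Prop :=
  @ContinuousOn K X _ F.leafTopology τ U

theorem LeafContinuousOn.continuousOn {F : Foliation B T X}
    {τ : K → X} {U : Set K} (h : F.LeafContinuousOn τ U) : ContinuousOn τ U :=
  fun q hq ↦ (h q hq).mono_right ((le_iff_nhds _ _).1 F.leafTopology_le _)

theorem LeafContinuousOn.eventually_eq {F : Foliation B T X}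
    {τ : K → X} {U : Set K} (h : F.LeafContinuousOn τ U) {q : K} (hq : q ∈ U)
    {e : OpenPartialHomeomorph X (B × T)} (he : e ∈ F.charts) (hx : τ q ∈ e.source) :
    ∀ᶠ q' in 𝓝[U] q, (e (τ q')).2 = (e (τ q)).2 := by
  have h1 : Tendsto τ (𝓝[U] q) (@nhds X F.leafTopology (τ q)) := h q hq
  rw [F.nhds_leafTopology he hx] at h1
  exact h1.eventually (eventually_mem_nhdsWithin)

theorem leafContinuousOn_of {F : Foliation B T X}
    {τ : K → X} {U : Set K} (hc : ContinuousOn τ U)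
    (h : ∀ q ∈ U, ∃ e ∈ F.charts, τ q ∈ e.source ∧
      ∀ᶠ q' in 𝓝[U] q, (e (τ q')).2 = (e (τ q)).2) : F.LeafContinuousOn τ U := by
  intro q hq
  obtain ⟨e, he, hx, hev⟩ := h q hq
  change Tendsto τ (𝓝[U] q) (@nhds X F.leafTopology (τ q))
  rw [F.nhds_leafTopology he hx]
  exact tendsto_inf.2 ⟨hc q hq, tendsto_principal.2 hev⟩

theorem LeafContinuousOn.congr {F : Foliation B T X}
    {τ τ' : K → X} {U : Set K} (h : F.LeafContinuousOn τ U) (h' : ∀ q ∈ U, τ' q = τ q) :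
    F.LeafContinuousOn τ' U :=
  letI := F.leafTopology
  ContinuousOn.congr h h'

theorem LeafContinuousOn.mono {F : Foliation B T X}
    {τ : K → X} {U V : Set K} (h : F.LeafContinuousOn τ U) (h' : V ⊆ U) :
    F.LeafContinuousOn τ V :=
  letI := F.leafTopology
  ContinuousOn.mono h h'

theorem LeafContinuousOn.mem_leaf {F : Foliation B T X}
    {τ : K → X} {U : Set K} (h : F.LeafContinuousOn τ U) (hU : IsPreconnected U)
    {q q' : K} (hq : q ∈ U) (hq' : q' ∈ U) : τ q' ∈ F.leaf (τ q) := by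
  let := F.leafTopology
  have h1 : IsPreconnected (τ '' U) := hU.image τ h
  exact h1.subset_connectedComponent ⟨q, hq, rfl⟩ ⟨q', hq', rfl⟩

end Foliation

section Sections

variable {n : ℕ} {K : Type*} [TopologicalSpace K]
  {F : Foliation (EuclideanSpace ℝ (Fin n)) unitInterval (K × unitInterval)}

namespace IsFoliatedIBundle

theorem exists_chart_eq (hF : IsFoliatedIBundle F) (p : K × unitInterval) :
    ∃ e ∈ F.charts, p ∈ e.source ∧
      ∃ Φ : OpenPartialHomeomorph (K × unitInterval) (K × unitInterval),
        p ∈ Φ.source ∧ ∀ x, Φ x = (x.1, (e x).2) := by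
  obtain ⟨e, he, hp⟩ := F.cover p
  obtain ⟨Φ, hΦ, hΦe⟩ := hF.transverse e he p hp
  exact ⟨e, he, hp, Φ, hΦ, fun x ↦ by rw [← hΦe]⟩

theorem section_eventuallyEq (hF : IsFoliatedIBundle F) {u v : K → unitInterval}
    {U : Set K} (hu : F.LeafContinuousOn (fun q ↦ (q, u q)) U)
    (hv : F.LeafContinuousOn (fun q ↦ (q, v q)) U) {q : K} (hq : q ∈ U) (huv : u q = v q) :
    ∀ᶠ q' in 𝓝[U] q, u q' = v q' := by
  obtain ⟨e, he, hx, Φ, hΦ, hΦe⟩ := hF.exists_chart_eq (q, u q)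
  have hx' : (q, v q) ∈ e.source := huv ▸ hx
  have hΦ' : (q, v q) ∈ Φ.source := huv ▸ hΦ
  filter_upwards [hu.eventually_eq hq he hx, hv.eventually_eq hq he hx',
    (hu.continuousOn q hq).eventually (Φ.open_source.mem_nhds hΦ),
    (hv.continuousOn q hq).eventually (Φ.open_source.mem_nhds hΦ')] with q' hu' hv' huΦ hvΦ
  have : Φ (q', u q') = Φ (q', v q') := by rw [hΦe, hΦe, hu', hv', huv]
  exact congrArg Prod.snd (Φ.injOn huΦ hvΦ this)

theorem section_eqOn (hF : IsFoliatedIBundle F) {u v : K → unitInterval}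
    {U : Set K} (hUo : IsOpen U) (hU : IsPreconnected U)
    (hu : F.LeafContinuousOn (fun q ↦ (q, u q)) U)
    (hv : F.LeafContinuousOn (fun q ↦ (q, v q)) U) {q : K} (hq : q ∈ U) (huv : u q = v q) :
    EqOn u v U := by
  have hcu : ContinuousOn u U := continuous_snd.comp_continuousOn hu.continuousOn
  have hcv : ContinuousOn v U := continuous_snd.comp_continuousOn hv.continuousOn
  have hne : IsOpen (U ∩ {x | u x ≠ v x}) :=
    (hcu.prodMk hcv).isOpen_inter_preimage hUo isClosed_diagonal.isOpen_compl
  have heq : IsOpen (U ∩ {x | u x = v x}) := isOpen_iff_mem_nhds.2 fun x hx ↦ by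
    have := hF.section_eventuallyEq hu hv hx.1 hx.2
    rw [hUo.nhdsWithin_eq hx.1] at this
    exact inter_mem (hUo.mem_nhds hx.1) this
  have := hU.subset_left_of_subset_union heq hne
    (disjoint_left.2 fun x h₁ h₂ ↦ h₂.2 h₁.2)
    (fun x hx ↦ (em (u x = v x)).imp (⟨hx, ·⟩) (⟨hx, ·⟩)) ⟨q, hq, hq, huv⟩
  exact fun q' hq' ↦ (this hq').2

theorem section_eq_zero (hF : IsFoliatedIBundle F) {u : K → unitInterval} {U : Set K}
    (hU : IsPreconnected U) (hu : F.LeafContinuousOn (fun q ↦ (q, u q)) U)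
    {q q' : K} (hq : q ∈ U) (hq' : q' ∈ U) (h : u q = 0) : u q' = 0 :=
  hF.boundary_zero q _ (h ▸ hu.mem_leaf hU hq hq')

theorem section_eq_one (hF : IsFoliatedIBundle F) {u : K → unitInterval} {U : Set K}
    (hU : IsPreconnected U) (hu : F.LeafContinuousOn (fun q ↦ (q, u q)) U)
    {q q' : K} (hq : q ∈ U) (hq' : q' ∈ U) (h : u q = 1) : u q' = 1 :=
  hF.boundary_one q _ (h ▸ hu.mem_leaf hU hq hq')

theorem exists_plaque_sections (hF : IsFoliatedIBundle F)
    {e : OpenPartialHomeomorph (K × unitInterval) (EuclideanSpace ℝ (Fin n) × unitInterval)}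
    (he : e ∈ F.charts) {q₀ : K} {t : unitInterval} (hx : (q₀, t) ∈ e.source)
    {O : Set (K × unitInterval)} (hO : O ∈ 𝓝 (q₀, t)) :
    ∃ W ∈ 𝓝 q₀, ∃ J : Set unitInterval, IsOpen J ∧ t ∈ J ∧ ∃ k : K → unitInterval → unitInterval,
      ∀ s ∈ J, k q₀ s = s ∧ ContinuousOn (k · s) W ∧
        ∀ q ∈ W, (q, k q s) ∈ O ∧ (e (q, k q s)).2 = (e (q₀, s)).2 := by
  obtain ⟨Φ, hΦ, hΦe⟩ := hF.transverse e he _ hx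
  replace hΦe : ∀ p, Φ p = (p.1, (e p).2) := fun p ↦ by rw [← hΦe]
  have hV : Φ.target ∩ Φ.symm ⁻¹' O ∈ 𝓝 (q₀, (e (q₀, t)).2) := by
    rw [← hΦe (q₀, t)]
    refine inter_mem (Φ.open_target.mem_nhds (Φ.map_source hΦ))
      ((Φ.continuousAt_symm (Φ.map_source hΦ)).preimage_mem_nhds ?_)
    rwa [Φ.left_inv hΦ]
  obtain ⟨W, hW, Y, hY, hWY⟩ := mem_nhds_prod_iff.1 hV
  have hsymm : ∀ q ∈ W, ∀ y ∈ Y, (Φ.symm (q, y)).1 = q ∧ (e (Φ.symm (q, y))).2 = y :=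
    fun q hq y hy ↦ by simpa [hΦe] using Φ.right_inv (hWY (mk_mem_prod hq hy)).1
  have hslice : ContinuousAt (fun s : unitInterval ↦ (q₀, s)) t := by fun_prop
  have hJ : ∀ᶠ s in 𝓝 t, (q₀, s) ∈ Φ.source ∧ (e (q₀, s)).2 ∈ Y :=
    (hslice.eventually (Φ.open_source.mem_nhds hΦ)).and
      (((ContinuousAt.comp (e.continuousAt hx) hslice).snd).eventually hY)
  obtain ⟨J, hJ, hJo, htJ⟩ := mem_nhds_iff.1 hJ
  refine ⟨W, hW, J, hJo, htJ, fun q s ↦ (Φ.symm (q, (e (q₀, s)).2)).2,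
    fun s hs ↦ ⟨?_, ?_, fun q hq ↦ ?_⟩⟩
  · have := Φ.left_inv (hJ hs).1
    rw [hΦe] at this
    exact congrArg Prod.snd this
  · exact continuous_snd.comp_continuousOn
      (Φ.symm.continuousOn.comp (by fun_prop) fun q hq ↦ (hWY ⟨hq, (hJ hs).2⟩).1)
  · obtain ⟨hfst, hsnd⟩ := hsymm q hq _ (hJ hs).2
    have heq : (q, (Φ.symm (q, (e (q₀, s)).2)).2) = Φ.symm (q, (e (q₀, s)).2) :=
      Prod.ext hfst.symm rfl
    rw [heq]
    exact ⟨(hWY ⟨hq, (hJ hs).2⟩).2, hsnd⟩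

theorem exists_local_sections (hF : IsFoliatedIBundle F)
    (hL : IsLipschitzFoliation F) (q₀ : K) (t : unitInterval) :
    ∃ W ∈ 𝓝 q₀, ∃ J : Set unitInterval, IsOpen J ∧ t ∈ J ∧ ∃ (C : ℝ≥0)
      (k : K → unitInterval → unitInterval),
      (∀ s ∈ J, k q₀ s = s ∧ F.LeafContinuousOn (fun q ↦ (q, k q s)) W) ∧
      ∀ s ∈ J, ∀ s' ∈ J, ∀ q ∈ W, ∀ q' ∈ W,
        dist (k q' s) (k q' s') ≤ C * dist (k q s) (k q s') := by
  obtain ⟨e, he, hx⟩ := F.cover (q₀, t)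
  obtain ⟨N, hN, C, hC⟩ := hL e he _ hx
  obtain ⟨W, hW, J, hJo, htJ, k, hk⟩ :=
    hF.exists_plaque_sections he hx (inter_mem hN (e.open_source.mem_nhds hx))
  refine ⟨W, hW, J, hJo, htJ, C, k, fun s hs ↦ ⟨(hk s hs).1, ?_⟩, fun s hs s' hs' q hq q' hq' ↦ ?_⟩
  · refine Foliation.leafContinuousOn_of (continuousOn_id.prodMk (hk s hs).2.1) fun q hq ↦
      ⟨e, he, ((hk s hs).2.2 q hq).1.2, ?_⟩
    filter_upwards [self_mem_nhdsWithin] with q' hq'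
    rw [((hk s hs).2.2 q hq).2, ((hk s hs).2.2 q' hq').2]
  · have hN := fun s hs q hq ↦ ((hk s hs).2.2 q hq).1.1
    have hplaque := fun s hs ↦ ((hk s hs).2.2 q hq).2.trans ((hk s hs).2.2 q' hq').2.symm
    exact hC q q' _ _ _ _ (hN s hs q hq) (hN s' hs' q hq) (hN s hs q' hq') (hN s' hs' q' hq')
      (hplaque s hs) (hplaque s' hs')

theorem exists_sections [LocallyConnectedSpace K] (hF : IsFoliatedIBundle F)
    (hL : IsLipschitzFoliation F) (q₀ : K) {W₀ : Set K} (hW₀ : W₀ ∈ 𝓝 q₀) :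
    ∃ U ⊆ W₀, IsOpen U ∧ IsPreconnected U ∧ q₀ ∈ U ∧
      ∃ (h : K → unitInterval → unitInterval) (C : ℝ≥0), ∃ δ > 0,
        (∀ s, h q₀ s = s ∧ F.LeafContinuousOn (fun q ↦ (q, h q s)) U) ∧
        ∀ s t, dist s t < δ → ∀ q ∈ U, ∀ q' ∈ U,
          dist (h q' s) (h q' t) ≤ C * dist (h q s) (h q t) := by
  choose W hW J hJo htJ C k hk hkC using hF.exists_local_sections hL q₀
  obtain ⟨S, hS⟩ := isCompact_univ.elim_finite_subcover J hJo
    (fun t _ ↦ mem_iUnion.2 ⟨t, htJ t⟩)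
  obtain ⟨δ, hδ, hδJ⟩ := lebesgue_number_lemma_of_metric (isCompact_univ (X := unitInterval))
    (c := fun i : S ↦ J i) (fun i ↦ hJo i) (by simpa [iUnion_subtype] using hS)
  obtain ⟨U, ⟨hUo, hqU, hUc⟩, hUW⟩ := (LocallyConnectedSpace.open_connected_basis q₀).mem_iff.1
    (inter_mem ((biInter_finset_mem S).2 fun i _ ↦ hW i) hW₀)
  have hUWi : ∀ i ∈ S, U ⊆ W i := fun i hi x hx ↦ mem_iInter₂.1 (hUW hx).1 i hi
  choose i hi using fun s : unitInterval ↦ hδJ s (mem_univ s)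
  have hself : ∀ s, s ∈ J (i s) := fun s ↦ hi s (Metric.mem_ball_self hδ)
  have hsec : ∀ s, F.LeafContinuousOn (fun q ↦ (q, k (i s) q s)) U := fun s ↦
    (hk (i s) s (hself s)).2.mono (hUWi _ (i s).2)
  have hagree : ∀ j ∈ S, ∀ s ∈ J j, ∀ q ∈ U, k (i s) q s = k j q s := fun j hj s hs ↦
    hF.section_eqOn hUo hUc.isPreconnected (hsec s) ((hk j s hs).2.mono (hUWi j hj)) hqU
      ((hk (i s) s (hself s)).1.trans (hk j s hs).1.symm)
  refine ⟨U, fun x hx ↦ (hUW hx).2, hUo, hUc.isPreconnected, hqU, fun q s ↦ k (i s) q s, S.sup C,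
    δ, hδ, fun s ↦ ⟨(hk (i s) s (hself s)).1, hsec s⟩, fun s t hst q hq q' hq' ↦ ?_⟩
  have hs : s ∈ J (i t) := hi t hst
  have hiS := (i t).2
  change dist (k (i s) q' s) (k (i t) q' t) ≤ S.sup C * dist (k (i s) q s) (k (i t) q t)
  rw [hagree _ hiS s hs q hq, hagree _ hiS s hs q' hq']
  refine (hkC (i t) s hs t (hself t) q (hUWi _ hiS hq) q' (hUWi _ hiS hq')).trans ?_
  gcongr
  exact Finset.le_sup (f := C) hiS

end IsFoliatedIBundle

/-- A product neighbourhood of the fiber over `q₀` in a foliated `I`-bundle: over the connected open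
set `U`, the leaves are the graphs of the functions `h · t`, with `t` the height over `q₀`. The
holonomy `h q` from the fiber over `q₀` to the fiber over `q` is Lipschitz, and so is locally its
inverse. -/
structure IsFoliatedBox (F : Foliation (EuclideanSpace ℝ (Fin n)) unitInterval (K × unitInterval))
    (q₀ : K) (U : Set K) (h : K → unitInterval → unitInterval) (C : ℝ≥0) : Prop where
  isOpen : IsOpen U
  isPreconnected : IsPreconnected U
  mem : q₀ ∈ U
  base : ∀ t, h q₀ t = t
  leafContinuousOn : ∀ t, F.LeafContinuousOn (fun q ↦ (q, h q t)) U
  lipschitz : ∀ q ∈ U, LipschitzWith C (h q)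
  expanding : ∀ q ∈ U, ∀ s, ∀ᶠ t in 𝓝 s, dist s t ≤ C * dist (h q s) (h q t)

theorem lipschitzWith_of_dist_lt {α β : Type*} [PseudoMetricSpace α] [PseudoMetricSpace β]
    {f : α → β} {C D : ℝ≥0} {δ : ℝ} (hδ : 0 < δ) (hD : ∀ s t, dist (f s) (f t) ≤ D)
    (hf : ∀ s t, dist s t < δ → dist (f s) (f t) ≤ C * dist s t) :
    LipschitzWith (max C (D * δ⁻¹.toNNReal)) f := by
  refine LipschitzWith.of_dist_le_mul fun s t ↦ ?_
  rcases lt_or_ge (dist s t) δ with h | h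
  · exact (hf s t h).trans (by gcongr; exact le_max_left _ _)
  · calc dist (f s) (f t) ≤ D * δ⁻¹ * δ := by
          rw [mul_assoc, inv_mul_cancel₀ hδ.ne', mul_one]; exact hD s t
      _ = (D * δ⁻¹.toNNReal : ℝ≥0) * δ := by
          rw [NNReal.coe_mul, Real.coe_toNNReal _ (inv_nonneg.2 hδ.le)]
      _ ≤ _ := by gcongr; exact le_max_right _ _

theorem unitInterval_dist_le_one (s t : unitInterval) : dist s t ≤ 1 :=
  Real.dist_le_of_mem_Icc_01 s.2 t.2

theorem IsFoliatedIBundle.exists_isFoliatedBox [LocallyConnectedSpace K]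
    (hF : IsFoliatedIBundle F) (hL : IsLipschitzFoliation F) (q₀ : K) {W₀ : Set K}
    (hW₀ : W₀ ∈ 𝓝 q₀) : ∃ U ⊆ W₀, ∃ h C, IsFoliatedBox F q₀ U h C := by
  obtain ⟨U, hUW, hUo, hUc, hqU, h, C, δ, hδ, hsec, hlip⟩ := hF.exists_sections hL q₀ hW₀
  refine ⟨U, hUW, h, max C (1 * δ⁻¹.toNNReal), hUo, hUc, hqU, fun s ↦ (hsec s).1,
    fun s ↦ (hsec s).2, fun q hq ↦ ?_, fun q hq s ↦ ?_⟩
  · refine lipschitzWith_of_dist_lt hδ (fun s t ↦ unitInterval_dist_le_one _ _) fun s t hst ↦ ?_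
    simpa only [(hsec _).1] using hlip s t hst q₀ hqU q hq
  · filter_upwards [Metric.ball_mem_nhds s hδ] with t ht
    have := hlip s t (by rwa [dist_comm]) q hq q₀ hqU
    rw [(hsec s).1, (hsec t).1] at this
    exact this.trans (by gcongr; exact le_max_left _ _)

namespace IsFoliatedBox

variable {q₀ : K} {U : Set K} {h : K → unitInterval → unitInterval} {C : ℝ≥0}

theorem zero (hB : IsFoliatedBox F q₀ U h C) (hF : IsFoliatedIBundle F) {q : K} (hq : q ∈ U) :
    h q 0 = 0 :=
  hF.section_eq_zero hB.isPreconnected (hB.leafContinuousOn 0) hB.mem hq (hB.base 0)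

theorem one (hB : IsFoliatedBox F q₀ U h C) (hF : IsFoliatedIBundle F) {q : K} (hq : q ∈ U) :
    h q 1 = 1 :=
  hF.section_eq_one hB.isPreconnected (hB.leafContinuousOn 1) hB.mem hq (hB.base 1)

theorem injective (hB : IsFoliatedBox F q₀ U h C) (hF : IsFoliatedIBundle F) {q : K} (hq : q ∈ U) :
    Function.Injective (h q) := fun s t hst ↦ by
  simpa only [hB.base] using hF.section_eqOn hB.isOpen hB.isPreconnected (hB.leafContinuousOn s)
    (hB.leafContinuousOn t) hq hst hB.mem

theorem strictMono (hB : IsFoliatedBox F q₀ U h C) (hF : IsFoliatedIBundle F) {q : K}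
    (hq : q ∈ U) : StrictMono (h q) := by
  refine ((hB.lipschitz q hq).continuous.strictMono_of_inj (hB.injective hF hq)).resolve_right
    fun hanti ↦ ?_
  have := hanti (zero_lt_one (α := unitInterval))
  rw [hB.zero hF hq, hB.one hF hq] at this
  exact this.not_ge zero_le_one

theorem surjective (hB : IsFoliatedBox F q₀ U h C) (hF : IsFoliatedIBundle F) {q : K}
    (hq : q ∈ U) : Function.Surjective (h q) := fun s ↦
  mem_range_of_exists_le_of_exists_ge (hB.lipschitz q hq).continuous
    ⟨0, by rw [hB.zero hF hq]; exact zero_le⟩ ⟨1, by rw [hB.one hF hq]; exact s.2.2⟩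

end IsFoliatedBox

theorem IsFoliatedIBundle.isLocallyConstant_snd (hF : IsFoliatedIBundle F)
    (h : ∀ (q : K) (t : unitInterval), ∃ O ∈ 𝓝 q, F.LeafContinuousOn (fun q' ↦ (q', t)) O) :
    @IsLocallyConstant _ _ F.leafTopology (Prod.snd : K × unitInterval → unitInterval) := by
  refine (@IsLocallyConstant.iff_eventually_eq _ _ F.leafTopology _).2 ?_
  rintro ⟨q, s⟩
  obtain ⟨O, hO, hcO⟩ := h q s
  obtain ⟨e, he, hx, Φ, hΦ, hΦe⟩ := hF.exists_chart_eq (q, s)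
  have hplaque : ∀ᶠ q' in 𝓝 q, (e (q', s)).2 = (e (q, s)).2 :=
    nhdsWithin_eq_nhds.2 hO ▸ hcO.eventually_eq (mem_of_mem_nhds hO) he hx
  have hsource : ∀ᶠ q' in 𝓝 q, (q', s) ∈ Φ.source :=
    (show ContinuousAt (fun q' ↦ (q', s)) q by fun_prop).eventually (Φ.open_source.mem_nhds hΦ)
  rw [F.nhds_leafTopology he hx]
  filter_upwards [mem_inf_of_left (Φ.open_source.mem_nhds hΦ),
    mem_inf_of_left (continuous_fst.continuousAt.eventually (hplaque.and hsource)),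
    mem_inf_of_right (mem_principal_self _)] with p hpΦ hpe hp
  have : Φ p = Φ (p.1, s) := by rw [hΦe, hΦe, hpe.1]; exact congrArg _ hp
  exact congrArg Prod.snd (Φ.injOn hpΦ hpe.2 this)

theorem isProductFoliation_of_constant_sections (hF : IsFoliatedIBundle F)
    (h : ∀ (q : K) (t : unitInterval), ∃ O ∈ 𝓝 q, F.LeafContinuousOn (fun q' ↦ (q', t)) O) :
    IsProductFoliation F := by
  intro q t
  apply Subset.antisymm
  · intro p hp
    have hfst : @Continuous _ _ F.leafTopology _ (Prod.fst : K × unitInterval → K) :=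
      continuous_le_dom F.leafTopology_le continuous_fst
    exact ⟨(@Continuous.image_connectedComponent_subset _ _ F.leafTopology _ _ hfst (q, t))
        (mem_image_of_mem _ hp),
      @IsLocallyConstant.apply_eq_of_isPreconnected _ _ F.leafTopology _
        (hF.isLocallyConstant_snd h) _ (@isPreconnected_connectedComponent _ F.leafTopology _) _ _
        hp (@mem_connectedComponent _ F.leafTopology _)⟩
  · rintro ⟨q', s⟩ ⟨hq', rfl : s = t⟩
    have hconst : F.LeafContinuousOn (fun q' : K ↦ (q', s)) univ := fun x _ ↦ by
      obtain ⟨O, hO, hcO⟩ := h x s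
      let := F.leafTopology
      exact (ContinuousOn.continuousAt hcO hO).continuousWithinAt
    exact (hconst.mono (subset_univ _)).mem_leaf isPreconnected_connectedComponent
      mem_connectedComponent hq'

end Sections

/-! ### Charts and the Riemannian metric -/

section Smoothness

variable {E : Type*} [NormedAddCommGroup E] [NormedSpace ℝ E] {ι : Type*} [Fintype ι]
  [DecidableEq ι] {A : E → Matrix ι ι ℝ} {s : Set E} {k : WithTop ℕ∞}

theorem contDiffOn_matrix_det (hA : ∀ i j, ContDiffOn ℝ k (fun y ↦ A y i j) s) :
    ContDiffOn ℝ k (fun y ↦ (A y).det) s := by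
  simp only [Matrix.det_apply]
  exact ContDiffOn.sum fun σ _ ↦ (contDiffOn_prod fun i _ ↦ hA _ _).const_smul _

theorem contDiffOn_matrix_inv_apply (hA : ∀ i j, ContDiffOn ℝ k (fun y ↦ A y i j) s)
    (hdet : ∀ y ∈ s, (A y).det ≠ 0) (i j : ι) : ContDiffOn ℝ k (fun y ↦ (A y)⁻¹ i j) s := by
  simp only [Matrix.inv_def, Matrix.smul_apply, Ring.inverse_eq_inv', smul_eq_mul,
    Matrix.adjugate_apply]
  refine ((contDiffOn_matrix_det hA).inv hdet).mul (contDiffOn_matrix_det fun a b ↦ ?_)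
  obtain rfl | h := eq_or_ne a j
  · simpa only [Matrix.updateRow_self] using contDiffOn_const
  · simpa only [Matrix.updateRow_ne h] using hA a b

end Smoothness

section Gram

variable {V ι : Type*} [NormedAddCommGroup V] [InnerProductSpace ℝ V] [Fintype ι] [DecidableEq ι]

theorem inner_eq_sum_gram_inv (b : Module.Basis ι ℝ V) (v w : V) :
    inner ℝ v w =
      ∑ i, ∑ j, (Matrix.gram ℝ b)⁻¹ i j * (inner ℝ v (b i) * inner ℝ w (b j)) := by
  have hdet : IsUnit (Matrix.gram ℝ b).det :=
    (Matrix.posDef_gram_of_linearIndependent b.linearIndependent).det_pos.ne'.isUnit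
  set G := Matrix.gram ℝ b with hG
  have hw : w = ∑ i, (G⁻¹.mulVec fun j ↦ inner ℝ w (b j)) i • b i := by
    refine InnerProductSpace.ext_inner_right_basis b fun k ↦ ?_
    have hk : ∀ i, inner ℝ (b i) (b k) = G k i := fun i ↦ by
      rw [hG, Matrix.gram_apply, real_inner_comm]
    have hsum := congrFun (Matrix.mulVec_mulVec (fun j ↦ inner ℝ w (b j)) G G⁻¹) k
    rw [Matrix.mul_nonsing_inv _ hdet, Matrix.one_mulVec] at hsum
    simp only [sum_inner, real_inner_smul_left, hk, ← hsum, Matrix.mulVec, dotProduct]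
    exact Finset.sum_congr rfl fun i _ ↦ mul_comm _ _
  conv_lhs => rw [hw]
  simp only [inner_sum, real_inner_smul_right, Matrix.mulVec, dotProduct, Finset.sum_mul]
  exact Finset.sum_congr rfl fun i _ ↦ Finset.sum_congr rfl fun j _ ↦ by ring

end Gram

section Transition

variable {n : ℕ} {K : Type*} [TopologicalSpace K]
  {c c' : OpenPartialHomeomorph K (EuclideanSpace ℝ (Fin n))}

/-- The change of coordinates from the chart `c` to the chart `c'`. -/
def transition (c c' : OpenPartialHomeomorph K (EuclideanSpace ℝ (Fin n)))
    (y : EuclideanSpace ℝ (Fin n)) : EuclideanSpace ℝ (Fin n) := c' (c.symm y)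

theorem symm_transition {y : EuclideanSpace ℝ (Fin n)} (hy : c.symm y ∈ c'.source) :
    c'.symm (transition c c' y) = c.symm y :=
  c'.left_inv hy

/-- The Jacobian matrix at `y` of the change of coordinates from `c` to `c'`. -/
noncomputable def transitionMatrix (c c' : OpenPartialHomeomorph K (EuclideanSpace ℝ (Fin n)))
    (y : EuclideanSpace ℝ (Fin n)) : Matrix (Fin n) (Fin n) ℝ :=
  Matrix.of fun k i ↦ fderiv ℝ (transition c c') y (EuclideanSpace.single i (1 : ℝ)) k

theorem euclideanSpace_eq_sum_single (v : EuclideanSpace ℝ (Fin n)) :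
    v = ∑ k, v k • EuclideanSpace.single k (1 : ℝ) := by
  ext i
  simp [Pi.single_apply]

theorem det_transitionMatrix (y : EuclideanSpace ℝ (Fin n)) :
    (transitionMatrix c c' y).det = (fderiv ℝ (transition c c') y).det := by
  rw [ContinuousLinearMap.det,
    ← LinearMap.det_toMatrix (EuclideanSpace.basisFun (Fin n) ℝ).toBasis]
  congr 1

end Transition

section Charts

variable {n : ℕ} {K : Type*} [TopologicalSpace K] [ChartedSpace (EuclideanSpace ℝ (Fin n)) K]
  [IsManifold (𝓡 n) ∞ K] {c c' : OpenPartialHomeomorph K (EuclideanSpace ℝ (Fin n))}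
  {y : EuclideanSpace ℝ (Fin n)}

theorem contMDiffOn_atlas (hc : c ∈ atlas (EuclideanSpace ℝ (Fin n)) K) :
    ContMDiffOn (𝓡 n) (𝓡 n) ∞ c c.source :=
  contMDiffOn_of_mem_maximalAtlas (IsManifold.subset_maximalAtlas hc)

theorem contMDiffOn_atlas_symm (hc : c ∈ atlas (EuclideanSpace ℝ (Fin n)) K) :
    ContMDiffOn (𝓡 n) (𝓡 n) ∞ c.symm c.target :=
  contMDiffOn_symm_of_mem_maximalAtlas (IsManifold.subset_maximalAtlas hc)

theorem mdifferentiableAt_of_mem_atlas (hc : c ∈ atlas (EuclideanSpace ℝ (Fin n)) K) {q : K}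
    (hq : q ∈ c.source) : MDifferentiableAt (𝓡 n) (𝓡 n) c q :=
  ((contMDiffOn_atlas hc).contMDiffAt (c.open_source.mem_nhds hq)).mdifferentiableAt (by simp)

theorem mdifferentiableAt_symm_of_mem_atlas (hc : c ∈ atlas (EuclideanSpace ℝ (Fin n)) K)
    (hy : y ∈ c.target) : MDifferentiableAt (𝓡 n) (𝓡 n) c.symm y :=
  ((contMDiffOn_atlas_symm hc).contMDiffAt (c.open_target.mem_nhds hy)).mdifferentiableAt (by simp)

theorem differentiableAt_transition (hc : c ∈ atlas (EuclideanSpace ℝ (Fin n)) K)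
    (hc' : c' ∈ atlas (EuclideanSpace ℝ (Fin n)) K) (hy : y ∈ c.target)
    (hy' : c.symm y ∈ c'.source) : DifferentiableAt ℝ (transition c c') y := by
  rw [← mdifferentiableAt_iff_differentiableAt]
  exact (mdifferentiableAt_of_mem_atlas hc' hy').comp y
    (mdifferentiableAt_symm_of_mem_atlas hc hy)

theorem mfderiv_symm_transition (hc : c ∈ atlas (EuclideanSpace ℝ (Fin n)) K)
    (hc' : c' ∈ atlas (EuclideanSpace ℝ (Fin n)) K) (hy : y ∈ c.target)
    (hy' : c.symm y ∈ c'.source) (v : EuclideanSpace ℝ (Fin n)) :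
    (mfderiv (𝓡 n) (𝓡 n) c.symm y v : EuclideanSpace ℝ (Fin n)) =
      (mfderiv (𝓡 n) (𝓡 n) c'.symm (transition c c' y) (fderiv ℝ (transition c c') y v) :
        EuclideanSpace ℝ (Fin n)) := by
  have heq : c.symm =ᶠ[𝓝 y] c'.symm ∘ transition c c' := by
    filter_upwards [(c.symm.continuousAt hy).eventually (c'.open_source.mem_nhds hy')] with z hz
    exact (symm_transition hz).symm
  rw [heq.mfderiv_eq, mfderiv_comp y (mdifferentiableAt_symm_of_mem_atlas hc' (c'.map_source hy'))
    (differentiableAt_transition hc hc' hy hy').mdifferentiableAt, mfderiv_eq_fderiv]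
  rfl

theorem mfderiv_symm_injective (hc : c ∈ atlas (EuclideanSpace ℝ (Fin n)) K)
    (hy : y ∈ c.target) : Function.Injective (mfderiv (𝓡 n) (𝓡 n) c.symm y) := by
  have heq : c ∘ c.symm =ᶠ[𝓝 y] id := by
    filter_upwards [c.open_target.mem_nhds hy] with z hz using c.right_inv hz
  have hcomp := mfderiv_comp y (mdifferentiableAt_of_mem_atlas hc (c.map_target hy))
    (mdifferentiableAt_symm_of_mem_atlas hc hy)
  rw [heq.mfderiv_eq, mfderiv_id] at hcomp
  exact Function.LeftInverse.injective (g := mfderiv (𝓡 n) (𝓡 n) c (c.symm y))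
    fun v ↦ (DFunLike.congr_fun hcomp v).symm

end Charts

section Frame

variable {n : ℕ} {K : Type*} [TopologicalSpace K] [ChartedSpace (EuclideanSpace ℝ (Fin n)) K]
  {c c' : OpenPartialHomeomorph K (EuclideanSpace ℝ (Fin n))} {y : EuclideanSpace ℝ (Fin n)}

/-- The coordinate vector field `∂ᵢ` of the chart `c`, at the point with coordinates `y`. -/
noncomputable def chartFrame (c : OpenPartialHomeomorph K (EuclideanSpace ℝ (Fin n)))
    (y : EuclideanSpace ℝ (Fin n)) (i : Fin n) : TangentSpace (𝓡 n) (c.symm y) :=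
  mfderiv (𝓡 n) (𝓡 n) c.symm y (EuclideanSpace.single i (1 : ℝ))

variable [IsManifold (𝓡 n) ∞ K]

theorem linearIndependent_chartFrame (hc : c ∈ atlas (EuclideanSpace ℝ (Fin n)) K)
    (hy : y ∈ c.target) : LinearIndependent ℝ (chartFrame c y) := by
  have hbasis : LinearIndependent ℝ fun i : Fin n ↦ EuclideanSpace.single i (1 : ℝ) := by
    simpa [← funext (EuclideanSpace.basisFun_apply (Fin n) ℝ)] using
      (EuclideanSpace.basisFun (Fin n) ℝ).toBasis.linearIndependent
  exact hbasis.map' (mfderiv (𝓡 n) (𝓡 n) c.symm y).toLinearMap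
    (LinearMap.ker_eq_bot.2 (mfderiv_symm_injective hc hy))

theorem chartFrame_eq_sum_transitionMatrix (hc : c ∈ atlas (EuclideanSpace ℝ (Fin n)) K)
    (hc' : c' ∈ atlas (EuclideanSpace ℝ (Fin n)) K) (hy : y ∈ c.target)
    (hy' : c.symm y ∈ c'.source) (i : Fin n) :
    (chartFrame c y i : EuclideanSpace ℝ (Fin n)) =
      (∑ k, transitionMatrix c c' y k i • chartFrame c' (transition c c' y) k :
        TangentSpace (𝓡 n) (c'.symm (transition c c' y))) := by
  rw [chartFrame, mfderiv_symm_transition hc hc' hy hy']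
  conv_lhs => rw [euclideanSpace_eq_sum_single
    (fderiv ℝ (transition c c') y (EuclideanSpace.single i (1 : ℝ)))]
  exact (map_sum (mfderiv (𝓡 n) (𝓡 n) c'.symm (transition c c' y)) _ _).trans
    (Finset.sum_congr rfl fun k _ ↦ map_smul _ _ _)

theorem contMDiffOn_chartFrame (hc : c ∈ atlas (EuclideanSpace ℝ (Fin n)) K) (i : Fin n) :
    ContMDiffOn (𝓡 n) (𝓡 n).tangent ∞
      (fun y ↦ (⟨c.symm y, chartFrame c y i⟩ : TangentBundle (𝓡 n) K)) c.target := by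
  have hsymm := (contMDiffOn_atlas_symm hc).contMDiffOn_tangentMapWithin (m := ∞) (by simp)
    c.open_target.uniqueMDiffOn
  have hsingle : ContMDiff (𝓡 n) (𝓡 n).tangent ∞ (fun y : EuclideanSpace ℝ (Fin n) ↦
      (⟨y, EuclideanSpace.single i (1 : ℝ)⟩ : TangentBundle (𝓡 n) (EuclideanSpace ℝ (Fin n)))) :=
    contMDiff_vectorSpace_iff_contDiff.2 contDiff_const
  refine (hsymm.comp hsingle.contMDiffOn fun y hy ↦ hy).congr fun y hy ↦ ?_
  simp only [Function.comp_apply, tangentMapWithin, chartFrame]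
  rw [mfderivWithin_of_isOpen c.open_target hy]

end Frame

section Metric

variable {n : ℕ} {K : Type*} [TopologicalSpace K] [ChartedSpace (EuclideanSpace ℝ (Fin n)) K]
  [RiemannianBundle (fun x : K ↦ TangentSpace (𝓡 n) x)]
  {c c' : OpenPartialHomeomorph K (EuclideanSpace ℝ (Fin n))} {y : EuclideanSpace ℝ (Fin n)}

theorem metricMatrix_eq_gram (c : OpenPartialHomeomorph K (EuclideanSpace ℝ (Fin n)))
    (y : EuclideanSpace ℝ (Fin n)) : metricMatrix c y = Matrix.gram ℝ (chartFrame c y) :=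
  rfl

theorem inner_tangentSpace_congr {p p' : K} (h : p = p') (v w : EuclideanSpace ℝ (Fin n)) :
    @inner ℝ (TangentSpace (𝓡 n) p) _ v w = @inner ℝ (TangentSpace (𝓡 n) p') _ v w := by
  subst h
  rfl

variable [IsManifold (𝓡 n) ∞ K]

theorem metricMatrix_posDef (hc : c ∈ atlas (EuclideanSpace ℝ (Fin n)) K) (hy : y ∈ c.target) :
    (metricMatrix c y).PosDef :=
  Matrix.posDef_gram_of_linearIndependent (linearIndependent_chartFrame hc hy)

theorem metricMatrix_transition (hc : c ∈ atlas (EuclideanSpace ℝ (Fin n)) K)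
    (hc' : c' ∈ atlas (EuclideanSpace ℝ (Fin n)) K) (hy : y ∈ c.target)
    (hy' : c.symm y ∈ c'.source) :
    metricMatrix c y = (transitionMatrix c c' y).transpose *
      metricMatrix c' (transition c c' y) * transitionMatrix c c' y := by
  ext i j
  refine (inner_tangentSpace_congr (symm_transition hy').symm _ _).trans
    ((congrArg₂ (@inner ℝ (TangentSpace (𝓡 n) (c'.symm (transition c c' y))) _)
      (chartFrame_eq_sum_transitionMatrix hc hc' hy hy' i)
      (chartFrame_eq_sum_transitionMatrix hc hc' hy hy' j)).trans ?_)
  simp only [sum_inner, inner_sum, Matrix.mul_apply, Matrix.transpose_apply,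
    real_inner_smul_left, real_inner_smul_right, Finset.sum_mul, metricMatrix_eq_gram,
    Matrix.gram_apply]
  exact Finset.sum_congr rfl fun k _ ↦ Finset.sum_congr rfl fun l _ ↦ by
    rw [real_inner_comm]
    ring

theorem volDensity_pos (hc : c ∈ atlas (EuclideanSpace ℝ (Fin n)) K) (hy : y ∈ c.target) :
    0 < volDensity c y :=
  Real.sqrt_pos.2 (metricMatrix_posDef hc hy).det_pos

theorem volDensity_transition (hc : c ∈ atlas (EuclideanSpace ℝ (Fin n)) K)
    (hc' : c' ∈ atlas (EuclideanSpace ℝ (Fin n)) K) (hy : y ∈ c.target)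
    (hy' : c.symm y ∈ c'.source) :
    volDensity c y = |(fderiv ℝ (transition c c') y).det| * volDensity c' (transition c c' y) := by
  rw [volDensity, metricMatrix_transition hc hc' hy hy', Matrix.det_mul, Matrix.det_mul,
    Matrix.det_transpose, det_transitionMatrix, mul_right_comm, ← sq,
    Real.sqrt_mul (sq_nonneg _), Real.sqrt_sq_eq_abs, volDensity]

variable [IsContMDiffRiemannianBundle (𝓡 n) ∞ (EuclideanSpace ℝ (Fin n))
  (fun x : K ↦ TangentSpace (𝓡 n) x)]

theorem contDiffOn_metricMatrix (hc : c ∈ atlas (EuclideanSpace ℝ (Fin n)) K) (i j : Fin n) :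
    ContDiffOn ℝ ∞ (fun y ↦ metricMatrix c y i j) c.target :=
  ((contMDiffOn_chartFrame hc i).inner_bundle (contMDiffOn_chartFrame hc j)).contDiffOn

theorem contDiffOn_volDensity (hc : c ∈ atlas (EuclideanSpace ℝ (Fin n)) K) :
    ContDiffOn ℝ ∞ (volDensity c) c.target :=
  (contDiffOn_matrix_det (contDiffOn_metricMatrix hc)).sqrt
    fun _ hy ↦ (metricMatrix_posDef hc hy).det_pos.ne'

theorem aemeasurable_ofReal_volDensity (hc : c ∈ atlas (EuclideanSpace ℝ (Fin n)) K) :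
    AEMeasurable (fun y ↦ ENNReal.ofReal (volDensity c y)) (volume.restrict c.target) :=
  ((contDiffOn_volDensity hc).continuousOn.aemeasurable
    c.open_target.measurableSet).ennreal_ofReal

theorem contDiffOn_metricMatrix_inv (hc : c ∈ atlas (EuclideanSpace ℝ (Fin n)) K) (i j : Fin n) :
    ContDiffOn ℝ ∞ (fun y ↦ (metricMatrix c y)⁻¹ i j) c.target :=
  contDiffOn_matrix_inv_apply (contDiffOn_metricMatrix hc)
    (fun _ hy ↦ (metricMatrix_posDef hc hy).det_pos.ne') i j

end Metric

section Gradient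

variable {n : ℕ} {K : Type*} [TopologicalSpace K] [ChartedSpace (EuclideanSpace ℝ (Fin n)) K]
  [RiemannianBundle (fun x : K ↦ TangentSpace (𝓡 n) x)]
  {c : OpenPartialHomeomorph K (EuclideanSpace ℝ (Fin n))} {y : EuclideanSpace ℝ (Fin n)}

instance (q : K) : FiniteDimensional ℝ (TangentSpace (𝓡 n) q) :=
  inferInstanceAs (FiniteDimensional ℝ (EuclideanSpace ℝ (Fin n)))

instance (q : K) : CompleteSpace (TangentSpace (𝓡 n) q) :=
  FiniteDimensional.complete ℝ _

/-- The Riemannian gradient of `u` at `q`: the tangent vector dual to the differential of `u`. -/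
noncomputable def riemannianGradient (u : K → ℝ) (q : K) : TangentSpace (𝓡 n) q :=
  (InnerProductSpace.toDual ℝ (TangentSpace (𝓡 n) q)).symm (mvfderiv (𝓡 n) u q)

theorem inner_riemannianGradient (u : K → ℝ) (q : K) (v : TangentSpace (𝓡 n) q) :
    inner ℝ (riemannianGradient u q) v = mvfderiv (𝓡 n) u q v :=
  InnerProductSpace.toDual_symm_apply (𝕜 := ℝ) (E := TangentSpace (𝓡 n) q)

theorem riemannianGradient_congr {u v : K → ℝ} {q : K} (h : u =ᶠ[𝓝 q] v) :
    riemannianGradient (n := n) u q = riemannianGradient v q := by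
  rw [riemannianGradient, riemannianGradient, mvfderiv, mvfderiv, h.mfderiv_eq]
  rfl

theorem riemannianGradient_const (r : ℝ) (q : K) :
    riemannianGradient (n := n) (fun _ ↦ r) q = 0 := by
  rw [riemannianGradient, mvfderiv_const, map_zero]

theorem riemannianGradient_sum {ι : Type*} {s : Finset ι} {u : ι → K → ℝ} {q : K}
    (hu : ∀ i ∈ s, MDifferentiableAt (𝓡 n) 𝓘(ℝ, ℝ) (u i) q) :
    riemannianGradient (∑ i ∈ s, u i) q = ∑ i ∈ s, riemannianGradient (n := n) (u i) q := by
  have hsum : MDifferentiableAt (𝓡 n) 𝓘(ℝ, ℝ) (∑ i ∈ s, u i) q ∧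
      mvfderiv (𝓡 n) (∑ i ∈ s, u i) q = ∑ i ∈ s, mvfderiv (𝓡 n) (u i) q := by
    classical
    induction s using Finset.induction_on with
    | empty => exact ⟨mdifferentiableAt_const, by simp [mvfderiv_zero]⟩
    | insert i s hi ih =>
      obtain ⟨hdiff, heq⟩ := ih fun j hj ↦ hu j (Finset.mem_insert_of_mem hj)
      rw [Finset.sum_insert hi, Finset.sum_insert hi]
      have hui := hu i (Finset.mem_insert_self i s)
      exact ⟨hui.add hdiff, by rw [mvfderiv_add hui hdiff, heq]⟩
  simp only [riemannianGradient, hsum.2, map_sum]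

end Gradient

section CovectorForm

variable {E ι : Type*} [NormedAddCommGroup E] [NormedSpace ℝ E] [Fintype ι] [DecidableEq ι]

/-- The bilinear form `(ξ, η) ↦ ∑ i j, Aᵢⱼ ξ(eᵢ) η(eⱼ)` on the covectors of `E`. -/
noncomputable def covectorForm (e : ι → E) (A : Matrix ι ι ℝ) :
    LinearMap.BilinForm ℝ (E →L[ℝ] ℝ) :=
  A.toBilin'.comp (.pi fun i ↦ (ContinuousLinearMap.apply ℝ ℝ (e i)).toLinearMap)
    (.pi fun i ↦ (ContinuousLinearMap.apply ℝ ℝ (e i)).toLinearMap)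

theorem covectorForm_apply (e : ι → E) (A : Matrix ι ι ℝ) (ξ η : E →L[ℝ] ℝ) :
    covectorForm e A ξ η = ∑ i, ∑ j, ξ (e i) * A i j * η (e j) :=
  Matrix.toBilin'_apply ..

theorem covectorForm_smul (e : ι → E) (r : ℝ) (A : Matrix ι ι ℝ) :
    covectorForm e (r • A) = r • covectorForm e A := by
  ext ξ η
  simp [covectorForm]

theorem continuousOn_covectorForm {X : Type*} [TopologicalSpace X] {s : Set X} (e : ι → E)
    {A : X → Matrix ι ι ℝ} (hA : ∀ i j, ContinuousOn (fun x ↦ A x i j) s) :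
    ContinuousOn (fun p : X × (E →L[ℝ] ℝ) × (E →L[ℝ] ℝ) ↦ covectorForm e (A p.1) p.2.1 p.2.2)
      (s ×ˢ univ) := by
  simp only [covectorForm_apply]
  refine continuousOn_finsetSum _ fun i _ ↦ continuousOn_finsetSum _ fun j _ ↦ ?_
  have hAij : ContinuousOn (fun p : X × (E →L[ℝ] ℝ) × (E →L[ℝ] ℝ) ↦ A p.1 i j) (s ×ˢ univ) :=
    (hA i j).comp continuousOn_fst fun p hp ↦ hp.1
  have heval : ∀ k, Continuous fun ξ : E →L[ℝ] ℝ ↦ ξ (e k) := fun k ↦ by fun_prop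
  exact (((heval i).comp continuous_snd.fst).continuousOn.mul hAij).mul
    ((heval j).comp continuous_snd.snd).continuousOn

end CovectorForm

section EnergyForm

variable {n : ℕ} {K : Type*} [TopologicalSpace K] [ChartedSpace (EuclideanSpace ℝ (Fin n)) K]
  [RiemannianBundle (fun x : K ↦ TangentSpace (𝓡 n) x)]
  {c : OpenPartialHomeomorph K (EuclideanSpace ℝ (Fin n))} {y : EuclideanSpace ℝ (Fin n)}

/-- The inner product `⟪ξ, η⟫ = ∑ i j, gⁱʲ ξᵢ ηⱼ` of covectors in the chart `c`. -/
noncomputable def cometric (c : OpenPartialHomeomorph K (EuclideanSpace ℝ (Fin n)))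
    (y : EuclideanSpace ℝ (Fin n)) :
    LinearMap.BilinForm ℝ (EuclideanSpace ℝ (Fin n) →L[ℝ] ℝ) :=
  covectorForm (fun i ↦ EuclideanSpace.single i 1) (metricMatrix c y)⁻¹

/-- The cometric weighted by the Riemannian volume density, so that integrating
`energyForm c y (Du) (Dv)` in coordinates gives the Dirichlet form `∫ ⟪∇u, ∇v⟫ dvol`. -/
noncomputable def energyForm (c : OpenPartialHomeomorph K (EuclideanSpace ℝ (Fin n)))
    (y : EuclideanSpace ℝ (Fin n)) :
    LinearMap.BilinForm ℝ (EuclideanSpace ℝ (Fin n) →L[ℝ] ℝ) :=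
  covectorForm (fun i ↦ EuclideanSpace.single i 1) (volDensity c y • (metricMatrix c y)⁻¹)

theorem cometric_apply (ξ η : EuclideanSpace ℝ (Fin n) →L[ℝ] ℝ) :
    cometric c y ξ η = ∑ i, ∑ j, ξ (EuclideanSpace.single i (1 : ℝ)) *
      (metricMatrix c y)⁻¹ i j * η (EuclideanSpace.single j (1 : ℝ)) :=
  covectorForm_apply ..

theorem energyForm_apply (ξ η : EuclideanSpace ℝ (Fin n) →L[ℝ] ℝ) :
    energyForm c y ξ η = volDensity c y * cometric c y ξ η := by
  rw [energyForm, covectorForm_smul]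
  rfl

variable [IsManifold (𝓡 n) ∞ K]

theorem inner_riemannianGradient_eq_cometric (hc : c ∈ atlas (EuclideanSpace ℝ (Fin n)) K)
    (hy : y ∈ c.target) {u v : K → ℝ} (hu : MDifferentiableAt (𝓡 n) 𝓘(ℝ, ℝ) u (c.symm y))
    (hv : MDifferentiableAt (𝓡 n) 𝓘(ℝ, ℝ) v (c.symm y)) :
    inner ℝ (riemannianGradient (n := n) u (c.symm y)) (riemannianGradient v (c.symm y)) =
      cometric c y (fderiv ℝ (u ∘ c.symm) y) (fderiv ℝ (v ∘ c.symm) y) := by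
  have hframe : ∀ {w : K → ℝ}, MDifferentiableAt (𝓡 n) 𝓘(ℝ, ℝ) w (c.symm y) → ∀ i,
      inner ℝ (riemannianGradient w (c.symm y)) (chartFrame c y i) =
        fderiv ℝ (w ∘ c.symm) y (EuclideanSpace.single i 1) := fun {w} hw i ↦ by
    rw [inner_riemannianGradient, chartFrame, ← mfderiv_eq_fderiv,
      mfderiv_comp y hw (mdifferentiableAt_symm_of_mem_atlas hc hy)]
    rfl
  let b : Module.Basis (Fin n) ℝ (TangentSpace (𝓡 n) (c.symm y)) :=
    basisOfLinearIndependentOfCardEqFinrank' _ (linearIndependent_chartFrame hc hy) (by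
      rw [Fintype.card_fin]
      exact finrank_euclideanSpace_fin.symm)
  have hb : ⇑b = chartFrame c y := coe_basisOfLinearIndependentOfCardEqFinrank' ..
  rw [inner_eq_sum_gram_inv b, cometric_apply, hb, ← metricMatrix_eq_gram]
  simp only [hframe hu, hframe hv]
  exact Finset.sum_congr rfl fun i _ ↦ Finset.sum_congr rfl fun j _ ↦ by ring

theorem cometric_symm (hc : c ∈ atlas (EuclideanSpace ℝ (Fin n)) K) (hy : y ∈ c.target)
    (ξ η : EuclideanSpace ℝ (Fin n) →L[ℝ] ℝ) : cometric c y ξ η = cometric c y η ξ := by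
  have hinv : ∀ i j, (metricMatrix c y)⁻¹ i j = (metricMatrix c y)⁻¹ j i := fun i j ↦ by
    simpa using (metricMatrix_posDef hc hy).inv.isHermitian.apply j i
  rw [cometric_apply, cometric_apply, Finset.sum_comm]
  refine Finset.sum_congr rfl fun i _ ↦ Finset.sum_congr rfl fun j _ ↦ ?_
  rw [hinv]
  ring

theorem cometric_self_nonneg (hc : c ∈ atlas (EuclideanSpace ℝ (Fin n)) K) (hy : y ∈ c.target)
    (ξ : EuclideanSpace ℝ (Fin n) →L[ℝ] ℝ) : 0 ≤ cometric c y ξ ξ := by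
  refine ((metricMatrix_posDef hc hy).inv.posSemidef.dotProduct_mulVec_nonneg
    fun i ↦ ξ (EuclideanSpace.single i 1)).trans_eq ?_
  simp only [cometric_apply, dotProduct, Matrix.mulVec, Finset.mul_sum, Pi.star_apply,
    star_trivial]
  exact Finset.sum_congr rfl fun i _ ↦ Finset.sum_congr rfl fun j _ ↦ by ring

theorem energyForm_symm (hc : c ∈ atlas (EuclideanSpace ℝ (Fin n)) K) (hy : y ∈ c.target)
    (ξ η : EuclideanSpace ℝ (Fin n) →L[ℝ] ℝ) : energyForm c y ξ η = energyForm c y η ξ := by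
  rw [energyForm_apply, energyForm_apply, cometric_symm hc hy]

theorem energyForm_self_nonneg (hc : c ∈ atlas (EuclideanSpace ℝ (Fin n)) K) (hy : y ∈ c.target)
    (ξ : EuclideanSpace ℝ (Fin n) →L[ℝ] ℝ) : 0 ≤ energyForm c y ξ ξ := by
  rw [energyForm_apply]
  exact mul_nonneg (volDensity_pos hc hy).le (cometric_self_nonneg hc hy ξ)

theorem continuousOn_energyForm [IsContMDiffRiemannianBundle (𝓡 n) ∞ (EuclideanSpace ℝ (Fin n))
      (fun x : K ↦ TangentSpace (𝓡 n) x)] (hc : c ∈ atlas (EuclideanSpace ℝ (Fin n)) K) :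
    ContinuousOn (fun p : EuclideanSpace ℝ (Fin n) × (EuclideanSpace ℝ (Fin n) →L[ℝ] ℝ) ×
      (EuclideanSpace ℝ (Fin n) →L[ℝ] ℝ) ↦ energyForm c p.1 p.2.1 p.2.2) (c.target ×ˢ univ) :=
  continuousOn_covectorForm (A := fun y ↦ volDensity c y • (metricMatrix c y)⁻¹)
    (fun i ↦ EuclideanSpace.single i 1) fun i j ↦
    (contDiffOn_volDensity hc).continuousOn.mul (contDiffOn_metricMatrix_inv hc i j).continuousOn

end EnergyForm

section IntegrationByParts

variable {E : Type*} [NormedAddCommGroup E] [MeasurableSpace E] [BorelSpace E] {μ : Measure E}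
  [IsFiniteMeasureOnCompacts μ] {f g : E → ℝ} {Ω : Set E}

theorem integrable_of_continuousOn_of_tsupport_subset (hfc : HasCompactSupport f)
    (hfs : tsupport f ⊆ Ω) (hg : ContinuousOn g Ω) (hg0 : ∀ x ∉ tsupport f, g x = 0) :
    Integrable g μ :=
  ((hg.mono hfs).integrableOn_compact hfc).integrable_of_forall_notMem_eq_zero hg0

theorem integrable_mul_of_hasCompactSupport (hf : Continuous f)
    (hfc : HasCompactSupport f) (hfs : tsupport f ⊆ Ω) (hg : ContinuousOn g Ω) :
    Integrable (fun x ↦ f x * g x) μ :=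
  integrable_of_continuousOn_of_tsupport_subset hfc hfs (hf.continuousOn.mul hg)
    fun x hx ↦ by rw [image_eq_zero_of_notMem_tsupport hx, zero_mul]

variable [NormedSpace ℝ E]

theorem integrable_fderiv_mul_of_hasCompactSupport (hf : ContDiff ℝ 1 f)
    (hfc : HasCompactSupport f) (hfs : tsupport f ⊆ Ω) (hg : ContinuousOn g Ω) (v : E) :
    Integrable (fun x ↦ fderiv ℝ f x v * g x) μ :=
  integrable_of_continuousOn_of_tsupport_subset hfc hfs
    (((hf.continuous_fderiv one_ne_zero).clm_apply continuous_const).continuousOn.mul hg)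
    fun x hx ↦ by simp [fderiv_of_notMem_tsupport ℝ hx]

/-- Each component of the vector field is only assumed to be differentiable near the support of
`f`, since the coefficients in a chart are only controlled on its target. -/
theorem integral_sum_fderiv_mul_eq_neg [FiniteDimensional ℝ E] {μ : Measure E}
    [μ.IsAddHaarMeasure] {ι : Type*} [Fintype ι]
    {X : ι → E → ℝ} (hΩ : IsOpen Ω) (hf : ContDiff ℝ 1 f) (hfc : HasCompactSupport f)
    (hfs : tsupport f ⊆ Ω) (hX : ∀ i, ContDiffOn ℝ 1 (X i) Ω) (v : ι → E) :
    ∫ x, ∑ i, fderiv ℝ f x (v i) * X i x ∂μ =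
      -∫ x, f x * ∑ i, fderiv ℝ (X i) x (v i) ∂μ := by
  have hdX : ∀ i, ContinuousOn (fun x ↦ fderiv ℝ (X i) x (v i)) Ω := fun i ↦
    ((hX i).continuousOn_fderiv_of_isOpen hΩ le_rfl).clm_apply continuousOn_const
  have hleft := fun i ↦ integrable_fderiv_mul_of_hasCompactSupport (μ := μ) hf hfc hfs
    (hX i).continuousOn (v i)
  have hright := fun i ↦ integrable_mul_of_hasCompactSupport (μ := μ) hf.continuous hfc hfs (hdX i)
  simp only [Finset.mul_sum]
  rw [integral_finsetSum _ fun i _ ↦ hleft i, integral_finsetSum _ fun i _ ↦ hright i,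
    ← Finset.sum_neg_distrib]
  refine Finset.sum_congr rfl fun i _ ↦ ?_
  rw [integral_mul_fderiv_eq_neg_fderiv_mul_of_integrable (hleft i) (hright i)
    (integrable_mul_of_hasCompactSupport hf.continuous hfc hfs (hX i).continuousOn)
    (fun x _ ↦ (hf.differentiable one_ne_zero).differentiableAt)
    (fun x hx ↦ ((hX i).differentiableOn one_ne_zero).differentiableAt (hΩ.mem_nhds (hfs hx))),
    neg_neg]

end IntegrationByParts

section Green

variable {n : ℕ} {K : Type*} [TopologicalSpace K] [ChartedSpace (EuclideanSpace ℝ (Fin n)) K]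
  [IsManifold (𝓡 n) ∞ K] [RiemannianBundle (fun x : K ↦ TangentSpace (𝓡 n) x)]
  {c : OpenPartialHomeomorph K (EuclideanSpace ℝ (Fin n))} {u : K → ℝ} {U : Set K}

theorem IsHarmonicOn.contDiffOn_comp_symm (hu : IsHarmonicOn (n := n) u U)
    (hc : c ∈ atlas (EuclideanSpace ℝ (Fin n)) K) :
    ContDiffOn ℝ 2 (u ∘ c.symm) (c.target ∩ c.symm ⁻¹' U) := by
  rw [← contMDiffOn_iff_contDiffOn]
  exact hu.1.comp (((contMDiffOn_atlas_symm hc).of_le (by norm_cast)).mono inter_subset_left)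
    fun y hy ↦ hy.2

theorem IsHarmonicOn.integral_energyForm_eq_zero
    [IsContMDiffRiemannianBundle (𝓡 n) ∞ (EuclideanSpace ℝ (Fin n))
      (fun x : K ↦ TangentSpace (𝓡 n) x)]
    (hu : IsHarmonicOn (n := n) u U) (hU : IsOpen U)
    (hc : c ∈ atlas (EuclideanSpace ℝ (Fin n)) K) {φ : EuclideanSpace ℝ (Fin n) → ℝ}
    (hφ : ContDiff ℝ 1 φ) (hφc : HasCompactSupport φ)
    (hφs : tsupport φ ⊆ c.target ∩ c.symm ⁻¹' U) :
    ∫ y, energyForm c y (fderiv ℝ (u ∘ c.symm) y) (fderiv ℝ φ y) = 0 := by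
  have hΩ : IsOpen (c.target ∩ c.symm ⁻¹' U) := c.symm.isOpen_inter_preimage hU
  let X : Fin n → EuclideanSpace ℝ (Fin n) → ℝ := fun i z ↦ volDensity c z *
    ∑ j, (metricMatrix c z)⁻¹ i j * fderiv ℝ (u ∘ c.symm) z (EuclideanSpace.single j (1 : ℝ))
  have hX : ∀ i, ContDiffOn ℝ 1 (X i) (c.target ∩ c.symm ⁻¹' U) := fun i ↦
    (((contDiffOn_volDensity hc).of_le (by norm_cast)).mono inter_subset_left).mul
      (ContDiffOn.sum fun j _ ↦
        (((contDiffOn_metricMatrix_inv hc i j).of_le (by norm_cast)).mono inter_subset_left).mul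
          (((hu.contDiffOn_comp_symm hc).fderiv_of_isOpen hΩ (m := 1) (by norm_num)).clm_apply
            contDiffOn_const))
  have hdiv : ∀ y, φ y * ∑ i, fderiv ℝ (X i) y (EuclideanSpace.single i (1 : ℝ)) = 0 := by
    intro y
    by_cases hy : y ∈ tsupport φ
    · obtain ⟨hyc, hyU⟩ := hφs hy
      have hΔ := hu.2 c hc (c.symm y) ⟨hyU, c.map_target hyc⟩
      rw [c.right_inv hyc, laplaceBeltrami] at hΔ
      rw [(mul_eq_zero.1 hΔ).resolve_left (inv_ne_zero (volDensity_pos hc hyc).ne'), mul_zero]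
    · rw [image_eq_zero_of_notMem_tsupport hy, zero_mul]
  have hflux : ∀ y ∈ c.target, energyForm c y (fderiv ℝ (u ∘ c.symm) y) (fderiv ℝ φ y) =
      ∑ i, fderiv ℝ φ y (EuclideanSpace.single i (1 : ℝ)) * X i y := fun y hy ↦ by
    rw [energyForm_symm hc hy, energyForm_apply, cometric_apply]
    simp only [X, Finset.mul_sum]
    exact Finset.sum_congr rfl fun i _ ↦ Finset.sum_congr rfl fun j _ ↦ by ring
  calc ∫ y, energyForm c y (fderiv ℝ (u ∘ c.symm) y) (fderiv ℝ φ y)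
      = ∫ y, ∑ i, fderiv ℝ φ y (EuclideanSpace.single i (1 : ℝ)) * X i y := by
        refine integral_congr_ae (Eventually.of_forall fun y ↦ ?_)
        by_cases hy : y ∈ tsupport φ
        · exact hflux y (hφs hy).1
        · simp [fderiv_of_notMem_tsupport ℝ hy]
    _ = 0 := by
        rw [integral_sum_fderiv_mul_eq_neg hΩ hφ hφc hφs hX]
        simp only [hdiv, integral_zero, neg_zero]

end Green

section Volume

/-- The pieces of a countable measurable cover on which prescribed measures agree can be glued: the
sum of the restrictions to the disjointed cover does not depend on the ordering of the pieces. -/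
theorem exists_measure_restrict_eq {α ι : Type*} [MeasurableSpace α] {s : ι → Set α}
    (hs : ∀ i, MeasurableSet (s i)) {T : Set ι} (hT : T.Countable) (hcover : ⋃ i ∈ T, s i = univ)
    (ν : ι → Measure α)
    (hν : ∀ i j, (ν i).restrict (s i ∩ s j) = (ν j).restrict (s i ∩ s j)) :
    ∃ μ : Measure α, ∀ i, μ.restrict (s i) = (ν i).restrict (s i) := by
  rcases isEmpty_or_nonempty α with hα | ⟨⟨x⟩⟩
  · exact ⟨0, fun i ↦ Subsingleton.elim _ _⟩
  obtain ⟨i₀, hi₀, -⟩ := mem_iUnion₂.1 (hcover ▸ mem_univ x)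
  obtain ⟨f, rfl⟩ := hT.exists_eq_range ⟨i₀, hi₀⟩
  rw [biUnion_range] at hcover
  have hmeas : ∀ k, MeasurableSet (disjointed (s ∘ f) k) :=
    MeasurableSet.disjointed fun k ↦ hs (f k)
  refine ⟨Measure.sum fun k ↦ (ν (f k)).restrict (disjointed (s ∘ f) k), fun i ↦ ?_⟩
  have hpiece : ∀ k, ((ν (f k)).restrict (disjointed (s ∘ f) k)).restrict (s i) =
      ((ν i).restrict (s i)).restrict (disjointed (s ∘ f) k) := fun k ↦ by
    rw [Measure.restrict_restrict (hs i), Measure.restrict_restrict (hmeas k), inter_comm,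
      ← inter_eq_left.2 (inter_subset_inter_left (s i) (disjointed_subset (s ∘ f) k)),
      ← Measure.restrict_restrict ((hmeas k).inter (hs i)), Function.comp_apply, hν,
      Measure.restrict_restrict ((hmeas k).inter (hs i))]
  rw [Measure.restrict_sum _ (hs i)]
  simp only [hpiece]
  rw [← Measure.restrict_iUnion (disjoint_disjointed _) hmeas, iUnion_disjointed,
    show ⋃ k, (s ∘ f) k = univ from hcover, Measure.restrict_univ]

section Embedding

variable {n : ℕ} {K : Type*} [TopologicalSpace K] [MeasurableSpace K] [BorelSpace K]
  (c : OpenPartialHomeomorph K (EuclideanSpace ℝ (Fin n)))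

theorem measurableEmbedding_domRestrict_symm : MeasurableEmbedding (c.target.domRestrict c.symm) :=
  c.symm.isOpenEmbedding_restrict.measurableEmbedding

theorem measurableSet_target_inter_preimage_symm {s : Set K} (hs : MeasurableSet s) :
    MeasurableSet (c.target ∩ c.symm ⁻¹' s) := by
  have himage := (MeasurableEmbedding.subtype_coe c.open_target.measurableSet).measurableSet_image.2
    ((measurableEmbedding_domRestrict_symm c).measurable hs)
  rwa [domRestrict_eq, preimage_comp, Subtype.image_preimage_coe] at himage

end Embedding

variable {n : ℕ} {K : Type*} [TopologicalSpace K] [ChartedSpace (EuclideanSpace ℝ (Fin n)) K]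
  [RiemannianBundle (fun x : K ↦ TangentSpace (𝓡 n) x)] [MeasurableSpace K]
  {c c' : OpenPartialHomeomorph K (EuclideanSpace ℝ (Fin n))} {μ : Measure K}

/-- The Riemannian volume of the domain of the chart `c`, extended by zero. It is pushed forward
from the subtype of the chart target, on which `c.symm` is an embedding. -/
noncomputable def chartVolume (c : OpenPartialHomeomorph K (EuclideanSpace ℝ (Fin n))) :
    Measure K :=
  (((volume.withDensity fun y ↦ ENNReal.ofReal (volDensity c y)).comap
    ((↑) : c.target → EuclideanSpace ℝ (Fin n))).map (c.target.domRestrict c.symm))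

/-- `μ` is the Riemannian volume of `K`: in every chart of the atlas it has density `√(det g)`. -/
def IsRiemannianVolume (μ : Measure K) : Prop :=
  ∀ c ∈ atlas (EuclideanSpace ℝ (Fin n)) K, μ.restrict c.source = chartVolume c

variable [BorelSpace K]

theorem chartVolume_apply {s : Set K} (hs : MeasurableSet s) :
    chartVolume c s = ∫⁻ y in c.target ∩ c.symm ⁻¹' s, ENNReal.ofReal (volDensity c y) := by
  rw [chartVolume, (measurableEmbedding_domRestrict_symm c).map_apply,
    comap_subtype_coe_apply c.open_target.measurableSet,
    ← withDensity_apply _ (measurableSet_target_inter_preimage_symm c hs), domRestrict_eq,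
    preimage_comp, Subtype.image_preimage_coe]

theorem chartVolume_restrict_source : (chartVolume c).restrict c.source = chartVolume c := by
  have hempty : c.target ∩ c.symm ⁻¹' c.sourceᶜ = ∅ := by
    ext y
    simpa using fun hy ↦ c.map_target hy
  have hzero : chartVolume c c.sourceᶜ = 0 := by
    rw [chartVolume_apply c.open_source.measurableSet.compl, hempty, setLIntegral_empty]
  exact Measure.restrict_eq_self_of_ae_mem (mem_ae_iff.2 hzero)

variable [IsManifold (𝓡 n) ∞ K]

theorem chartVolume_restrict_eq (hc : c ∈ atlas (EuclideanSpace ℝ (Fin n)) K)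
    (hc' : c' ∈ atlas (EuclideanSpace ℝ (Fin n)) K) :
    (chartVolume c).restrict (c.source ∩ c'.source) =
      (chartVolume c').restrict (c.source ∩ c'.source) := by
  have hsource : MeasurableSet (c.source ∩ c'.source) :=
    (c.open_source.inter c'.open_source).measurableSet
  ext s hs
  rw [Measure.restrict_apply hs, Measure.restrict_apply hs, chartVolume_apply (hs.inter hsource),
    chartVolume_apply (hs.inter hsource)]
  set A := c.target ∩ c.symm ⁻¹' (s ∩ (c.source ∩ c'.source))
  have himage : c'.target ∩ c'.symm ⁻¹' (s ∩ (c.source ∩ c'.source)) = transition c c' '' A := by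
    ext z
    constructor
    · rintro ⟨hz, hzs, hzc, hzc'⟩
      refine ⟨c (c'.symm z), ⟨c.map_source hzc, ?_⟩, ?_⟩
      · rw [mem_preimage, c.left_inv hzc]
        exact ⟨hzs, hzc, hzc'⟩
      · rw [transition, c.left_inv hzc, c'.right_inv hz]
    · rintro ⟨y, ⟨-, hys, hyc, hyc'⟩, rfl⟩
      refine ⟨c'.map_source hyc', ?_⟩
      rw [mem_preimage, symm_transition hyc']
      exact ⟨hys, hyc, hyc'⟩
  have hinj : InjOn (transition c c') A := fun y hy z hz hyz ↦
    c.symm.injOn hy.1 hz.1 (c'.injOn hy.2.2.2 hz.2.2.2 hyz)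
  rw [himage, lintegral_image_eq_lintegral_abs_det_fderiv_mul volume
    (measurableSet_target_inter_preimage_symm c (hs.inter hsource))
    (fun y hy ↦ (differentiableAt_transition hc hc' hy.1
      hy.2.2.2).hasFDerivAt.hasFDerivWithinAt) hinj]
  refine setLIntegral_congr_fun
    (measurableSet_target_inter_preimage_symm c (hs.inter hsource)) fun y hy ↦ ?_
  rw [volDensity_transition hc hc' hy.1 hy.2.2.2, ENNReal.ofReal_mul (abs_nonneg _)]

theorem exists_isRiemannianVolume [LindelofSpace K] :
    ∃ μ : Measure K, IsRiemannianVolume (n := n) μ := by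
  obtain ⟨T, hT, hcover⟩ := isLindelof_univ.elim_countable_subcover
    (fun c : atlas (EuclideanSpace ℝ (Fin n)) K ↦ c.1.source) (fun c ↦ c.1.open_source)
    fun q _ ↦ mem_iUnion.2 ⟨⟨_, chart_mem_atlas _ q⟩, mem_chart_source _ q⟩
  obtain ⟨μ, hμ⟩ := exists_measure_restrict_eq (fun c ↦ c.1.open_source.measurableSet) hT
    (univ_subset_iff.1 hcover) (fun c ↦ chartVolume c.1)
    fun c c' ↦ chartVolume_restrict_eq c.2 c'.2
  exact ⟨μ, fun c hc ↦ (hμ ⟨c, hc⟩).trans chartVolume_restrict_source⟩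

variable [IsContMDiffRiemannianBundle (𝓡 n) ∞ (EuclideanSpace ℝ (Fin n))
  (fun x : K ↦ TangentSpace (𝓡 n) x)]

namespace IsRiemannianVolume

theorem ae_iff (hμ : IsRiemannianVolume (n := n) μ)
    (hc : c ∈ atlas (EuclideanSpace ℝ (Fin n)) K) {p : K → Prop} :
    (∀ᵐ q ∂μ, q ∈ c.source → p q) ↔ ∀ᵐ y, y ∈ c.target → p (c.symm y) := by
  rw [← ae_restrict_iff' c.open_source.measurableSet, hμ c hc, chartVolume,
    (measurableEmbedding_domRestrict_symm c).ae_map_iff]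
  change (∀ᵐ y : c.target ∂_, p (c.symm y)) ↔ _
  rw [← (MeasurableEmbedding.subtype_coe c.open_target.measurableSet).ae_map_iff
      (p := fun y ↦ p (c.symm y)), map_comap_subtype_coe c.open_target.measurableSet,
    restrict_withDensity c.open_target.measurableSet,
    ae_withDensity_iff' (aemeasurable_ofReal_volDensity hc),
    ae_restrict_iff' c.open_target.measurableSet]
  refine eventually_congr (Eventually.of_forall fun y ↦ forall_congr' fun hy ↦ ?_)
  simp [volDensity_pos hc hy]

theorem integrableOn_source_iff (hμ : IsRiemannianVolume (n := n) μ)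
    (hc : c ∈ atlas (EuclideanSpace ℝ (Fin n)) K) {f : K → ℝ} :
    IntegrableOn f c.source μ ↔
      IntegrableOn (fun y ↦ volDensity c y * f (c.symm y)) c.target := by
  rw [IntegrableOn, hμ c hc, chartVolume,
    (measurableEmbedding_domRestrict_symm c).integrable_map_iff]
  change Integrable ((f ∘ c.symm) ∘ ((↑) : c.target → EuclideanSpace ℝ (Fin n))) _ ↔ _
  rw [← integrableOn_iff_comap_subtypeVal c.open_target.measurableSet, IntegrableOn,
    restrict_withDensity c.open_target.measurableSet,
    integrable_withDensity_iff_integrable_smul₀' (aemeasurable_ofReal_volDensity hc)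
      (Eventually.of_forall fun y ↦ ENNReal.ofReal_lt_top)]
  refine integrable_congr ((ae_restrict_mem c.open_target.measurableSet).mono fun y hy ↦ ?_)
  simp [(volDensity_pos hc hy).le]

theorem setIntegral_source (hμ : IsRiemannianVolume (n := n) μ)
    (hc : c ∈ atlas (EuclideanSpace ℝ (Fin n)) K) (f : K → ℝ) :
    ∫ q in c.source, f q ∂μ = ∫ y in c.target, volDensity c y * f (c.symm y) := by
  rw [hμ c hc, chartVolume, (measurableEmbedding_domRestrict_symm c).integral_map]
  change ∫ y : c.target, (f ∘ c.symm) y ∂_ = _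
  rw [integral_subtype_comap c.open_target.measurableSet,
    setIntegral_withDensity_eq_setIntegral_toReal_smul₀ (aemeasurable_ofReal_volDensity hc)
      (Eventually.of_forall fun y ↦ ENNReal.ofReal_lt_top) _ c.open_target.measurableSet]
  refine setIntegral_congr_fun c.open_target.measurableSet fun y hy ↦ ?_
  simp [(volDensity_pos hc hy).le]

end IsRiemannianVolume

end Volume

/-! ### Weakly harmonic functions -/

/-- A continuous field `a` of symmetric nonnegative bilinear forms on the covectors at the points of
`Ω`. The associated Dirichlet form is `(u, v) ↦ ∫ a (Du) (Dv)`. -/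
structure IsDirichletFormOn {E : Type*} [NormedAddCommGroup E] [NormedSpace ℝ E]
    (a : E → LinearMap.BilinForm ℝ (E →L[ℝ] ℝ)) (Ω : Set E) : Prop where
  continuousOn : ContinuousOn (fun p : E × (E →L[ℝ] ℝ) × (E →L[ℝ] ℝ) ↦ a p.1 p.2.1 p.2.2)
    (Ω ×ˢ univ)
  symm : ∀ y ∈ Ω, ∀ ξ η, a y ξ η = a y η ξ
  nonneg : ∀ y ∈ Ω, ∀ ξ, 0 ≤ a y ξ ξ

/-- `u` is of class `C¹` on `Ω` and a critical point there of the Dirichlet form of `a`: the weak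
formulation of `div (a ∇u) = 0`. -/
def IsWeaklyHarmonicOn {E : Type*} [NormedAddCommGroup E] [NormedSpace ℝ E] [MeasurableSpace E]
    (a : E → LinearMap.BilinForm ℝ (E →L[ℝ] ℝ)) (μ : Measure E) (u : E → ℝ) (Ω : Set E) : Prop :=
  ContDiffOn ℝ 1 u Ω ∧ ∀ φ : E → ℝ, ContDiff ℝ 1 φ → HasCompactSupport φ → tsupport φ ⊆ Ω →
    ∫ y, a y (fderiv ℝ u y) (fderiv ℝ φ y) ∂μ = 0

section DirichletForm

variable {E : Type*} [NormedAddCommGroup E] [NormedSpace ℝ E]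
  {a : E → LinearMap.BilinForm ℝ (E →L[ℝ] ℝ)} {Ω : Set E} {φ ψ χ u v : E → ℝ}

namespace IsDirichletFormOn

theorem continuousOn_apply (ha : IsDirichletFormOn a Ω) {ξ η : E → E →L[ℝ] ℝ}
    (hξ : ContinuousOn ξ Ω) (hη : ContinuousOn η Ω) :
    ContinuousOn (fun y ↦ a y (ξ y) (η y)) Ω :=
  ha.continuousOn.comp (continuousOn_id.prodMk (hξ.prodMk hη)) fun _ hy ↦ ⟨hy, mem_univ _⟩

theorem neg_two_mul_le (ha : IsDirichletFormOn a Ω) {y : E} (hy : y ∈ Ω) (r s : ℝ)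
    (ξ η : E →L[ℝ] ℝ) :
    -(2 * (r * s * a y ξ η)) ≤ r ^ 2 / 2 * a y ξ ξ + 2 * s ^ 2 * a y η η := by
  have hsq := ha.nonneg y hy (r • ξ + (2 * s) • η)
  simp only [map_add, map_smul, LinearMap.add_apply, LinearMap.smul_apply, smul_eq_mul,
    ha.symm y hy η ξ] at hsq
  linarith

theorem abs_apply_le (ha : IsDirichletFormOn a Ω) {y : E} (hy : y ∈ Ω) (ξ η : E →L[ℝ] ℝ) :
    |a y ξ η| ≤ a y ξ ξ + a y η η := by
  have hadd := ha.nonneg y hy (ξ + η)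
  have hsub := ha.nonneg y hy (ξ - η)
  have hξ := ha.nonneg y hy ξ
  have hη := ha.nonneg y hy η
  simp only [map_add, map_sub, LinearMap.add_apply, LinearMap.sub_apply,
    ha.symm y hy η ξ] at hadd hsub
  exact abs_le.2 ⟨by linarith, by linarith⟩

variable [MeasurableSpace E] [BorelSpace E] {μ : Measure E} [IsFiniteMeasureOnCompacts μ]

theorem integrable_mul_apply (ha : IsDirichletFormOn a Ω) (hΩ : IsOpen Ω) (hφ : Continuous φ)
    (hφc : HasCompactSupport φ) (hφs : tsupport φ ⊆ Ω) (hu : ContDiffOn ℝ 1 u Ω)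
    (hv : ContDiffOn ℝ 1 v Ω) :
    Integrable (fun y ↦ φ y * a y (fderiv ℝ u y) (fderiv ℝ v y)) μ :=
  integrable_mul_of_hasCompactSupport hφ hφc hφs
    (ha.continuousOn_apply (hu.continuousOn_fderiv_of_isOpen hΩ le_rfl)
      (hv.continuousOn_fderiv_of_isOpen hΩ le_rfl))

theorem integrable_mul_apply_fderiv (ha : IsDirichletFormOn a Ω) (hΩ : IsOpen Ω)
    (hψ : ContDiff ℝ 1 ψ) (hψc : HasCompactSupport ψ) (hψs : tsupport ψ ⊆ Ω)
    (hu : ContDiffOn ℝ 1 u Ω) (hv : ContinuousOn v Ω) :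
    Integrable (fun y ↦ v y * a y (fderiv ℝ u y) (fderiv ℝ ψ y)) μ :=
  integrable_of_continuousOn_of_tsupport_subset hψc hψs
    (hv.mul (ha.continuousOn_apply (hu.continuousOn_fderiv_of_isOpen hΩ le_rfl)
      (hψ.continuous_fderiv one_ne_zero).continuousOn))
    fun y hy ↦ by rw [fderiv_of_notMem_tsupport ℝ hy, map_zero, mul_zero]

end IsDirichletFormOn

variable [MeasurableSpace E] [BorelSpace E] {μ : Measure E} [IsFiniteMeasureOnCompacts μ]

namespace IsWeaklyHarmonicOn

theorem integral_mul_apply (hu : IsWeaklyHarmonicOn a μ u Ω) (ha : IsDirichletFormOn a Ω)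
    (hΩ : IsOpen Ω) (hψ : ContDiff ℝ 1 ψ) (hψc : HasCompactSupport ψ) (hψs : tsupport ψ ⊆ Ω)
    (hv : ContDiffOn ℝ 1 v Ω) :
    ∫ y, ψ y * a y (fderiv ℝ u y) (fderiv ℝ v y) ∂μ =
      -∫ y, v y * a y (fderiv ℝ u y) (fderiv ℝ ψ y) ∂μ := by
  have hsupp : tsupport (ψ * v) ⊆ tsupport ψ := tsupport_mul_subset_left
  have hψv : ContDiff ℝ 1 (ψ * v) := contMDiff_iff_contDiff.1 <| contMDiff_of_tsupport fun y hy ↦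
    (hψ.contDiffAt.mul (hv.contDiffAt (hΩ.mem_nhds (hψs (hsupp hy))))).contMDiffAt
  have hprod : ∀ y, a y (fderiv ℝ u y) (fderiv ℝ (ψ * v) y) =
      ψ y * a y (fderiv ℝ u y) (fderiv ℝ v y) + v y * a y (fderiv ℝ u y) (fderiv ℝ ψ y) := by
    intro y
    by_cases hy : y ∈ tsupport ψ
    · rw [fderiv_mul (hψ.differentiable one_ne_zero y)
        ((hv.differentiableOn one_ne_zero).differentiableAt (hΩ.mem_nhds (hψs hy))),
        map_add, map_smul, map_smul, smul_eq_mul, smul_eq_mul]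
    · rw [fderiv_of_notMem_tsupport ℝ fun h ↦ hy (hsupp h), fderiv_of_notMem_tsupport ℝ hy,
        image_eq_zero_of_notMem_tsupport hy, map_zero, zero_mul, mul_zero, add_zero]
  have htest := hu.2 (ψ * v) hψv hψc.mul_right (hsupp.trans hψs)
  simp only [hprod] at htest
  rw [integral_add (ha.integrable_mul_apply hΩ hψ.continuous hψc hψs hu.1 hv)
    (ha.integrable_mul_apply_fderiv hΩ hψ hψc hψs hu.1 hv.continuousOn)] at htest
  exact eq_neg_of_add_eq_zero_left htest

theorem integral_mul_energy (hu : IsWeaklyHarmonicOn a μ u Ω) (hv : IsWeaklyHarmonicOn a μ v Ω)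
    (ha : IsDirichletFormOn a Ω) (hΩ : IsOpen Ω) (hψ : ContDiff ℝ 1 ψ)
    (hψc : HasCompactSupport ψ) (hψs : tsupport ψ ⊆ Ω) :
    ∫ y, ψ y * (v y * a y (fderiv ℝ u y) (fderiv ℝ u y)) ∂μ =
      2⁻¹ * ∫ y, u y ^ 2 * a y (fderiv ℝ v y) (fderiv ℝ ψ y) ∂μ -
        ∫ y, u y * v y * a y (fderiv ℝ u y) (fderiv ℝ ψ y) ∂μ := by
  have hdiff : ∀ {w : E → ℝ}, ContDiffOn ℝ 1 w Ω → ∀ y ∈ Ω, DifferentiableAt ℝ w y := fun hw y hy ↦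
    (hw.differentiableOn one_ne_zero).differentiableAt (hΩ.mem_nhds hy)
  have hu2 : ContDiffOn ℝ 1 (u ^ 2) Ω := hu.1.pow 2
  have hadd := hu.integral_mul_apply ha hΩ hψ hψc hψs (v := u * v) (hu.1.mul hv.1)
  have hsq := hv.integral_mul_apply ha hΩ hψ hψc hψs hu2
  have hψ0 : ∀ y, y ∈ tsupport ψ ∨ ψ y = 0 := fun y ↦
    or_iff_not_imp_left.2 image_eq_zero_of_notMem_tsupport
  have hcross : ∀ y, ψ y * a y (fderiv ℝ u y) (fderiv ℝ (u * v) y) =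
      ψ y * (v y * a y (fderiv ℝ u y) (fderiv ℝ u y)) +
        2⁻¹ * (ψ y * a y (fderiv ℝ v y) (fderiv ℝ (u ^ 2) y)) := fun y ↦ by
    obtain hy | hy := hψ0 y
    · rw [fderiv_mul (hdiff hu.1 y (hψs hy)) (hdiff hv.1 y (hψs hy)),
        fderiv_pow 2 (hdiff hu.1 y (hψs hy))]
      simp only [map_add, map_smul, LinearMap.smul_apply, smul_eq_mul, nsmul_eq_mul,
        ha.symm y (hψs hy) (fderiv ℝ v y)]
      ring
    · simp only [hy, zero_mul, mul_zero, add_zero]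
  have hint : Integrable (fun y ↦ ψ y * (v y * a y (fderiv ℝ u y) (fderiv ℝ u y))) μ :=
    integrable_mul_of_hasCompactSupport hψ.continuous hψc hψs (hv.1.continuousOn.mul
      (ha.continuousOn_apply (hu.1.continuousOn_fderiv_of_isOpen hΩ le_rfl)
        (hu.1.continuousOn_fderiv_of_isOpen hΩ le_rfl)))
  simp only [hcross] at hadd
  rw [integral_add hint ((ha.integrable_mul_apply hΩ hψ.continuous hψc hψs hv.1
    hu2).const_mul 2⁻¹), integral_const_mul, hsq] at hadd
  simp only [Pi.mul_apply, Pi.pow_apply] at hadd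
  linarith

theorem integral_sq_mul_energy_le (hu : IsWeaklyHarmonicOn a μ u Ω) (ha : IsDirichletFormOn a Ω)
    (hΩ : IsOpen Ω) (hχ : ContDiff ℝ 1 χ) (hχc : HasCompactSupport χ) (hχs : tsupport χ ⊆ Ω)
    (hu1 : ∀ y ∈ Ω, |u y| ≤ 1) :
    ∫ y, χ y ^ 2 * a y (fderiv ℝ u y) (fderiv ℝ u y) ∂μ ≤
      4 * ∫ y, a y (fderiv ℝ χ y) (fderiv ℝ χ y) ∂μ := by
  have hsupp : tsupport (χ ^ 2) ⊆ tsupport χ := by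
    rw [sq]
    exact tsupport_mul_subset_left
  have hχ2c : HasCompactSupport (χ ^ 2) := hχc.of_isClosed_subset isClosed_closure hsupp
  have hint := ha.integrable_mul_apply (μ := μ) hΩ (hχ.pow 2).continuous hχ2c
    (hsupp.trans hχs) hu.1 hu.1
  have hint' : Integrable (fun y ↦ a y (fderiv ℝ χ y) (fderiv ℝ χ y)) μ := by
    simpa only [one_mul] using ha.integrable_mul_apply_fderiv hΩ hχ hχc hχs hχ.contDiffOn
      (continuousOn_const (c := 1))
  have hpoint : ∀ y, -(u y * a y (fderiv ℝ u y) (fderiv ℝ (χ ^ 2) y)) ≤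
      2⁻¹ * (χ y ^ 2 * a y (fderiv ℝ u y) (fderiv ℝ u y)) +
        2 * a y (fderiv ℝ χ y) (fderiv ℝ χ y) := fun y ↦ by
    by_cases hy : y ∈ tsupport χ
    · have hyoung := ha.neg_two_mul_le (hχs hy) (χ y) (u y) (fderiv ℝ u y) (fderiv ℝ χ y)
      have hle : u y ^ 2 * a y (fderiv ℝ χ y) (fderiv ℝ χ y) ≤
          a y (fderiv ℝ χ y) (fderiv ℝ χ y) :=
        mul_le_of_le_one_left (ha.nonneg y (hχs hy) _)
          ((sq_le_one_iff_abs_le_one _).2 (hu1 y (hχs hy)))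
      rw [fderiv_pow 2 (hχ.differentiable one_ne_zero y)]
      simp only [map_smul, smul_eq_mul, nsmul_eq_mul]
      norm_num
      linarith
    · rw [fderiv_of_notMem_tsupport ℝ fun h ↦ hy (hsupp h), fderiv_of_notMem_tsupport ℝ hy,
        image_eq_zero_of_notMem_tsupport hy]
      simp
  have hmono := integral_mono
    (ha.integrable_mul_apply_fderiv hΩ (hχ.pow 2) hχ2c (hsupp.trans hχs) hu.1
      hu.1.continuousOn).neg ((hint.const_mul 2⁻¹).add (hint'.const_mul 2)) hpoint
  simp only [Pi.neg_apply, Pi.add_apply] at hmono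
  rw [integral_neg, ← hu.integral_mul_apply ha hΩ (hχ.pow 2) hχ2c (hsupp.trans hχs) hu.1,
    integral_add (hint.const_mul _) (hint'.const_mul _), integral_const_mul,
    integral_const_mul] at hmono
  linarith

end IsWeaklyHarmonicOn

end DirichletForm

section ProductIntegral

variable {X : Type*} [MeasurableSpace X] {μ : Measure X} [SFinite μ]

theorem measurePreserving_prodMap_add_right (μ : Measure X) [SFinite μ] (δ : ℝ) :
    MeasurePreserving (Prod.map id (· + δ)) (μ.prod (volume : Measure ℝ)) (μ.prod volume) :=
  (MeasurePreserving.id μ).prod (measurePreserving_add_right volume δ)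

theorem integral_prod_add_right (f : X × ℝ → ℝ) (δ : ℝ) :
    ∫ p, f (p.1, p.2 + δ) ∂μ.prod volume = ∫ p, f p ∂μ.prod volume :=
  (measurePreserving_prodMap_add_right μ δ).integral_comp
    (MeasurableEmbedding.id.prodMap (measurableEmbedding_addRight δ)) f

theorem integrable_prod_add_right {f : X × ℝ → ℝ} (hf : Integrable f (μ.prod volume)) (δ : ℝ) :
    Integrable (fun p ↦ f (p.1, p.2 + δ)) (μ.prod volume) :=
  (measurePreserving_prodMap_add_right μ δ).integrable_comp_of_integrable hf

theorem integrable_prod_of_slices {f : X × ℝ → ℝ}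
    (hf : AEStronglyMeasurable f (μ.prod volume))
    (hslice : ∀ t, Integrable (fun x ↦ f (x, t)) μ) {M : ℝ} (hM : ∀ t, ∫ x, ‖f (x, t)‖ ∂μ ≤ M)
    (h0 : ∀ t ∉ Icc (0 : ℝ) 1, ∀ x, f (x, t) = 0) : Integrable f (μ.prod volume) := by
  refine (integrable_prod_iff' hf).2 ⟨ae_of_all _ hslice, ?_⟩
  have hbound : Integrable ((Icc (0 : ℝ) 1).indicator fun _ ↦ M) :=
    (integrable_indicator_iff measurableSet_Icc).2 (integrableOn_const (by simp))
  refine hbound.mono' hf.norm.prod_swap.integral_prod_right' (ae_of_all _ fun t ↦ ?_)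
  rw [Real.norm_of_nonneg (integral_nonneg fun _ ↦ norm_nonneg _)]
  by_cases ht : t ∈ Icc (0 : ℝ) 1
  · rw [indicator_of_mem ht]
    exact hM t
  · simp [h0 t ht, indicator_of_notMem ht]

end ProductIntegral

section LipschitzFamily

variable {X : Type*} [TopologicalSpace X] [MeasurableSpace X] [OpensMeasurableSpace X]
  {f : X × ℝ → ℝ} {g : X → ℝ → ℝ} {C : ℝ≥0}

theorem ae_prod_differentiableAt (μ : Measure X) (hg : Continuous (Function.uncurry g))
    (hC : ∀ x, LipschitzWith C (g x)) :
    ∀ᵐ p ∂μ.prod volume, DifferentiableAt ℝ (g p.1) p.2 :=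
  (Measure.ae_prod_iff_ae_ae (measurableSet_of_differentiableAt_with_param ℝ hg)).2 <|
    ae_of_all _ fun x ↦ (hC x).ae_differentiableAt_real

variable {μ : Measure X}

theorem integrable_deriv_mul (hf : Integrable f (μ.prod volume))
    (hg : Continuous (Function.uncurry g)) (hC : ∀ x, LipschitzWith C (g x)) :
    Integrable (fun p ↦ deriv (g p.1) p.2 * f p) (μ.prod volume) :=
  hf.bdd_mul (measurable_deriv_with_param hg).aestronglyMeasurable
    (ae_of_all _ fun p ↦ norm_deriv_le_of_lipschitz (hC p.1))

theorem tendsto_integral_slope_mul (hf : Integrable f (μ.prod volume))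
    (hg : Continuous (Function.uncurry g)) (hC : ∀ x, LipschitzWith C (g x)) :
    Tendsto (fun δ : ℝ ↦ δ⁻¹ * ∫ p, (g p.1 (p.2 + δ) - g p.1 p.2) * f p ∂μ.prod volume) (𝓝[≠] 0)
      (𝓝 (∫ p, deriv (g p.1) p.2 * f p ∂μ.prod volume)) := by
  simp only [← integral_const_mul, ← mul_assoc]
  refine tendsto_integral_filter_of_dominated_convergence (fun p ↦ C * ‖f p‖) ?_ ?_
    (hf.norm.const_mul _) ?_
  · refine Eventually.of_forall fun δ ↦ ?_
    have hslope : Continuous fun p : X × ℝ ↦ δ⁻¹ * (g p.1 (p.2 + δ) - g p.1 p.2) :=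
      continuous_const.mul ((hg.comp (continuous_fst.prodMk
        (continuous_snd.add continuous_const))).sub hg)
    exact hslope.aestronglyMeasurable.mul hf.aestronglyMeasurable
  · filter_upwards [self_mem_nhdsWithin] with δ hδ
    refine ae_of_all _ fun p ↦ ?_
    have hdist := (hC p.1).dist_le_mul (p.2 + δ) p.2
    rw [Real.dist_eq, Real.dist_eq, add_sub_cancel_left] at hdist
    rw [norm_mul, norm_mul, norm_inv, Real.norm_eq_abs δ, Real.norm_eq_abs (_ - _)]
    gcongr
    rwa [inv_mul_le_iff₀ (abs_pos.2 hδ), mul_comm]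
  · filter_upwards [ae_prod_differentiableAt μ hg hC] with p hp
    exact (hasDerivAt_iff_tendsto_slope_zero.1 hp.hasDerivAt).mul_const (f p)

theorem integrable_translate_mul (hf : Integrable f (μ.prod volume))
    (hg : Continuous (Function.uncurry g)) (hg1 : ∀ x t, |g x t| ≤ 1) (δ : ℝ) :
    Integrable (fun p ↦ g p.1 (p.2 + δ) * f p) (μ.prod volume) :=
  hf.bdd_mul (hg.comp (continuous_fst.prodMk
    (continuous_snd.add continuous_const))).aestronglyMeasurable
    (ae_of_all _ fun p ↦ hg1 p.1 (p.2 + δ))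

theorem lipschitzWith_sq_of_abs_le_one {g : ℝ → ℝ} (hC : LipschitzWith C g)
    (hg1 : ∀ t, |g t| ≤ 1) : LipschitzWith (2 * C) fun t ↦ g t ^ 2 :=
  LipschitzWith.of_dist_le_mul fun s t ↦ by
    rw [Real.dist_eq, sq_sub_sq, abs_mul, NNReal.coe_mul, NNReal.coe_ofNat, mul_assoc]
    refine mul_le_mul ((abs_add_le _ _).trans ?_) (hC.dist_le_mul s t) (abs_nonneg _) two_pos.le
    linarith [hg1 s, hg1 t]

theorem integral_deriv_sq_mul (μ : Measure X) (f : X × ℝ → ℝ)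
    (hg : Continuous (Function.uncurry g)) (hC : ∀ x, LipschitzWith C (g x)) :
    ∫ p, deriv (fun t ↦ g p.1 t ^ 2) p.2 * f p ∂μ.prod volume =
      2 * ∫ p, deriv (g p.1) p.2 * (g p.1 p.2 * f p) ∂μ.prod volume := by
  rw [← integral_const_mul]
  refine integral_congr_ae ?_
  filter_upwards [ae_prod_differentiableAt μ hg hC] with p hp
  rw [(hp.hasDerivAt.fun_pow 2).deriv]
  ring

theorem integral_deriv_mul_of_integral_translate_mul {e : X × ℝ → ℝ}
    (he : Integrable e (μ.prod volume)) (hf : Integrable f (μ.prod volume))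
    (hg : Continuous (Function.uncurry g)) (hC : ∀ x, LipschitzWith C (g x))
    (hg1 : ∀ x t, |g x t| ≤ 1)
    (h : ∀ δ, ∫ p, g p.1 (p.2 + δ) * e p ∂μ.prod volume =
      2⁻¹ * ∫ p, g p.1 (p.2 - δ) ^ 2 * f p ∂μ.prod volume -
        ∫ p, g p.1 (p.2 + δ) * (g p.1 p.2 * f p) ∂μ.prod volume) :
    ∫ p, deriv (g p.1) p.2 * e p ∂μ.prod volume =
      -2 * ∫ p, deriv (g p.1) p.2 * (g p.1 p.2 * f p) ∂μ.prod volume := by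
  have hgf : Integrable (fun p ↦ g p.1 p.2 * f p) (μ.prod volume) := by
    simpa only [add_zero] using integrable_translate_mul hf hg hg1 0
  have hsqf : ∀ δ, Integrable (fun p ↦ g p.1 (p.2 + δ) ^ 2 * f p) (μ.prod volume) := fun δ ↦ by
    simpa only [sq, mul_assoc] using
      integrable_translate_mul (integrable_translate_mul hf hg hg1 δ) hg hg1 δ
  have hdiff : ∀ δ, ∫ p, (g p.1 (p.2 + δ) - g p.1 p.2) * e p ∂μ.prod volume =
      2⁻¹ * ∫ p, (g p.1 (p.2 + -δ) ^ 2 - g p.1 p.2 ^ 2) * f p ∂μ.prod volume -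
        ∫ p, (g p.1 (p.2 + δ) - g p.1 p.2) * (g p.1 p.2 * f p) ∂μ.prod volume := fun δ ↦ by
    have he0 := integrable_translate_mul he hg hg1 0
    have hgf0 := integrable_translate_mul hgf hg hg1 0
    have hsqf0 := hsqf 0
    have h0 := h 0
    simp only [add_zero, sub_zero] at he0 hgf0 hsqf0 h0
    simp only [sub_mul]
    rw [integral_sub (integrable_translate_mul he hg hg1 δ) he0, integral_sub (hsqf (-δ)) hsqf0,
      integral_sub (integrable_translate_mul hgf hg hg1 δ) hgf0]
    simp only [← sub_eq_add_neg]
    linarith [h δ]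
  have hneg : Tendsto (fun δ : ℝ ↦ -δ) (𝓝[≠] 0) (𝓝[≠] 0) :=
    tendsto_nhdsWithin_of_tendsto_nhds_of_eventually_within _
      ((continuous_neg.tendsto' 0 0 neg_zero).mono_left nhdsWithin_le_nhds)
      (eventually_mem_nhdsWithin.mono fun _ ↦ neg_ne_zero.2)
  have hsq := tendsto_integral_slope_mul hf (g := fun x t ↦ g x t ^ 2) (by exact hg.pow 2)
    fun x ↦ lipschitzWith_sq_of_abs_le_one (hC x) (hg1 x)
  have hlim := ((hsq.comp hneg).const_mul (-2⁻¹)).sub (tendsto_integral_slope_mul hgf hg hC)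
  rw [tendsto_nhds_unique (tendsto_integral_slope_mul he hg hC) (hlim.congr fun δ ↦ ?_),
    integral_deriv_sq_mul μ f hg hC]
  · ring
  · rw [hdiff δ, Function.comp_apply, inv_neg]
    ring

end LipschitzFamily

section GraphFamily

theorem continuous_mul_of_tsupport_subset {X Y : Type*} [TopologicalSpace X] [TopologicalSpace Y]
    {Ω : Set X} {χ : X → ℝ} {f : X × Y → ℝ} (hΩ : IsOpen Ω) (hχ : Continuous χ)
    (hχs : tsupport χ ⊆ Ω) (hf : ContinuousOn f (Ω ×ˢ univ)) :
    Continuous fun p ↦ χ p.1 * f p :=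
  continuous_of_tsupport fun _ hp ↦ (hχ.comp continuous_fst).continuousAt.mul <|
    hf.continuousAt <| (hΩ.prod isOpen_univ).mem_nhds
      ⟨hχs (tsupport_comp_subset_preimage χ continuous_fst (tsupport_mul_subset_left hp)),
        mem_univ _⟩

/-- A family of weakly harmonic functions `h · t` on `Ω` whose graphs fill `Ω × [0, 1]` in
increasing order as the parameter `t` runs through `[0, 1]`. It is extended to all real `t` by its
boundary values `0` and `1`. -/
structure IsHarmonicGraphFamily {E : Type*} [NormedAddCommGroup E] [NormedSpace ℝ E]
    [MeasurableSpace E] (a : E → LinearMap.BilinForm ℝ (E →L[ℝ] ℝ)) (μ : Measure E)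
    (h : E → ℝ → ℝ) (Ω : Set E) (C : ℝ≥0) : Prop where
  isWeaklyHarmonicOn : ∀ t, IsWeaklyHarmonicOn a μ (h · t) Ω
  lipschitz : ∀ y ∈ Ω, LipschitzWith C (h y)
  monotone : ∀ y ∈ Ω, Monotone (h y)
  eq_zero : ∀ y ∈ Ω, ∀ t ≤ 0, h y t = 0
  eq_one : ∀ y ∈ Ω, ∀ t, 1 ≤ t → h y t = 1

/-- The differential at `y` of the member of index `t` of a family `h` of functions, as a function
of the pair `(y, t)`. -/
noncomputable def graphDifferential {E : Type*} [NormedAddCommGroup E] [NormedSpace ℝ E]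
    (h : E → ℝ → ℝ) (p : E × ℝ) : E →L[ℝ] ℝ :=
  fderiv ℝ (h · p.2) p.1

variable {E : Type*} [NormedAddCommGroup E] [NormedSpace ℝ E] {Ω S : Set E}

theorem exists_cutoff [FiniteDimensional ℝ E] (hS : IsCompact S) (hΩ : IsOpen Ω) (hSΩ : S ⊆ Ω) :
    ∃ χ : E → ℝ, ContDiff ℝ 1 χ ∧ HasCompactSupport χ ∧ tsupport χ ⊆ Ω ∧
      (∀ x, χ x ∈ Icc (0 : ℝ) 1) ∧ ∀ᶠ x in 𝓝ˢ S, χ x = 1 := by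
  obtain ⟨L, hL, hSL, hLΩ⟩ := exists_compact_between hS hΩ hSΩ
  obtain ⟨χ, hone, hzero, hmem⟩ := exists_contMDiffMap_one_nhds_of_subset_interior (n := 1)
    𝓘(ℝ, E) hS.isClosed hSL
  have hsupp : tsupport χ ⊆ L := closure_minimal
    (fun x hx ↦ by_contra fun hxL ↦ hx (hzero x hxL)) hL.isClosed
  exact ⟨χ, χ.contMDiff.contDiff, hL.of_isClosed_subset (isClosed_tsupport _) hsupp,
    hsupp.trans hLΩ, hmem, hone⟩

theorem measurable_graphDifferential [FiniteDimensional ℝ E] [MeasurableSpace E] [BorelSpace E]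
    {h : E → ℝ → ℝ} (hh : Continuous (Function.uncurry h)) : Measurable (graphDifferential h) :=
  (measurable_fderiv_with_param ℝ (f := fun t y ↦ h y t) (hh.comp continuous_swap)).comp
    measurable_swap

theorem eq_or_eq_zero_of_eventually_nhdsSet_tsupport {F : Type*} {g h : E → F} {ψ : E → ℝ}
    (hgh : ∀ᶠ y in 𝓝ˢ (tsupport ψ), g y = h y) (y : E) :
    g y = h y ∨ ψ y = 0 ∧ fderiv ℝ ψ y = 0 := by
  refine or_iff_not_imp_right.2 fun hψy ↦ hgh.self_of_nhdsSet y ?_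
  contrapose! hψy
  exact ⟨image_eq_zero_of_notMem_tsupport hψy, fderiv_of_notMem_tsupport ℝ hψy⟩

theorem graphDifferential_congr {g h : E → ℝ → ℝ} (hgh : ∀ᶠ y in 𝓝ˢ S, g y = h y) {p : E × ℝ}
    (hp : p.1 ∈ S) : graphDifferential g p = graphDifferential h p :=
  EventuallyEq.fderiv_eq <|
    (eventually_nhdsSet_iff_forall.1 hgh p.1 hp).mono fun _ hy ↦ congrFun hy p.2

section DirichletForm

variable {a : E → LinearMap.BilinForm ℝ (E →L[ℝ] ℝ)} {χ ψ : E → ℝ}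

theorem IsDirichletFormOn.mul_apply_self_nonneg (ha : IsDirichletFormOn a Ω)
    (hχs : tsupport χ ⊆ Ω) (hχ0 : ∀ y, 0 ≤ χ y) (y : E) (ξ : E →L[ℝ] ℝ) :
    0 ≤ χ y * a y ξ ξ := by
  by_cases hy : y ∈ tsupport χ
  · exact mul_nonneg (hχ0 y) (ha.nonneg y (hχs hy) ξ)
  · rw [image_eq_zero_of_notMem_tsupport hy, zero_mul]

variable [FiniteDimensional ℝ E] [MeasurableSpace E] [BorelSpace E]

theorem IsDirichletFormOn.measurable_mul (ha : IsDirichletFormOn a Ω) (hΩ : IsOpen Ω)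
    (hχ : Continuous χ) (hχs : tsupport χ ⊆ Ω) {ξ η : E × ℝ → E →L[ℝ] ℝ} (hξ : Measurable ξ)
    (hη : Measurable η) : Measurable fun p : E × ℝ ↦ χ p.1 * a p.1 (ξ p) (η p) :=
  (continuous_mul_of_tsupport_subset hΩ hχ hχs ha.continuousOn).measurable.comp
    (measurable_fst.prodMk (hξ.prodMk hη))

variable {μ : Measure E} [IsFiniteMeasureOnCompacts μ]

namespace IsWeaklyHarmonicOn

theorem exists_integral_norm_mul_energy_le (ha : IsDirichletFormOn a Ω) (hΩ : IsOpen Ω)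
    (hψ : Continuous ψ) (hψc : HasCompactSupport ψ) (hψs : tsupport ψ ⊆ Ω) :
    ∃ M, ∀ u : E → ℝ, IsWeaklyHarmonicOn a μ u Ω → (∀ y ∈ Ω, |u y| ≤ 1) →
      ∫ y, ‖ψ y * a y (fderiv ℝ u y) (fderiv ℝ u y)‖ ∂μ ≤ M := by
  obtain ⟨χ, hχ, hχc, hχs, -, hχ1⟩ := exists_cutoff hψc.isCompact hΩ hψs
  obtain ⟨B, hB⟩ := hψc.exists_bound_of_continuous hψ
  have hB0 : 0 ≤ B := (norm_nonneg _).trans (hB 0)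
  refine ⟨B * (4 * ∫ y, a y (fderiv ℝ χ y) (fderiv ℝ χ y) ∂μ), fun u hu hu1 ↦ ?_⟩
  refine le_trans ?_ (mul_le_mul_of_nonneg_left
    (hu.integral_sq_mul_energy_le ha hΩ hχ hχc hχs hu1) hB0)
  have hsupp : tsupport (χ ^ 2) ⊆ tsupport χ := by
    rw [sq]
    exact tsupport_mul_subset_left
  have hint := ha.integrable_mul_apply (μ := μ) hΩ (hχ.pow 2).continuous
    (hχc.of_isClosed_subset isClosed_closure hsupp) (hsupp.trans hχs) hu.1 hu.1
  rw [← integral_const_mul]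
  refine integral_mono_of_nonneg (ae_of_all _ fun _ ↦ norm_nonneg _) (hint.const_mul B)
    (ae_of_all _ fun y ↦ ?_)
  by_cases hy : y ∈ tsupport ψ
  · have henergy := ha.nonneg y (hψs hy) (fderiv ℝ u y)
    simp only [hχ1.self_of_nhdsSet y hy, one_pow,
      one_mul, norm_mul, Real.norm_of_nonneg henergy]
    exact mul_le_mul_of_nonneg_right (hB y) henergy
  · simp only [image_eq_zero_of_notMem_tsupport hy, zero_mul, norm_zero]
    exact mul_nonneg hB0 (ha.mul_apply_self_nonneg (hsupp.trans hχs) (fun y ↦ sq_nonneg (χ y)) y _)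

theorem exists_integral_norm_apply_fderiv_le (ha : IsDirichletFormOn a Ω) (hΩ : IsOpen Ω)
    (hψ : ContDiff ℝ 1 ψ) (hψc : HasCompactSupport ψ) (hψs : tsupport ψ ⊆ Ω) :
    ∃ M, ∀ u : E → ℝ, IsWeaklyHarmonicOn a μ u Ω → (∀ y ∈ Ω, |u y| ≤ 1) →
      ∫ y, ‖a y (fderiv ℝ u y) (fderiv ℝ ψ y)‖ ∂μ ≤ M := by
  obtain ⟨χ, hχ, hχc, hχs, -, hχ1⟩ := exists_cutoff hψc.isCompact hΩ hψs
  obtain ⟨M, hM⟩ := exists_integral_norm_mul_energy_le (μ := μ) ha hΩ hχ.continuous hχc hχs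
  refine ⟨M + ∫ y, a y (fderiv ℝ ψ y) (fderiv ℝ ψ y) ∂μ, fun u hu hu1 ↦ ?_⟩
  have hint := (ha.integrable_mul_apply (μ := μ) hΩ hχ.continuous hχc hχs hu.1 hu.1).norm
  have hint' : Integrable (fun y ↦ a y (fderiv ℝ ψ y) (fderiv ℝ ψ y)) μ := by
    simpa only [one_mul] using ha.integrable_mul_apply_fderiv hΩ hψ hψc hψs hψ.contDiffOn
      (continuousOn_const (c := 1))
  refine le_trans ?_ (add_le_add_left (hM u hu hu1) _)
  rw [← integral_add hint hint']
  refine integral_mono_of_nonneg (ae_of_all _ fun _ ↦ norm_nonneg _) (hint.add hint')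
    (ae_of_all _ fun y ↦ ?_)
  by_cases hy : y ∈ tsupport ψ
  · simp only [hχ1.self_of_nhdsSet y hy, one_mul,
      Real.norm_of_nonneg (ha.nonneg y (hψs hy) _)]
    exact ha.abs_apply_le (hψs hy) _ _
  · simp only [fderiv_of_notMem_tsupport ℝ hy, map_zero, norm_zero, add_zero, norm_nonneg]

end IsWeaklyHarmonicOn

end DirichletForm

namespace IsHarmonicGraphFamily

variable [MeasurableSpace E] {a : E → LinearMap.BilinForm ℝ (E →L[ℝ] ℝ)} {μ : Measure E}
  {h : E → ℝ → ℝ} {C : ℝ≥0} {y : E} {ψ : E → ℝ}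

theorem mem_Icc (H : IsHarmonicGraphFamily a μ h Ω C) (hy : y ∈ Ω) (t : ℝ) :
    h y t ∈ Icc (0 : ℝ) 1 := by
  rw [← H.eq_zero y hy _ (min_le_left 0 t), ← H.eq_one y hy _ (le_max_left 1 t)]
  exact ⟨H.monotone y hy (min_le_right _ _), H.monotone y hy (le_max_right _ _)⟩

theorem abs_le_one (H : IsHarmonicGraphFamily a μ h Ω C) (hy : y ∈ Ω) (t : ℝ) : |h y t| ≤ 1 :=
  abs_le.2 ⟨by linarith [(H.mem_Icc hy t).1], (H.mem_Icc hy t).2⟩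

theorem continuousOn_uncurry (H : IsHarmonicGraphFamily a μ h Ω C) :
    ContinuousOn (Function.uncurry h) (Ω ×ˢ univ) :=
  continuousOn_prod_of_continuousOn_lipschitzOnWith' _ C
    (fun y hy ↦ (H.lipschitz y hy).lipschitzOnWith)
    fun t _ ↦ (H.isWeaklyHarmonicOn t).1.continuousOn

theorem graphDifferential_eq_zero (H : IsHarmonicGraphFamily a μ h Ω C) (hΩ : IsOpen Ω)
    (hy : y ∈ Ω) {t : ℝ} (ht : t ∉ Icc (0 : ℝ) 1) : graphDifferential h (y, t) = 0 := by
  suffices ∃ c, (h · t) =ᶠ[𝓝 y] fun _ ↦ c by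
    obtain ⟨c, hc⟩ := this
    rw [graphDifferential, hc.fderiv_eq, fderiv_fun_const, Pi.zero_apply]
  obtain ht0 | ht1 := not_and_or.1 ht
  · exact ⟨0, (hΩ.eventually_mem hy).mono fun z hz ↦ H.eq_zero z hz t (not_le.1 ht0).le⟩
  · exact ⟨1, (hΩ.eventually_mem hy).mono fun z hz ↦ H.eq_one z hz t (not_le.1 ht1).le⟩

theorem exists_continuous_extension [FiniteDimensional ℝ E]
    (H : IsHarmonicGraphFamily a μ h Ω C) (hΩ : IsOpen Ω) (hS : IsCompact S) (hSΩ : S ⊆ Ω) :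
    ∃ g : E → ℝ → ℝ, Continuous (Function.uncurry g) ∧ (∀ y, LipschitzWith C (g y)) ∧
      (∀ y t, |g y t| ≤ 1) ∧ ∀ᶠ y in 𝓝ˢ S, g y = h y := by
  obtain ⟨χ, hχ, -, hχs, hχI, hχ1⟩ := exists_cutoff hS hΩ hSΩ
  have hΩ_or : ∀ y, y ∈ Ω ∨ χ y = 0 := fun y ↦
    or_iff_not_imp_left.2 fun hy ↦ image_eq_zero_of_notMem_tsupport fun h ↦ hy (hχs h)
  have habs : ∀ y, |χ y| ≤ 1 := fun y ↦ abs_le.2 ⟨by linarith [(hχI y).1], (hχI y).2⟩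
  refine ⟨fun y t ↦ χ y * h y t, ?_, fun y ↦ LipschitzWith.of_dist_le_mul fun s t ↦ ?_,
    fun y t ↦ ?_, hχ1.mono fun y hy ↦ funext fun t ↦ by simp only [hy, one_mul]⟩
  · exact continuous_mul_of_tsupport_subset hΩ hχ.continuous hχs H.continuousOn_uncurry
  · obtain hy | hy := hΩ_or y
    · rw [Real.dist_eq, ← mul_sub, abs_mul]
      exact (mul_le_of_le_one_left (abs_nonneg _) (habs y)).trans
        ((H.lipschitz y hy).dist_le_mul s t)
    · simp only [hy, zero_mul, dist_self]
      positivity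
  · obtain hy | hy := hΩ_or y
    · rw [abs_mul]
      exact mul_le_one₀ (habs y) (abs_nonneg _) (H.abs_le_one hy t)
    · simp [hy]

variable [BorelSpace E] [IsFiniteMeasureOnCompacts μ]

theorem integral_slice_mul_energy (H : IsHarmonicGraphFamily a μ h Ω C)
    (ha : IsDirichletFormOn a Ω) (hΩ : IsOpen Ω) (hψ : ContDiff ℝ 1 ψ) (hψc : HasCompactSupport ψ)
    (hψs : tsupport ψ ⊆ Ω) {g : E → ℝ → ℝ} (hgh : ∀ᶠ y in 𝓝ˢ (tsupport ψ), g y = h y) (s t : ℝ) :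
    ∫ y, g y s * (ψ y * a y (graphDifferential h (y, t)) (graphDifferential h (y, t))) ∂μ =
      2⁻¹ * ∫ y, g y t ^ 2 * a y (graphDifferential h (y, s)) (fderiv ℝ ψ y) ∂μ -
        ∫ y, g y s * (g y t * a y (graphDifferential h (y, t)) (fderiv ℝ ψ y)) ∂μ := by
  have hcases := eq_or_eq_zero_of_eventually_nhdsSet_tsupport hgh
  convert (H.isWeaklyHarmonicOn t).integral_mul_energy (H.isWeaklyHarmonicOn s) ha hΩ hψ
    hψc hψs using 3 with y
  · obtain hy | ⟨hy, -⟩ := hcases y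
    · simp only [hy, graphDifferential]
      ring
    · simp only [hy, zero_mul, mul_zero]
  · congr 1 with y
    obtain hy | ⟨-, hy⟩ := hcases y
    · simp only [hy, graphDifferential]
    · simp only [hy, map_zero, mul_zero]
  · ext y
    obtain hy | ⟨-, hy⟩ := hcases y
    · simp only [hy, graphDifferential]
      ring
    · simp only [hy, map_zero, mul_zero]

variable [FiniteDimensional ℝ E]

theorem integrable_mul_energy (H : IsHarmonicGraphFamily a μ h Ω C) (ha : IsDirichletFormOn a Ω)
    (hΩ : IsOpen Ω) (hψ : Continuous ψ) (hψc : HasCompactSupport ψ) (hψs : tsupport ψ ⊆ Ω) :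
    Integrable (fun p : E × ℝ ↦ ψ p.1 * a p.1 (graphDifferential h p) (graphDifferential h p))
      (μ.prod volume) := by
  obtain ⟨g, hg, -, -, hgh⟩ := H.exists_continuous_extension hΩ hψc.isCompact hψs
  obtain ⟨M, hM⟩ := IsWeaklyHarmonicOn.exists_integral_norm_mul_energy_le (μ := μ) ha hΩ hψ hψc hψs
  have hD := measurable_graphDifferential hg
  refine integrable_prod_of_slices (M := M) ?_ (fun t ↦ ha.integrable_mul_apply hΩ hψ hψc hψs
      (H.isWeaklyHarmonicOn t).1 (H.isWeaklyHarmonicOn t).1)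
    (fun t ↦ hM _ (H.isWeaklyHarmonicOn t) fun y hy ↦ H.abs_le_one hy t) fun t ht y ↦ ?_
  · refine (ha.measurable_mul hΩ hψ hψs hD hD).aestronglyMeasurable.congr (ae_of_all _ fun p ↦ ?_)
    by_cases hp : p.1 ∈ tsupport ψ
    · simp only [graphDifferential_congr hgh hp]
    · simp only [image_eq_zero_of_notMem_tsupport hp, zero_mul]
  · by_cases hy : y ∈ tsupport ψ
    · rw [H.graphDifferential_eq_zero hΩ (hψs hy) ht, map_zero, mul_zero]
    · rw [image_eq_zero_of_notMem_tsupport hy, zero_mul]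

theorem integrable_apply_fderiv (H : IsHarmonicGraphFamily a μ h Ω C) (ha : IsDirichletFormOn a Ω)
    (hΩ : IsOpen Ω) (hψ : ContDiff ℝ 1 ψ) (hψc : HasCompactSupport ψ) (hψs : tsupport ψ ⊆ Ω) :
    Integrable (fun p : E × ℝ ↦ a p.1 (graphDifferential h p) (fderiv ℝ ψ p.1))
      (μ.prod volume) := by
  obtain ⟨g, hg, -, -, hgh⟩ := H.exists_continuous_extension hΩ hψc.isCompact hψs
  obtain ⟨χ, hχ, -, hχs, -, hχ1⟩ := exists_cutoff hψc.isCompact hΩ hψs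
  obtain ⟨M, hM⟩ := IsWeaklyHarmonicOn.exists_integral_norm_apply_fderiv_le (μ := μ) ha hΩ hψ hψc
    hψs
  refine integrable_prod_of_slices (M := M) ?_ (fun t ↦ ?_)
    (fun t ↦ hM _ (H.isWeaklyHarmonicOn t) fun y hy ↦ H.abs_le_one hy t) fun t ht y ↦ ?_
  · refine (ha.measurable_mul hΩ hχ.continuous hχs (measurable_graphDifferential hg)
      ((hψ.continuous_fderiv one_ne_zero).measurable.comp
        measurable_fst)).aestronglyMeasurable.congr (ae_of_all _ fun p ↦ ?_)
    by_cases hp : p.1 ∈ tsupport ψ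
    · simp only [Function.comp_apply, graphDifferential_congr hgh hp, hχ1.self_of_nhdsSet _ hp,
        one_mul]
    · simp only [Function.comp_apply, fderiv_of_notMem_tsupport ℝ hp, map_zero, mul_zero]
  · simpa only [one_mul, graphDifferential] using ha.integrable_mul_apply_fderiv (μ := μ) hΩ hψ hψc
      hψs (H.isWeaklyHarmonicOn t).1 (continuousOn_const (c := 1))
  · by_cases hy : y ∈ tsupport ψ
    · rw [H.graphDifferential_eq_zero hΩ (hψs hy) ht, map_zero, LinearMap.zero_apply]
    · rw [fderiv_of_notMem_tsupport ℝ hy, map_zero]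

theorem integral_translate_mul_energy (H : IsHarmonicGraphFamily a μ h Ω C)
    (ha : IsDirichletFormOn a Ω) (hΩ : IsOpen Ω) (hψ : ContDiff ℝ 1 ψ) (hψc : HasCompactSupport ψ)
    (hψs : tsupport ψ ⊆ Ω) {g : E → ℝ → ℝ} (hg : Continuous (Function.uncurry g))
    (hg1 : ∀ y t, |g y t| ≤ 1) (hgh : ∀ᶠ y in 𝓝ˢ (tsupport ψ), g y = h y) (δ : ℝ) :
    ∫ p, g p.1 (p.2 + δ) * (ψ p.1 * a p.1 (graphDifferential h p) (graphDifferential h p))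
        ∂μ.prod volume =
      2⁻¹ * ∫ p, g p.1 (p.2 - δ) ^ 2 * a p.1 (graphDifferential h p) (fderiv ℝ ψ p.1)
          ∂μ.prod volume -
        ∫ p, g p.1 (p.2 + δ) * (g p.1 p.2 * a p.1 (graphDifferential h p) (fderiv ℝ ψ p.1))
          ∂μ.prod volume := by
  set e : E × ℝ → ℝ := fun p ↦ ψ p.1 * a p.1 (graphDifferential h p) (graphDifferential h p)
    with he_def
  set f : E × ℝ → ℝ := fun p ↦ a p.1 (graphDifferential h p) (fderiv ℝ ψ p.1) with hf_def
  have he : Integrable e (μ.prod volume) := H.integrable_mul_energy ha hΩ hψ.continuous hψc hψs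
  have hf : Integrable f (μ.prod volume) := H.integrable_apply_fderiv ha hΩ hψ hψc hψs
  have hf1 : Integrable (fun p ↦ g p.1 p.2 ^ 2 * f (p.1, p.2 + δ)) (μ.prod volume) :=
    (integrable_prod_add_right hf δ).bdd_mul (c := 1) (hg.pow 2).aestronglyMeasurable
      (ae_of_all _ fun p ↦ by
        simpa only [norm_pow] using pow_le_one₀ (norm_nonneg _) (hg1 p.1 p.2))
  have hf2 : Integrable (fun p ↦ g p.1 (p.2 + δ) * (g p.1 p.2 * f p)) (μ.prod volume) :=
    integrable_translate_mul (hf.bdd_mul hg.aestronglyMeasurable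
      (ae_of_all _ fun p ↦ hg1 p.1 p.2)) hg hg1 δ
  rw [integral_prod_symm _ (integrable_translate_mul he hg hg1 δ), integral_prod_symm _ hf2,
    ← integral_prod_add_right (fun p ↦ g p.1 (p.2 - δ) ^ 2 * f p) δ]
  simp only [add_sub_cancel_right, he_def, hf_def,
    H.integral_slice_mul_energy ha hΩ hψ hψc hψs hgh]
  rw [integral_prod_symm _ hf1, integral_sub (hf1.integral_prod_right.const_mul _)
    hf2.integral_prod_right, integral_const_mul]

theorem integral_deriv_mul_energy (H : IsHarmonicGraphFamily a μ h Ω C)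
    (ha : IsDirichletFormOn a Ω) (hΩ : IsOpen Ω) (hψ : ContDiff ℝ 1 ψ) (hψc : HasCompactSupport ψ)
    (hψs : tsupport ψ ⊆ Ω) :
    ∫ p, deriv (h p.1) p.2 * (ψ p.1 * a p.1 (graphDifferential h p) (graphDifferential h p))
        ∂μ.prod volume =
      -2 * ∫ p, deriv (h p.1) p.2 *
        (h p.1 p.2 * a p.1 (graphDifferential h p) (fderiv ℝ ψ p.1)) ∂μ.prod volume := by
  obtain ⟨g, hg, hC, hg1, hgh⟩ := H.exists_continuous_extension hΩ hψc.isCompact hψs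
  convert integral_deriv_mul_of_integral_translate_mul
    (H.integrable_mul_energy ha hΩ hψ.continuous hψc hψs)
    (H.integrable_apply_fderiv ha hΩ hψ hψc hψs) hg hC hg1
    (H.integral_translate_mul_energy ha hΩ hψ hψc hψs hg hg1 hgh) using 3 with p
  · obtain hp | ⟨hp, -⟩ := eq_or_eq_zero_of_eventually_nhdsSet_tsupport hgh p.1 <;> simp [hp]
  · ext p
    obtain hp | ⟨-, hp⟩ := eq_or_eq_zero_of_eventually_nhdsSet_tsupport hgh p.1 <;> simp [hp]

theorem integrable_deriv_mul_energy (H : IsHarmonicGraphFamily a μ h Ω C)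
    (ha : IsDirichletFormOn a Ω) (hΩ : IsOpen Ω) (hψ : Continuous ψ) (hψc : HasCompactSupport ψ)
    (hψs : tsupport ψ ⊆ Ω) :
    Integrable (fun p : E × ℝ ↦ deriv (h p.1) p.2 *
      (ψ p.1 * a p.1 (graphDifferential h p) (graphDifferential h p))) (μ.prod volume) := by
  obtain ⟨g, hg, hC, -, hgh⟩ := H.exists_continuous_extension hΩ hψc.isCompact hψs
  convert integrable_deriv_mul (H.integrable_mul_energy ha hΩ hψ hψc hψs) hg hC using 2 with p
  obtain hp | ⟨hp, -⟩ := eq_or_eq_zero_of_eventually_nhdsSet_tsupport hgh p.1 <;> simp [hp]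

theorem integrable_deriv_mul_apply_fderiv (H : IsHarmonicGraphFamily a μ h Ω C)
    (ha : IsDirichletFormOn a Ω) (hΩ : IsOpen Ω) (hψ : ContDiff ℝ 1 ψ) (hψc : HasCompactSupport ψ)
    (hψs : tsupport ψ ⊆ Ω) :
    Integrable (fun p : E × ℝ ↦ deriv (h p.1) p.2 *
      (h p.1 p.2 * a p.1 (graphDifferential h p) (fderiv ℝ ψ p.1))) (μ.prod volume) := by
  obtain ⟨g, hg, hC, hg1, hgh⟩ := H.exists_continuous_extension hΩ hψc.isCompact hψs
  convert integrable_deriv_mul (integrable_translate_mul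
    (H.integrable_apply_fderiv ha hΩ hψ hψc hψs) hg hg1 0) hg hC using 2 with p
  obtain hp | ⟨-, hp⟩ := eq_or_eq_zero_of_eventually_nhdsSet_tsupport hgh p.1 <;> simp [hp]

end IsHarmonicGraphFamily

end GraphFamily

/-! ### The leafwise gradient -/

section FiberIntegral

theorem image_setOf_differentiableAt_ae_eq_range {f : ℝ → ℝ} {C : ℝ≥0} (hf : LipschitzWith C f) :
    f '' {t | DifferentiableAt ℝ f t} =ᵐ[volume] range f := by
  refine ae_eq_set.2 ⟨by rw [sdiff_eq_empty.2 (image_subset_range _ _), measure_empty],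
    measure_mono_null (range_sdiff_image_subset _ _) ?_⟩
  have hnull : volume {t | DifferentiableAt ℝ f t}ᶜ = 0 := hf.ae_differentiableAt_real
  have himage := hf.hausdorffMeasure_image_le zero_le_one {t | DifferentiableAt ℝ f t}ᶜ
  rwa [hausdorffMeasure_real, hnull, mul_zero, nonpos_iff_eq_zero] at himage

variable {F : Type*} [NormedAddCommGroup F] [NormedSpace ℝ F] {C : ℝ≥0}

theorem integrableOn_range_iff_integrable_deriv_smul {f : ℝ → ℝ} (hf : LipschitzWith C f)
    (hm : Monotone f) (g : ℝ → F) :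
    IntegrableOn g (range f) ↔ Integrable fun t ↦ deriv f t • g (f t) := by
  have hae : ∀ᵐ t, t ∈ {t | DifferentiableAt ℝ f t} := hf.ae_differentiableAt_real
  rw [← integrableOn_congr_set_ae (image_setOf_differentiableAt_ae_eq_range hf),
    integrableOn_image_iff_integrableOn_deriv_smul_of_monotoneOn
      (measurableSet_of_differentiableAt ℝ f) (fun t ht ↦ ht.hasDerivAt.hasDerivWithinAt)
      (hm.monotoneOn _), IntegrableOn, Measure.restrict_eq_self_of_ae_mem hae]

theorem integral_range_eq_integral_deriv_smul {f : ℝ → ℝ} (hf : LipschitzWith C f)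
    (hm : Monotone f) (g : ℝ → F) : ∫ s in range f, g s = ∫ t, deriv f t • g (f t) := by
  have hae : ∀ᵐ t, t ∈ {t | DifferentiableAt ℝ f t} := hf.ae_differentiableAt_real
  rw [← setIntegral_congr_set (image_setOf_differentiableAt_ae_eq_range hf),
    integral_image_eq_integral_deriv_smul_of_monotoneOn
      (measurableSet_of_differentiableAt ℝ f) (fun t ht ↦ ht.hasDerivAt.hasDerivWithinAt)
      (hm.monotoneOn _), Measure.restrict_eq_self_of_ae_mem hae]

/-- The function `f` from the unit interval to itself, as a function on the real line that is
constant on both sides of the unit interval. -/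
noncomputable def realExtension (f : unitInterval → unitInterval) : ℝ → ℝ :=
  IccExtend zero_le_one fun t ↦ (f t : ℝ)

variable {f : unitInterval → unitInterval}

theorem lipschitzWith_realExtension (hf : LipschitzWith C f) :
    LipschitzWith C (realExtension f) := by
  have hcomp := ((LipschitzWith.subtype_val _).comp hf).comp
    (LipschitzWith.projIcc (zero_le_one' ℝ))
  rwa [one_mul, mul_one] at hcomp

theorem monotone_realExtension (hf : Monotone f) : Monotone (realExtension f) :=
  Monotone.IccExtend _ fun _ _ hst ↦ hf hst

theorem range_realExtension (hf : Function.Surjective f) :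
    range (realExtension f) = Icc 0 1 := by
  rw [realExtension, IccExtend_range]
  exact (hf.range_comp Subtype.val).trans Subtype.range_val

theorem projIcc_realExtension (t : ℝ) :
    projIcc 0 1 zero_le_one (realExtension f t) = f (projIcc 0 1 zero_le_one t) :=
  projIcc_val _ _

theorem integrable_unitInterval_iff (hf : LipschitzWith C f) (hm : Monotone f)
    (hs : Function.Surjective f) {g : unitInterval → F} :
    Integrable g ↔ Integrable fun t ↦ deriv (realExtension f) t •
      g (f (projIcc 0 1 zero_le_one t)) := by
  have hiff := integrableOn_range_iff_integrable_deriv_smul (lipschitzWith_realExtension hf)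
    (monotone_realExtension hm) (IccExtend zero_le_one g)
  rw [range_realExtension hs, integrableOn_iff_comap_subtypeVal measurableSet_Icc] at hiff
  simp only [IccExtend, Function.comp_def, projIcc_val, projIcc_realExtension] at hiff
  exact hiff

theorem integral_unitInterval_eq (hf : LipschitzWith C f) (hm : Monotone f)
    (hs : Function.Surjective f) (g : unitInterval → F) :
    ∫ s, g s = ∫ t, deriv (realExtension f) t • g (f (projIcc 0 1 zero_le_one t)) := by
  have heq := integral_range_eq_integral_deriv_smul (lipschitzWith_realExtension hf)
    (monotone_realExtension hm) (IccExtend zero_le_one g)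
  rw [range_realExtension hs, ← integral_subtype_comap measurableSet_Icc] at heq
  simp only [IccExtend, Function.comp_apply, projIcc_val, projIcc_realExtension] at heq
  exact heq

end FiberIntegral

section LeafGraph

variable {n : ℕ} {K : Type*} [TopologicalSpace K]

/-- The height function, near `p.1`, of the leaf of `F` through `p`. It is meaningful only as a germ
at `p.1`. -/
noncomputable def leafGraph
    (F : Foliation (EuclideanSpace ℝ (Fin n)) unitInterval (K × unitInterval))
    (p : K × unitInterval) : K → unitInterval :=
  Classical.epsilon fun u ↦ u p.1 = p.2 ∧ ∃ O ∈ 𝓝 p.1, F.LeafContinuousOn (fun q ↦ (q, u q)) O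

variable {F : Foliation (EuclideanSpace ℝ (Fin n)) unitInterval (K × unitInterval)} {q₀ q : K}
  {U : Set K} {h : K → unitInterval → unitInterval} {C : ℝ≥0}

theorem IsFoliatedBox.leafGraph_eventuallyEq (H : IsFoliatedBox F q₀ U h C)
    (hF : IsFoliatedIBundle F) (hq : q ∈ U) (t : unitInterval) :
    leafGraph F (q, h q t) =ᶠ[𝓝 q] (h · t) := by
  have hspec := Classical.epsilon_spec (p := fun u : K → unitInterval ↦ u q = h q t ∧
    ∃ O ∈ 𝓝 q, F.LeafContinuousOn (fun q ↦ (q, u q)) O)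
    ⟨(h · t), rfl, U, H.isOpen.mem_nhds hq, H.leafContinuousOn t⟩
  obtain ⟨hval, O, hO, hcont⟩ := hspec
  have hev := hF.section_eventuallyEq (hcont.mono inter_subset_left)
    ((H.leafContinuousOn t).mono inter_subset_right) ⟨mem_of_mem_nhds hO, hq⟩ hval
  rwa [nhdsWithin_eq_nhds.2 (inter_mem hO (H.isOpen.mem_nhds hq))] at hev

variable [ChartedSpace (EuclideanSpace ℝ (Fin n)) K]
  [RiemannianBundle (fun x : K ↦ TangentSpace (𝓡 n) x)]

/-- The gradient of the height function along the leaf of `F` through `(q, s)`, as a tangent vector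
to the base. -/
noncomputable def leafGradient
    (F : Foliation (EuclideanSpace ℝ (Fin n)) unitInterval (K × unitInterval)) (q : K)
    (s : unitInterval) : TangentSpace (𝓡 n) q :=
  riemannianGradient (fun q' ↦ (leafGraph F (q, s) q' : ℝ)) q

variable {c : OpenPartialHomeomorph K (EuclideanSpace ℝ (Fin n))} {y : EuclideanSpace ℝ (Fin n)}

/-- The holonomy of a foliated box, written in the chart `c`. -/
noncomputable def boxGraph (c : OpenPartialHomeomorph K (EuclideanSpace ℝ (Fin n)))
    (h : K → unitInterval → unitInterval) (y : EuclideanSpace ℝ (Fin n)) : ℝ → ℝ :=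
  realExtension (h (c.symm y))

namespace IsFoliatedBox

theorem leafGradient_eq (H : IsFoliatedBox F q₀ U h C) (hF : IsFoliatedIBundle F) (hq : q ∈ U)
    (t : unitInterval) :
    leafGradient F q (h q t) = riemannianGradient (fun q' ↦ (h q' t : ℝ)) q :=
  riemannianGradient_congr ((H.leafGraph_eventuallyEq hF hq t).fun_comp Subtype.val)

variable [IsManifold (𝓡 n) ∞ K]

theorem isHarmonicOn (H : IsFoliatedBox F q₀ U h C) (hF : IsHarmonicFoliation F)
    (t : unitInterval) : IsHarmonicOn (n := n) (fun q ↦ (h q t : ℝ)) U :=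
  hF.2.2 U (fun q ↦ (q, h q t)) H.isOpen (fun _ _ ↦ rfl) (H.leafContinuousOn t)

theorem mdifferentiableAt (H : IsFoliatedBox F q₀ U h C) (hF : IsHarmonicFoliation F) (hq : q ∈ U)
    (t : unitInterval) : MDifferentiableAt (𝓡 n) 𝓘(ℝ, ℝ) (fun q ↦ (h q t : ℝ)) q :=
  ((H.isHarmonicOn hF t).1.contMDiffAt (H.isOpen.mem_nhds hq)).mdifferentiableAt two_ne_zero

theorem energyForm_graphDifferential_fderiv (H : IsFoliatedBox F q₀ U h C)
    (hF : IsHarmonicFoliation F) (hc : c ∈ atlas (EuclideanSpace ℝ (Fin n)) K)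
    (hy : y ∈ c.target ∩ c.symm ⁻¹' U) {v : K → ℝ}
    (hv : MDifferentiableAt (𝓡 n) 𝓘(ℝ, ℝ) v (c.symm y)) (t : ℝ) :
    energyForm c y (graphDifferential (boxGraph c h) (y, t)) (fderiv ℝ (v ∘ c.symm) y) =
      volDensity c y * inner ℝ
        (leafGradient F (c.symm y) (h (c.symm y) (projIcc 0 1 zero_le_one t)))
        (riemannianGradient v (c.symm y)) := by
  rw [energyForm_apply, H.leafGradient_eq hF.1 hy.2,
    inner_riemannianGradient_eq_cometric hc hy.1 (H.mdifferentiableAt hF hy.2 _) hv]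
  rfl

theorem energyForm_graphDifferential_self (H : IsFoliatedBox F q₀ U h C)
    (hF : IsHarmonicFoliation F) (hc : c ∈ atlas (EuclideanSpace ℝ (Fin n)) K)
    (hy : y ∈ c.target ∩ c.symm ⁻¹' U) (t : ℝ) :
    energyForm c y (graphDifferential (boxGraph c h) (y, t))
        (graphDifferential (boxGraph c h) (y, t)) =
      volDensity c y * inner ℝ
        (leafGradient F (c.symm y) (h (c.symm y) (projIcc 0 1 zero_le_one t)))
        (leafGradient F (c.symm y) (h (c.symm y) (projIcc 0 1 zero_le_one t))) := by
  have hh := H.mdifferentiableAt hF hy.2 (projIcc 0 1 zero_le_one t)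
  rw [energyForm_apply, H.leafGradient_eq hF.1 hy.2,
    inner_riemannianGradient_eq_cometric hc hy.1 hh hh]
  rfl

theorem graphDifferential_eq_zero (H : IsFoliatedBox F q₀ U h C) (hF : IsHarmonicFoliation F)
    (hc : c ∈ atlas (EuclideanSpace ℝ (Fin n)) K) (hy : y ∈ c.target ∩ c.symm ⁻¹' U) {t : ℝ}
    (hX : leafGradient F (c.symm y) (h (c.symm y) (projIcc 0 1 zero_le_one t)) = 0) :
    graphDifferential (boxGraph c h) (y, t) = 0 := by
  have hh := H.mdifferentiableAt hF hy.2 (projIcc 0 1 zero_le_one t)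
  rw [H.leafGradient_eq hF.1 hy.2] at hX
  have hfderiv : graphDifferential (boxGraph c h) (y, t) = mfderiv (𝓡 n) 𝓘(ℝ, ℝ)
      ((fun q ↦ (h q (projIcc 0 1 zero_le_one t) : ℝ)) ∘ c.symm) y :=
    mfderiv_eq_fderiv.symm
  ext v
  rw [hfderiv, mfderiv_comp y hh (mdifferentiableAt_symm_of_mem_atlas hc hy.1)]
  refine (inner_riemannianGradient (n := n) (fun q ↦ (h q (projIcc 0 1 zero_le_one t) : ℝ))
    (c.symm y) (mfderiv (𝓡 n) (𝓡 n) c.symm y v)).symm.trans ?_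
  rw [hX, inner_zero_left]
  rfl

variable [IsContMDiffRiemannianBundle (𝓡 n) ∞ (EuclideanSpace ℝ (Fin n))
  (fun x : K ↦ TangentSpace (𝓡 n) x)]

theorem isHarmonicGraphFamily (H : IsFoliatedBox F q₀ U h C) (hF : IsHarmonicFoliation F)
    (hc : c ∈ atlas (EuclideanSpace ℝ (Fin n)) K) :
    IsHarmonicGraphFamily (energyForm c) volume (boxGraph c h) (c.target ∩ c.symm ⁻¹' U) C where
  isWeaklyHarmonicOn t :=
    ⟨((H.isHarmonicOn hF _).contDiffOn_comp_symm hc).of_le one_le_two, fun _ hφ hφc hφs ↦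
      (H.isHarmonicOn hF _).integral_energyForm_eq_zero H.isOpen hc hφ hφc hφs⟩
  lipschitz y hy := lipschitzWith_realExtension (H.lipschitz _ hy.2)
  monotone y hy := monotone_realExtension (H.strictMono hF.1 hy.2).monotone
  eq_zero y hy t ht := by
    rw [boxGraph, realExtension, IccExtend_of_le_left _ _ ht]
    exact congrArg Subtype.val (H.zero hF.1 hy.2)
  eq_one y hy t ht := by
    rw [boxGraph, realExtension, IccExtend_of_right_le _ _ ht]
    exact congrArg Subtype.val (H.one hF.1 hy.2)

end IsFoliatedBox

theorem isDirichletFormOn_energyForm [IsManifold (𝓡 n) ∞ K]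
    [IsContMDiffRiemannianBundle (𝓡 n) ∞ (EuclideanSpace ℝ (Fin n))
      (fun x : K ↦ TangentSpace (𝓡 n) x)] {Ω : Set (EuclideanSpace ℝ (Fin n))}
    (hc : c ∈ atlas (EuclideanSpace ℝ (Fin n)) K) (hΩ : Ω ⊆ c.target) :
    IsDirichletFormOn (energyForm c) Ω where
  continuousOn := (continuousOn_energyForm hc).mono (prod_mono hΩ subset_rfl)
  symm _ hy := energyForm_symm hc (hΩ hy)
  nonneg _ hy := energyForm_self_nonneg hc (hΩ hy)

end LeafGraph

section ChartExtension

variable {n : ℕ} {K : Type*} [TopologicalSpace K]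
  {c : OpenPartialHomeomorph K (EuclideanSpace ℝ (Fin n))} {ψ : K → ℝ} {U : Set K}
  {y : EuclideanSpace ℝ (Fin n)}

/-- The function `ψ` written in the chart `c` and extended by zero. -/
noncomputable def chartExtension (c : OpenPartialHomeomorph K (EuclideanSpace ℝ (Fin n)))
    (ψ : K → ℝ) : EuclideanSpace ℝ (Fin n) → ℝ :=
  c.target.indicator (ψ ∘ c.symm)

theorem chartExtension_eventuallyEq (hy : y ∈ c.target) :
    chartExtension c ψ =ᶠ[𝓝 y] ψ ∘ c.symm :=
  eventually_of_mem (c.open_target.mem_nhds hy) fun _ hz ↦ indicator_of_mem hz _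

variable [CompactSpace K]

theorem isCompact_image_tsupport (hψ : tsupport ψ ⊆ c.source) : IsCompact (c '' tsupport ψ) :=
  (isClosed_tsupport ψ).isCompact.image_of_continuousOn (c.continuousOn.mono hψ)

theorem tsupport_chartExtension_subset (hψ : tsupport ψ ⊆ c.source) :
    tsupport (chartExtension c ψ) ⊆ c '' tsupport ψ := by
  refine closure_minimal (fun y hy ↦ ?_) (isCompact_image_tsupport hψ).isClosed
  have hyt : y ∈ c.target := mem_of_indicator_ne_zero hy
  refine ⟨c.symm y, subset_tsupport _ fun h ↦ hy ?_, c.right_inv hyt⟩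
  rw [chartExtension, indicator_of_mem hyt]
  exact h

theorem hasCompactSupport_chartExtension (hψ : tsupport ψ ⊆ c.source) :
    HasCompactSupport (chartExtension c ψ) :=
  HasCompactSupport.of_support_subset_isCompact (isCompact_image_tsupport hψ)
    ((subset_tsupport _).trans (tsupport_chartExtension_subset hψ))

theorem tsupport_chartExtension_subset_preimage (hUc : U ⊆ c.source) (hψ : tsupport ψ ⊆ U) :
    tsupport (chartExtension c ψ) ⊆ c.target ∩ c.symm ⁻¹' U := by
  refine (tsupport_chartExtension_subset (hψ.trans hUc)).trans (image_subset_iff.2 fun q hq ↦ ?_)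
  have hqc := hUc (hψ hq)
  exact ⟨c.map_source hqc, by rw [mem_preimage, c.left_inv hqc]; exact hψ hq⟩

theorem contDiff_chartExtension [ChartedSpace (EuclideanSpace ℝ (Fin n)) K]
    [IsManifold (𝓡 n) ∞ K] (hc : c ∈ atlas (EuclideanSpace ℝ (Fin n)) K)
    (hψ : ContMDiff (𝓡 n) 𝓘(ℝ, ℝ) 1 ψ) (hψs : tsupport ψ ⊆ c.source) :
    ContDiff ℝ 1 (chartExtension c ψ) := by
  refine contDiff_iff_contDiffAt.2 fun y ↦ ?_
  by_cases hy : y ∈ c.target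
  · refine ContDiffAt.congr_of_eventuallyEq ?_ (chartExtension_eventuallyEq hy)
    exact contMDiffAt_iff_contDiffAt.1 (hψ.contMDiffAt.comp y
      (((contMDiffOn_atlas_symm hc).of_le (by norm_cast)).contMDiffAt (c.open_target.mem_nhds hy)))
  · have hy' : y ∉ tsupport (chartExtension c ψ) := fun h ↦
      hy (tsupport_chartExtension_subset_preimage subset_rfl hψs h).1
    exact contDiffAt_const.congr_of_eventuallyEq (notMem_tsupport_iff_eventuallyEq.1 hy')

end ChartExtension

section BoxPullback

variable {n : ℕ} {K : Type*} [TopologicalSpace K] [ChartedSpace (EuclideanSpace ℝ (Fin n)) K]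
  [RiemannianBundle (fun x : K ↦ TangentSpace (𝓡 n) x)]

/-- The density of `G dvol ds` in the coordinates `(y, t)` of a foliated box contained in the domain
of the chart `c`: the leaf coordinate `t` and the height `s` are related by `s = h q t`. -/
noncomputable def boxPullback (c : OpenPartialHomeomorph K (EuclideanSpace ℝ (Fin n))) (U : Set K)
    (h : K → unitInterval → unitInterval) (G : K → unitInterval → ℝ)
    (p : EuclideanSpace ℝ (Fin n) × ℝ) : ℝ :=
  (c.target ∩ c.symm ⁻¹' U).indicator (fun y ↦ deriv (boxGraph c h y) p.2 *
    (volDensity c y * G (c.symm y) (h (c.symm y) (projIcc 0 1 zero_le_one p.2)))) p.1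

variable {F : Foliation (EuclideanSpace ℝ (Fin n)) unitInterval (K × unitInterval)} {q₀ : K}
  {U : Set K} {h : K → unitInterval → unitInterval} {C : ℝ≥0}
  {c : OpenPartialHomeomorph K (EuclideanSpace ℝ (Fin n))} {y : EuclideanSpace ℝ (Fin n)}
  {G : K → unitInterval → ℝ}

theorem boxPullback_of_mem (hy : y ∈ c.target ∩ c.symm ⁻¹' U) (t : ℝ) :
    boxPullback c U h G (y, t) = volDensity c y * (deriv (realExtension (h (c.symm y))) t •
      G (c.symm y) (h (c.symm y) (projIcc 0 1 zero_le_one t))) := by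
  rw [boxPullback, indicator_of_mem hy, mul_left_comm]
  rfl

theorem boxPullback_of_notMem (hy : y ∉ c.target ∩ c.symm ⁻¹' U) (t : ℝ) :
    boxPullback c U h G (y, t) = 0 :=
  indicator_of_notMem hy _

namespace IsFoliatedBox

theorem integral_boxPullback_slice (H : IsFoliatedBox F q₀ U h C) (hF : IsFoliatedIBundle F)
    (hG : ∀ q ∉ U, G q = 0) (hy : y ∈ c.target) :
    ∫ t, boxPullback c U h G (y, t) = volDensity c y * ∫ s, G (c.symm y) s := by
  by_cases hyU : c.symm y ∈ U
  · simp only [boxPullback_of_mem ⟨hy, hyU⟩]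
    rw [integral_const_mul, integral_unitInterval_eq (H.lipschitz _ hyU)
      (H.strictMono hF hyU).monotone (H.surjective hF hyU)]
  · simp [boxPullback_of_notMem (fun h ↦ hyU h.2), hG _ hyU]

variable [IsManifold (𝓡 n) ∞ K]

theorem integrable_of_integrable_boxPullback_slice (H : IsFoliatedBox F q₀ U h C)
    (hF : IsFoliatedIBundle F) (hG : ∀ q ∉ U, G q = 0)
    (hc : c ∈ atlas (EuclideanSpace ℝ (Fin n)) K) (hy : y ∈ c.target)
    (hint : Integrable fun t ↦ boxPullback c U h G (y, t)) : Integrable (G (c.symm y)) := by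
  by_cases hyU : c.symm y ∈ U
  · simp only [boxPullback_of_mem ⟨hy, hyU⟩] at hint
    rw [integrable_const_mul_iff (volDensity_pos hc hy).ne'.isUnit] at hint
    exact (integrable_unitInterval_iff (H.lipschitz _ hyU) (H.strictMono hF hyU).monotone
      (H.surjective hF hyU)).2 hint
  · rw [hG _ hyU]
    exact integrable_zero _ _ _

variable [MeasurableSpace K] [BorelSpace K] {μ : Measure K}
  [IsContMDiffRiemannianBundle (𝓡 n) ∞ (EuclideanSpace ℝ (Fin n))
    (fun x : K ↦ TangentSpace (𝓡 n) x)]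

theorem ae_integrable_of_integrable_boxPullback (H : IsFoliatedBox F q₀ U h C)
    (hF : IsFoliatedIBundle F) (hμ : IsRiemannianVolume (n := n) μ)
    (hc : c ∈ atlas (EuclideanSpace ℝ (Fin n)) K) (hUc : U ⊆ c.source) (hG : ∀ q ∉ U, G q = 0)
    (hint : Integrable (boxPullback c U h G) (volume.prod volume)) :
    ∀ᵐ q ∂μ, Integrable (G q) := by
  have hsource : ∀ᵐ q ∂μ, q ∈ c.source → Integrable (G q) :=
    (hμ.ae_iff hc).2 <| hint.prod_right_ae.mono fun y hy hyc ↦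
      H.integrable_of_integrable_boxPullback_slice hF hG hc hyc hy
  filter_upwards [hsource] with q hq
  by_cases hqc : q ∈ c.source
  · exact hq hqc
  · rw [hG q fun hqU ↦ hqc (hUc hqU)]
    exact integrable_zero _ _ _

theorem integrable_integral_of_integrable_boxPullback (H : IsFoliatedBox F q₀ U h C)
    (hF : IsFoliatedIBundle F) (hμ : IsRiemannianVolume (n := n) μ)
    (hc : c ∈ atlas (EuclideanSpace ℝ (Fin n)) K) (hUc : U ⊆ c.source) (hG : ∀ q ∉ U, G q = 0)
    (hint : Integrable (boxPullback c U h G) (volume.prod volume)) :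
    Integrable (fun q ↦ ∫ s, G q s) μ := by
  have hzero : ∀ q ∉ c.source, ∫ s, G q s = 0 := fun q hq ↦ by
    simp [hG q fun hqU ↦ hq (hUc hqU)]
  refine IntegrableOn.integrable_of_forall_notMem_eq_zero ((hμ.integrableOn_source_iff hc).2 ?_)
    hzero
  exact hint.integral_prod_left.integrableOn.congr_fun
    (fun y hy ↦ H.integral_boxPullback_slice hF hG hy) c.open_target.measurableSet

theorem integral_boxPullback (H : IsFoliatedBox F q₀ U h C)
    (hF : IsFoliatedIBundle F) (hμ : IsRiemannianVolume (n := n) μ)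
    (hc : c ∈ atlas (EuclideanSpace ℝ (Fin n)) K) (hUc : U ⊆ c.source) (hG : ∀ q ∉ U, G q = 0)
    (hint : Integrable (boxPullback c U h G) (volume.prod volume)) :
    ∫ p, boxPullback c U h G p ∂volume.prod volume = ∫ q, (∫ s, G q s) ∂μ := by
  have hzero : ∀ q ∉ c.source, ∫ s, G q s = 0 := fun q hq ↦ by
    simp [hG q fun hqU ↦ hq (hUc hqU)]
  have htarget : ∀ y ∉ c.target, ∫ t, boxPullback c U h G (y, t) = 0 := fun y hy ↦ by
    simp [boxPullback_of_notMem (fun h ↦ hy h.1)]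
  rw [integral_prod _ hint, ← setIntegral_eq_integral_of_forall_compl_eq_zero htarget,
    ← setIntegral_eq_integral_of_forall_compl_eq_zero hzero, hμ.setIntegral_source hc]
  exact setIntegral_congr_fun c.open_target.measurableSet fun y hy ↦
    H.integral_boxPullback_slice hF hG hy

end IsFoliatedBox

end BoxPullback

section GlobalEnergy

variable {n : ℕ} {K : Type*} [TopologicalSpace K] [ChartedSpace (EuclideanSpace ℝ (Fin n)) K]
  [RiemannianBundle (fun x : K ↦ TangentSpace (𝓡 n) x)]
  {F : Foliation (EuclideanSpace ℝ (Fin n)) unitInterval (K × unitInterval)} {q₀ : K}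
  {U : Set K} {h : K → unitInterval → unitInterval} {C : ℝ≥0}
  {c : OpenPartialHomeomorph K (EuclideanSpace ℝ (Fin n))} {ψ : K → ℝ}

/-- `ψ |∇π₂|²`, where `∇π₂` is the leafwise gradient of the height function. -/
noncomputable def weightedLeafEnergy
    (F : Foliation (EuclideanSpace ℝ (Fin n)) unitInterval (K × unitInterval)) (ψ : K → ℝ) (q : K)
    (s : unitInterval) : ℝ :=
  ψ q * inner ℝ (leafGradient F q s) (leafGradient F q s)

/-- `π₂ ⟪∇π₂, ∇ψ⟫`, where `∇π₂` is the leafwise gradient of the height function. -/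
noncomputable def leafFlux
    (F : Foliation (EuclideanSpace ℝ (Fin n)) unitInterval (K × unitInterval)) (ψ : K → ℝ) (q : K)
    (s : unitInterval) : ℝ :=
  s * inner ℝ (leafGradient F q s) (riemannianGradient ψ q)

theorem weightedLeafEnergy_eq_zero {q : K} (hq : ψ q = 0) : weightedLeafEnergy F ψ q = 0 :=
  funext fun s ↦ by rw [weightedLeafEnergy, hq, zero_mul, Pi.zero_apply]

theorem leafFlux_eq_zero {q : K} (hq : q ∉ tsupport ψ) : leafFlux F ψ q = 0 := by
  have hgrad : riemannianGradient (n := n) ψ q = 0 := by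
    rw [riemannianGradient_congr (notMem_tsupport_iff_eventuallyEq.1 hq)]
    exact riemannianGradient_const 0 q
  exact funext fun s ↦ by rw [leafFlux, hgrad, inner_zero_right, mul_zero, Pi.zero_apply]

variable {ι : Type*} [Fintype ι] {φ : ι → K → ℝ}

theorem sum_leafFlux_eq_zero (hφ : ∀ i, MDifferentiable (𝓡 n) 𝓘(ℝ, ℝ) (φ i))
    (hsum : ∀ q, ∑ i, φ i q = 1) (q : K) (s : unitInterval) : ∑ i, leafFlux F (φ i) q s = 0 := by
  have hone : ∑ i, φ i = fun _ ↦ 1 := funext fun q ↦ (Finset.sum_apply ..).trans (hsum q)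
  have hgrad : ∑ i, riemannianGradient (n := n) (φ i) q = 0 := by
    rw [← riemannianGradient_sum fun i _ ↦ hφ i q, hone, riemannianGradient_const]
  simp only [leafFlux]
  rw [← Finset.mul_sum, ← inner_sum, hgrad, inner_zero_right, mul_zero]

variable [CompactSpace K] [IsManifold (𝓡 n) ∞ K]

namespace IsFoliatedBox

theorem boxPullback_weightedLeafEnergy (H : IsFoliatedBox F q₀ U h C) (hF : IsHarmonicFoliation F)
    (hc : c ∈ atlas (EuclideanSpace ℝ (Fin n)) K) (hUc : U ⊆ c.source) (hψ : tsupport ψ ⊆ U) :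
    boxPullback c U h (weightedLeafEnergy F ψ) = fun p ↦ deriv (boxGraph c h p.1) p.2 *
      (chartExtension c ψ p.1 * energyForm c p.1 (graphDifferential (boxGraph c h) p)
        (graphDifferential (boxGraph c h) p)) := by
  ext ⟨y, t⟩
  by_cases hy : y ∈ c.target ∩ c.symm ⁻¹' U
  · rw [boxPullback, indicator_of_mem hy, chartExtension, indicator_of_mem hy.1,
      H.energyForm_graphDifferential_self hF hc hy, weightedLeafEnergy,
      mul_left_comm (volDensity c y)]
    rfl
  · rw [boxPullback_of_notMem hy, image_eq_zero_of_notMem_tsupport fun h ↦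
      hy (tsupport_chartExtension_subset_preimage hUc hψ h), zero_mul, mul_zero]

theorem boxPullback_leafFlux (H : IsFoliatedBox F q₀ U h C) (hF : IsHarmonicFoliation F)
    (hc : c ∈ atlas (EuclideanSpace ℝ (Fin n)) K) (hUc : U ⊆ c.source)
    (hψ : MDifferentiable (𝓡 n) 𝓘(ℝ, ℝ) ψ) (hψs : tsupport ψ ⊆ U) :
    boxPullback c U h (leafFlux F ψ) = fun p ↦ deriv (boxGraph c h p.1) p.2 *
      (boxGraph c h p.1 p.2 * energyForm c p.1 (graphDifferential (boxGraph c h) p)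
        (fderiv ℝ (chartExtension c ψ) p.1)) := by
  ext ⟨y, t⟩
  by_cases hy : y ∈ c.target ∩ c.symm ⁻¹' U
  · rw [boxPullback, indicator_of_mem hy, (chartExtension_eventuallyEq hy.1).fderiv_eq,
      H.energyForm_graphDifferential_fderiv hF hc hy (hψ _), leafFlux,
      mul_left_comm (volDensity c y)]
    rfl
  · rw [boxPullback_of_notMem hy, fderiv_of_notMem_tsupport ℝ fun h ↦
      hy (tsupport_chartExtension_subset_preimage hUc hψs h), map_zero, mul_zero, mul_zero]

variable [IsContMDiffRiemannianBundle (𝓡 n) ∞ (EuclideanSpace ℝ (Fin n))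
  (fun x : K ↦ TangentSpace (𝓡 n) x)]

theorem integrable_boxPullback_weightedLeafEnergy (H : IsFoliatedBox F q₀ U h C)
    (hF : IsHarmonicFoliation F) (hc : c ∈ atlas (EuclideanSpace ℝ (Fin n)) K)
    (hUc : U ⊆ c.source) (hψ : ContMDiff (𝓡 n) 𝓘(ℝ, ℝ) 1 ψ) (hψs : tsupport ψ ⊆ U) :
    Integrable (boxPullback c U h (weightedLeafEnergy F ψ)) (volume.prod volume) := by
  rw [H.boxPullback_weightedLeafEnergy hF hc hUc hψs]
  exact (H.isHarmonicGraphFamily hF hc).integrable_deriv_mul_energy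
    (isDirichletFormOn_energyForm hc inter_subset_left) (c.symm.isOpen_inter_preimage H.isOpen)
    (contDiff_chartExtension hc hψ (hψs.trans hUc)).continuous
    (hasCompactSupport_chartExtension (hψs.trans hUc))
    (tsupport_chartExtension_subset_preimage hUc hψs)

theorem integrable_boxPullback_leafFlux (H : IsFoliatedBox F q₀ U h C)
    (hF : IsHarmonicFoliation F) (hc : c ∈ atlas (EuclideanSpace ℝ (Fin n)) K)
    (hUc : U ⊆ c.source) (hψ : ContMDiff (𝓡 n) 𝓘(ℝ, ℝ) 1 ψ) (hψs : tsupport ψ ⊆ U) :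
    Integrable (boxPullback c U h (leafFlux F ψ)) (volume.prod volume) := by
  rw [H.boxPullback_leafFlux hF hc hUc (hψ.mdifferentiable one_ne_zero) hψs]
  exact (H.isHarmonicGraphFamily hF hc).integrable_deriv_mul_apply_fderiv
    (isDirichletFormOn_energyForm hc inter_subset_left) (c.symm.isOpen_inter_preimage H.isOpen)
    (contDiff_chartExtension hc hψ (hψs.trans hUc))
    (hasCompactSupport_chartExtension (hψs.trans hUc))
    (tsupport_chartExtension_subset_preimage hUc hψs)

theorem integral_boxPullback_weightedLeafEnergy (H : IsFoliatedBox F q₀ U h C)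
    (hF : IsHarmonicFoliation F) (hc : c ∈ atlas (EuclideanSpace ℝ (Fin n)) K)
    (hUc : U ⊆ c.source) (hψ : ContMDiff (𝓡 n) 𝓘(ℝ, ℝ) 1 ψ) (hψs : tsupport ψ ⊆ U) :
    ∫ p, boxPullback c U h (weightedLeafEnergy F ψ) p ∂volume.prod volume =
      -2 * ∫ p, boxPullback c U h (leafFlux F ψ) p ∂volume.prod volume := by
  rw [H.boxPullback_weightedLeafEnergy hF hc hUc hψs,
    H.boxPullback_leafFlux hF hc hUc (hψ.mdifferentiable one_ne_zero) hψs]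
  exact (H.isHarmonicGraphFamily hF hc).integral_deriv_mul_energy
    (isDirichletFormOn_energyForm hc inter_subset_left) (c.symm.isOpen_inter_preimage H.isOpen)
    (contDiff_chartExtension hc hψ (hψs.trans hUc))
    (hasCompactSupport_chartExtension (hψs.trans hUc))
    (tsupport_chartExtension_subset_preimage hUc hψs)

end IsFoliatedBox

/-- `ψ` is of class `C¹` and supported in a foliated box contained in the domain of a chart. -/
def IsSupportedInBox (F : Foliation (EuclideanSpace ℝ (Fin n)) unitInterval (K × unitInterval))
    (ψ : K → ℝ) : Prop :=
  ContMDiff (𝓡 n) 𝓘(ℝ, ℝ) 1 ψ ∧ ∃ c ∈ atlas (EuclideanSpace ℝ (Fin n)) K, ∃ q₀ U h C,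
    IsFoliatedBox F q₀ U h C ∧ U ⊆ c.source ∧ tsupport ψ ⊆ U

theorem exists_isSupportedInBox_partition [T2Space K] (hF : IsHarmonicFoliation F)
    (hL : IsLipschitzFoliation F) : ∃ (T : Finset K) (φ : T → K → ℝ),
      (∀ i, IsSupportedInBox F (φ i)) ∧ (∀ i q, 0 ≤ φ i q) ∧ ∀ q, ∑ i, φ i q = 1 := by
  have : LocallyConnectedSpace K :=
    ChartedSpace.locallyConnectedSpace (EuclideanSpace ℝ (Fin n)) K
  choose U hU h C H using fun q : K ↦ hF.1.exists_isFoliatedBox hL q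
    ((chartAt (EuclideanSpace ℝ (Fin n)) q).open_source.mem_nhds (mem_chart_source _ q))
  obtain ⟨T, hT⟩ := isCompact_univ.elim_finite_subcover U (fun q ↦ (H q).isOpen)
    fun q _ ↦ mem_iUnion.2 ⟨q, (H q).mem⟩
  obtain ⟨φ, hφ⟩ := SmoothPartitionOfUnity.exists_isSubordinate (𝓡 n) isClosed_univ
    (fun i : T ↦ U i) (fun i ↦ (H i).isOpen) (hT.trans_eq (biUnion_eq_iUnion ..))
  refine ⟨T, fun i ↦ φ i, fun i ↦ ⟨(φ i).contMDiff.of_le (by norm_cast), _, chart_mem_atlas _ i.1,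
    _, _, _, _, H i, hU i, hφ i⟩, φ.nonneg, fun q ↦ ?_⟩
  rw [← finsum_eq_sum_of_fintype]
  exact φ.sum_eq_one (mem_univ q)

variable [MeasurableSpace K] [BorelSpace K] {μ : Measure K}
  [IsContMDiffRiemannianBundle (𝓡 n) ∞ (EuclideanSpace ℝ (Fin n))
    (fun x : K ↦ TangentSpace (𝓡 n) x)]

namespace IsSupportedInBox

theorem ae_integrable_weightedLeafEnergy (hψ : IsSupportedInBox F ψ) (hF : IsHarmonicFoliation F)
    (hμ : IsRiemannianVolume (n := n) μ) : ∀ᵐ q ∂μ, Integrable (weightedLeafEnergy F ψ q) := by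
  obtain ⟨hψ1, c, hc, q₀, U, h, C, H, hUc, hψs⟩ := hψ
  exact H.ae_integrable_of_integrable_boxPullback hF.1 hμ hc hUc
    (fun q hq ↦ weightedLeafEnergy_eq_zero (image_eq_zero_of_notMem_tsupport fun h ↦ hq (hψs h)))
    (H.integrable_boxPullback_weightedLeafEnergy hF hc hUc hψ1 hψs)

theorem integrable_integral_weightedLeafEnergy (hψ : IsSupportedInBox F ψ)
    (hF : IsHarmonicFoliation F) (hμ : IsRiemannianVolume (n := n) μ) :
    Integrable (fun q ↦ ∫ s, weightedLeafEnergy F ψ q s) μ := by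
  obtain ⟨hψ1, c, hc, q₀, U, h, C, H, hUc, hψs⟩ := hψ
  exact H.integrable_integral_of_integrable_boxPullback hF.1 hμ hc hUc
    (fun q hq ↦ weightedLeafEnergy_eq_zero (image_eq_zero_of_notMem_tsupport fun h ↦ hq (hψs h)))
    (H.integrable_boxPullback_weightedLeafEnergy hF hc hUc hψ1 hψs)

theorem ae_integrable_leafFlux (hψ : IsSupportedInBox F ψ) (hF : IsHarmonicFoliation F)
    (hμ : IsRiemannianVolume (n := n) μ) : ∀ᵐ q ∂μ, Integrable (leafFlux F ψ q) := by
  obtain ⟨hψ1, c, hc, q₀, U, h, C, H, hUc, hψs⟩ := hψ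
  exact H.ae_integrable_of_integrable_boxPullback hF.1 hμ hc hUc
    (fun q hq ↦ leafFlux_eq_zero fun h ↦ hq (hψs h))
    (H.integrable_boxPullback_leafFlux hF hc hUc hψ1 hψs)

theorem integrable_integral_leafFlux (hψ : IsSupportedInBox F ψ) (hF : IsHarmonicFoliation F)
    (hμ : IsRiemannianVolume (n := n) μ) : Integrable (fun q ↦ ∫ s, leafFlux F ψ q s) μ := by
  obtain ⟨hψ1, c, hc, q₀, U, h, C, H, hUc, hψs⟩ := hψ
  exact H.integrable_integral_of_integrable_boxPullback hF.1 hμ hc hUc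
    (fun q hq ↦ leafFlux_eq_zero fun h ↦ hq (hψs h))
    (H.integrable_boxPullback_leafFlux hF hc hUc hψ1 hψs)

theorem integral_weightedLeafEnergy (hψ : IsSupportedInBox F ψ) (hF : IsHarmonicFoliation F)
    (hμ : IsRiemannianVolume (n := n) μ) :
    ∫ q, (∫ s, weightedLeafEnergy F ψ q s) ∂μ = -2 * ∫ q, (∫ s, leafFlux F ψ q s) ∂μ := by
  obtain ⟨hψ1, c, hc, q₀, U, h, C, H, hUc, hψs⟩ := hψ
  rw [← H.integral_boxPullback hF.1 hμ hc hUc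
      (fun q hq ↦ weightedLeafEnergy_eq_zero (image_eq_zero_of_notMem_tsupport fun h ↦ hq (hψs h)))
      (H.integrable_boxPullback_weightedLeafEnergy hF hc hUc hψ1 hψs),
    ← H.integral_boxPullback hF.1 hμ hc hUc
      (fun q hq ↦ leafFlux_eq_zero fun h ↦ hq (hψs h))
      (H.integrable_boxPullback_leafFlux hF hc hUc hψ1 hψs)]
  exact H.integral_boxPullback_weightedLeafEnergy hF hc hUc hψ1 hψs

end IsSupportedInBox

theorem sum_integral_leafFlux_eq_zero (hF : IsHarmonicFoliation F)
    (hμ : IsRiemannianVolume (n := n) μ) (hφ : ∀ i, IsSupportedInBox F (φ i))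
    (hsum : ∀ q, ∑ i, φ i q = 1) : ∑ i, ∫ q, (∫ s, leafFlux F (φ i) q s) ∂μ = 0 := by
  rw [← integral_finsetSum _ fun i _ ↦ (hφ i).integrable_integral_leafFlux hF hμ]
  refine integral_eq_zero_of_ae ?_
  filter_upwards [ae_all_iff.2 fun i ↦ (hφ i).ae_integrable_leafFlux hF hμ] with q hq
  rw [← integral_finsetSum _ fun i _ ↦ hq i]
  simp only [sum_leafFlux_eq_zero (fun i ↦ (hφ i).1.mdifferentiable one_ne_zero) hsum q,
    integral_zero, Pi.zero_apply]

theorem ae_leafGradient_eq_zero (hF : IsHarmonicFoliation F) (hμ : IsRiemannianVolume (n := n) μ)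
    (hφ : ∀ i, IsSupportedInBox F (φ i)) (hφ0 : ∀ i q, 0 ≤ φ i q) (hsum : ∀ q, ∑ i, φ i q = 1) :
    ∀ᵐ q ∂μ, ∀ᵐ s, leafGradient F q s = 0 := by
  have hnonneg : ∀ i q s, 0 ≤ weightedLeafEnergy F (φ i) q s := fun i q s ↦
    mul_nonneg (hφ0 i q) real_inner_self_nonneg
  have hintegral : ∀ i, ∫ q, (∫ s, weightedLeafEnergy F (φ i) q s) ∂μ = 0 := by
    have htotal : ∑ i, ∫ q, (∫ s, weightedLeafEnergy F (φ i) q s) ∂μ = 0 := by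
      simp only [(hφ _).integral_weightedLeafEnergy hF hμ]
      rw [← Finset.mul_sum, sum_integral_leafFlux_eq_zero hF hμ hφ hsum, mul_zero]
    exact fun i ↦ (Finset.sum_eq_zero_iff_of_nonneg fun i _ ↦ integral_nonneg fun q ↦
      integral_nonneg (hnonneg i q)).1 htotal i (Finset.mem_univ i)
  have hslice : ∀ i, ∀ᵐ q ∂μ, ∀ᵐ s, weightedLeafEnergy F (φ i) q s = 0 := fun i ↦ by
    have hzero := (integral_eq_zero_iff_of_nonneg (fun q ↦ integral_nonneg (hnonneg i q))
      ((hφ i).integrable_integral_weightedLeafEnergy hF hμ)).1 (hintegral i)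
    filter_upwards [hzero, (hφ i).ae_integrable_weightedLeafEnergy hF hμ] with q hq hint
    exact (integral_eq_zero_iff_of_nonneg (hnonneg i q) hint).1 hq
  filter_upwards [ae_all_iff.2 hslice] with q hq
  obtain ⟨j, -, hj⟩ := Finset.exists_ne_zero_of_sum_ne_zero ((hsum q).trans_ne one_ne_zero)
  filter_upwards [hq j] with s hs
  exact inner_self_eq_zero.1 ((mul_eq_zero.1 hs).resolve_left hj)

end GlobalEnergy

/-! ### Vanishing leafwise gradient -/

section Expanding

theorem deriv_ne_zero_of_isBigO_sub {f : ℝ → ℝ} {t : ℝ} (hf : DifferentiableAt ℝ f t)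
    (hO : (fun s ↦ s - t) =O[𝓝 t] fun s ↦ f s - f t) : deriv f t ≠ 0 := fun hzero ↦ by
  have hlittle := hasDerivAt_iff_isLittleO.1 (hzero ▸ hf.hasDerivAt)
  simp only [smul_zero, sub_zero] at hlittle
  have hne : ∀ᶠ s in 𝓝[≠] t, s - t ≠ 0 :=
    eventually_nhdsWithin_of_forall fun s hs ↦ sub_ne_zero.2 hs
  exact Asymptotics.isLittleO_irrefl (hne.frequently.filter_mono nhdsWithin_le_nhds)
    (hO.trans_isLittleO hlittle)

variable {f : unitInterval → unitInterval} {C : ℝ≥0}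

theorem deriv_realExtension_ne_zero
    (he : ∀ s, ∀ᶠ t in 𝓝 s, dist s t ≤ C * dist (f s) (f t)) {t : ℝ} (ht : t ∈ Ioo 0 1)
    (hd : DifferentiableAt ℝ (realExtension f) t) : deriv (realExtension f) t ≠ 0 := by
  refine deriv_ne_zero_of_isBigO_sub hd (.of_bound C ?_)
  have hproj : Tendsto (projIcc (0 : ℝ) 1 zero_le_one) (𝓝 t)
    (𝓝 (projIcc 0 1 zero_le_one t)) := continuous_projIcc.continuousAt
  filter_upwards [hproj.eventually (he _), Icc_mem_nhds ht.1 ht.2] with s hs hs01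
  rw [projIcc_of_mem _ hs01, projIcc_of_mem _ (Ioo_subset_Icc_self ht)] at hs
  rw [realExtension, IccExtend_of_mem _ _ hs01, IccExtend_of_mem _ _ (Ioo_subset_Icc_self ht),
    ← dist_eq_norm, ← dist_eq_norm, dist_comm s, dist_comm (f _ : ℝ)]
  exact hs

theorem ae_of_ae_unitInterval (hf : LipschitzWith C f) (hm : Monotone f)
    (hs : Function.Surjective f) (he : ∀ s, ∀ᶠ t in 𝓝 s, dist s t ≤ C * dist (f s) (f t))
    {p : unitInterval → Prop} (hp : ∀ᵐ s, p s) :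
    ∀ᵐ t : ℝ, t ∈ Ioo 0 1 → p (f (projIcc 0 1 zero_le_one t)) := by
  have hzero : {s | ¬ p s}.indicator (1 : unitInterval → ℝ) =ᵐ[volume] 0 :=
    hp.mono fun s hs ↦ indicator_of_notMem (not_not.2 hs) _
  have hint := (integrable_unitInterval_iff hf hm hs).1 ((integrable_congr hzero).2
    (integrable_zero _ _ _))
  have hintegral := (integral_unitInterval_eq hf hm hs _).symm.trans
    (integral_eq_zero_of_ae hzero)
  have hnonneg : ∀ t, 0 ≤ deriv (realExtension f) t • {s | ¬ p s}.indicator (1 : unitInterval → ℝ)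
      (f (projIcc 0 1 zero_le_one t)) := fun t ↦
    mul_nonneg (monotone_realExtension hm).deriv_nonneg (indicator_nonneg (fun _ _ ↦ zero_le_one) _)
  filter_upwards [(integral_eq_zero_iff_of_nonneg hnonneg hint).1 hintegral,
    (lipschitzWith_realExtension hf).ae_differentiableAt_real] with t ht hd ht01
  have hmem := (smul_eq_zero.1 ht).resolve_left (deriv_realExtension_ne_zero he ht01 hd)
  by_contra hpt
  rw [indicator_of_mem hpt] at hmem
  exact one_ne_zero hmem

end Expanding

namespace IsHarmonicGraphFamily

variable {E : Type*} [NormedAddCommGroup E] [NormedSpace ℝ E] [FiniteDimensional ℝ E]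
  [MeasurableSpace E] [BorelSpace E] {a : E → LinearMap.BilinForm ℝ (E →L[ℝ] ℝ)} {μ : Measure E}
  {h : E → ℝ → ℝ} {Ω : Set E} {C : ℝ≥0}

theorem eqOn_ball_of_ae_graphDifferential_eq_zero [SFinite μ] [μ.IsOpenPosMeasure]
    (H : IsHarmonicGraphFamily a μ h Ω C) (hΩ : IsOpen Ω) {y₀ : E} {r : ℝ}
    (hr : Metric.closedBall y₀ r ⊆ Ω)
    (hzero : ∀ᵐ y ∂μ, y ∈ Ω → ∀ᵐ t, graphDifferential h (y, t) = 0) {y : E}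
    (hy : y ∈ Metric.ball y₀ r) : h y = h y₀ := by
  have hball : Metric.ball y₀ r ⊆ Ω := Metric.ball_subset_closedBall.trans hr
  have hy₀ : y₀ ∈ Metric.ball y₀ r := Metric.mem_ball_self (Metric.pos_of_mem_ball hy)
  obtain ⟨g, hg, -, -, hgh⟩ := H.exists_continuous_extension hΩ
    (isCompact_closedBall y₀ r) hr
  have hcongr : ∀ z ∈ Metric.ball y₀ r, ∀ t, graphDifferential g (z, t) =
      graphDifferential h (z, t) := fun z hz t ↦
    graphDifferential_congr hgh (p := (z, t)) (Metric.ball_subset_closedBall hz)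
  have hae : ∀ᵐ z ∂μ.restrict (Metric.ball y₀ r), ∀ᵐ t, graphDifferential g (z, t) = 0 := by
    rw [ae_restrict_iff' Metric.isOpen_ball.measurableSet]
    filter_upwards [hzero] with z hz hzb
    simpa only [hcongr z hzb] using hz (hball hzb)
  rw [Measure.ae_ae_comm (p := fun z t ↦ graphDifferential g (z, t) = 0)
    (measurable_graphDifferential hg (measurableSet_singleton 0))] at hae
  refine (H.lipschitz y (hball hy)).continuous.ext_on (Measure.dense_of_ae hae)
    (H.lipschitz y₀ (hball hy₀)).continuous fun t ht ↦ ?_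
  have hC1 := (H.isWeaklyHarmonicOn t).1.mono hball
  have hfderiv : EqOn (fderiv ℝ (h · t)) 0 (Metric.ball y₀ r) := by
    refine Measure.eqOn_open_of_ae_eq (μ := μ) ?_ Metric.isOpen_ball
      (hC1.continuousOn_fderiv_of_isOpen Metric.isOpen_ball le_rfl) continuousOn_const
    filter_upwards [ht, ae_restrict_mem Metric.isOpen_ball.measurableSet] with z hz hzb
    exact (hcongr z hzb t).symm.trans hz
  exact Metric.isOpen_ball.is_const_of_fderiv_eq_zero (convex_ball y₀ r).isPreconnected
    (hC1.differentiableOn one_ne_zero) hfderiv hy hy₀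

end IsHarmonicGraphFamily

section VanishingGradient

variable {n : ℕ} {K : Type*} [TopologicalSpace K] [ChartedSpace (EuclideanSpace ℝ (Fin n)) K]
  [IsManifold (𝓡 n) ∞ K] [RiemannianBundle (fun x : K ↦ TangentSpace (𝓡 n) x)]
  [IsContMDiffRiemannianBundle (𝓡 n) ∞ (EuclideanSpace ℝ (Fin n))
    (fun x : K ↦ TangentSpace (𝓡 n) x)]
  {F : Foliation (EuclideanSpace ℝ (Fin n)) unitInterval (K × unitInterval)} {q₀ : K}
  {U : Set K} {h : K → unitInterval → unitInterval} {C : ℝ≥0}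
  {c : OpenPartialHomeomorph K (EuclideanSpace ℝ (Fin n))} {y : EuclideanSpace ℝ (Fin n)}

namespace IsFoliatedBox

theorem ae_graphDifferential_eq_zero (H : IsFoliatedBox F q₀ U h C) (hF : IsHarmonicFoliation F)
    (hc : c ∈ atlas (EuclideanSpace ℝ (Fin n)) K) (hy : y ∈ c.target ∩ c.symm ⁻¹' U)
    (hX : ∀ᵐ s, leafGradient F (c.symm y) s = 0) :
    ∀ᵐ t, graphDifferential (boxGraph c h) (y, t) = 0 := by
  have hends : ∀ᵐ t : ℝ, t ∉ ({0, 1} : Set ℝ) :=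
    measure_eq_zero_iff_ae_notMem.1 (Set.Countable.measure_zero (by simp) _)
  filter_upwards [hends, ae_of_ae_unitInterval (H.lipschitz _ hy.2)
    (H.strictMono hF.1 hy.2).monotone (H.surjective hF.1 hy.2) (H.expanding _ hy.2) hX]
    with t ht01 ht
  by_cases htI : t ∈ Icc 0 1
  · rw [← Ioo_union_both zero_le_one] at htI
    exact H.graphDifferential_eq_zero hF hc hy (ht (htI.resolve_right ht01))
  · exact (H.isHarmonicGraphFamily hF hc).graphDifferential_eq_zero
      (c.symm.isOpen_inter_preimage H.isOpen) hy htI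

variable [MeasurableSpace K] [BorelSpace K] {μ : Measure K}

theorem eventually_eq_of_ae_leafGradient_eq_zero (H : IsFoliatedBox F q₀ U h C)
    (hF : IsHarmonicFoliation F) (hμ : IsRiemannianVolume (n := n) μ)
    (hX : ∀ᵐ q ∂μ, ∀ᵐ s, leafGradient F q s = 0) : ∀ᶠ q in 𝓝 q₀, ∀ t, h q t = t := by
  set c := chartAt (EuclideanSpace ℝ (Fin n)) q₀
  have hc : c ∈ atlas (EuclideanSpace ℝ (Fin n)) K := chart_mem_atlas _ q₀
  have hq₀ : q₀ ∈ c.source := mem_chart_source _ q₀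
  have hΩ := c.symm.isOpen_inter_preimage H.isOpen
  obtain ⟨r, hr, hrΩ⟩ := Metric.nhds_basis_closedBall.mem_iff.1 (hΩ.mem_nhds
    ⟨c.map_source hq₀, by rw [mem_preimage, c.left_inv hq₀]; exact H.mem⟩)
  have hzero : ∀ᵐ y, y ∈ c.target ∩ c.symm ⁻¹' U →
      ∀ᵐ t, graphDifferential (boxGraph c h) (y, t) = 0 := by
    filter_upwards [(hμ.ae_iff hc).1 (hX.mono fun q hq _ ↦ hq)] with y hy hyΩ
    exact H.ae_graphDifferential_eq_zero hF hc hyΩ (hy hyΩ.1)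
  filter_upwards [c.open_source.mem_nhds hq₀,
    (c.continuousAt hq₀).preimage_mem_nhds (Metric.ball_mem_nhds _ hr)] with q hq hqr t
  have heq := congrFun ((H.isHarmonicGraphFamily hF hc).eqOn_ball_of_ae_graphDifferential_eq_zero
    hΩ hrΩ hzero hqr) t
  simp only [boxGraph, realExtension, IccExtend_val, c.left_inv hq, c.left_inv hq₀] at heq
  exact (Subtype.ext heq).trans (H.base t)

end IsFoliatedBox

variable [MeasurableSpace K] [BorelSpace K] {μ : Measure K}

theorem isProductFoliation_of_ae_leafGradient_eq_zero [LocallyConnectedSpace K]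
    (hF : IsHarmonicFoliation F) (hL : IsLipschitzFoliation F) (hμ : IsRiemannianVolume (n := n) μ)
    (hX : ∀ᵐ q ∂μ, ∀ᵐ s, leafGradient F q s = 0) : IsProductFoliation F := by
  refine isProductFoliation_of_constant_sections hF.1 fun q t ↦ ?_
  obtain ⟨U, -, h, C, H⟩ := hF.1.exists_isFoliatedBox hL q univ_mem
  have hconst := H.eventually_eq_of_ae_leafGradient_eq_zero hF hμ hX
  refine ⟨_, inter_mem (H.isOpen.mem_nhds H.mem) hconst,
    ((H.leafContinuousOn t).mono inter_subset_left).congr fun q' hq' ↦ ?_⟩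
  rw [hq'.2 t]

end VanishingGradient

theorem mainTheorem6 {n : ℕ} {K : Type*} [TopologicalSpace K] [T2Space K] [CompactSpace K]
    [ChartedSpace (EuclideanSpace ℝ (Fin n)) K] [IsManifold (𝓡 n) ∞ K]
    [RiemannianBundle (fun x : K ↦ TangentSpace (𝓡 n) x)]
    [IsContMDiffRiemannianBundle (𝓡 n) ∞ (EuclideanSpace ℝ (Fin n))
      (fun x : K ↦ TangentSpace (𝓡 n) x)]
    (F : Foliation (EuclideanSpace ℝ (Fin n)) unitInterval (K × unitInterval))
    (hF : IsHarmonicFoliation F) (hLip : IsLipschitzFoliation F) :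
    IsProductFoliation F := by
  borelize K
  have : LocallyConnectedSpace K :=
    ChartedSpace.locallyConnectedSpace (EuclideanSpace ℝ (Fin n)) K
  obtain ⟨μ, hμ⟩ := exists_isRiemannianVolume (n := n) (K := K)
  obtain ⟨T, φ, hφ, hφ0, hsum⟩ := exists_isSupportedInBox_partition hF hLip
  exact isProductFoliation_of_ae_leafGradient_eq_zero hF hLip hμ
    (ae_leafGradient_eq_zero hF hμ hφ hφ0 hsum)
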